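/- Fix constants $c>0$, $d\in\mathbb R$, $\lambda_\pm\in(0,1]$, $\varrho_\pm>0$, where for $d<0$ we suppose that $-c/d$ is an integer and that $\varrho_\pm<-c/d$. Let $S=\mathbb N\cup\{0\}$ if $d\ge 0$ and $S=\{0,1,\dots,-c/d\}$ if $d<0$. For every integer $N\ge 2$ put $\Lambda_N=\{1,\dots,N-1\}$ and let $(\eta^N_{tN^2})_{t\ge0}$ be the càdlàg Markov jump process on $S^{\Lambda_N}$ with initial law $\mu^N$, under which $\mathbb E_{\mu^N}[\eta_0(x)^2]<\infty$ for all $x\in\Lambda_N$, and generator $N^2\mathcal L_N$, where $$\mathcal L_Nf(\eta)=\sum_{x=1}^{N-2}\ \sum_{(y,z)\in\{(x,x+1),(x+1,x)\}}\eta(y)(c+d\eta(z))[f(\eta-\delta_y+\delta_z)-f(\eta)]$$ $$+\sum_{(x,\lambda,\varrho)\in\{(1,\lambda_-,\varrho_-),(N-1,\lambda_+,\varrho_+)\}}\Big(\lambda\varrho(c+d\eta(x))[f(\eta+\delta_x)-f(\eta)]+\lambda\eta(x)(c+d\varrho)[f(\eta-\delta_x)-f(\eta)]\Big)$$ (boundary-driven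 partial exclusion, inclusion, independent particles). Let $\varrho^N_t(x)=\mathbb E_{\mu^N}[\eta_{tN^2}(x)]$ for $x\in\Lambda_N$, $\varrho^N_t(0)=\varrho_-$, $\varrho^N_t(N)=\varrho_+$, and define for $x,y\in\Lambda_N$ $$\varphi^N_t(x,y)=\mathbb E_{\mu^N}\big[(\eta_{tN^2}(x)-\varrho^N_t(x))(\eta_{tN^2}(y)-\varrho^N_t(y))\big]\quad(x\ne y),$$ $$\varphi^N_t(x,x)=\mathbb E_{\mu^N}\Big[\tfrac{c}{c+d}\,\eta_{tN^2}(x)(\eta_{tN^2}(x)-1)\Big]-\varrho^N_t(x)^2 ;$$ if $c+d=0$ (at most one particle per site) $\varphi^N_t$ is not defined on the diagonal and the diagonal is left out of all maxima below. Put $T_N=\{(x,y)\in(\Lambda_N)^2: x\le y\}$, $\mathcal D^+_N=\{(x,y)\in T_N:y=x+1\}$ and $g^N_t(z,z+1)=dN^2(\varrho^N_t(z+1)-\varrho^N_t(z))^2$. Let $(\mathcal X_{tN^2})_{t\ge0}$ be the random walk on $\{(x,y):0\le x\le y\le N\}$ that is absorbed at the points $(0,y)$ and $(x,N)$ and has elsewhere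 the generator $$\Delta^{2D}_Nf(x,y)=N^2\sum_{\epsilon=\pm1}\Big(c_{x,x+\epsilon}[f(x+\epsilon,y)-f(x,y)]+c_{y,y+\epsilon}[f(x,y+\epsilon)-f(x,y)]\Big)$$ $$+\,dN^2[f(x,x)+f(x+1,x+1)-2f(x,x+1)]\,\mathbb 1_{\{y=x+1\}},$$ where $f(a,b)=f(b,a)$, $c_{1,0}=c\lambda_-$, $c_{N-1,N}=c\lambda_+$, and the other rates $c_{z,z\pm1}$ equal $c$; let $\mathcal T_N(x,y)=\mathbb E_{(x,y)}\big[\int_0^\infty\mathbb 1(\mathcal X_{tN^2}\in\mathcal D^+_N)\,dt\big]$. Then $\mathbb E_{\mu^N}[\eta_{tN^2}(x)^2]<\infty$ for all $N\ge2$, $t\ge0$, $x\in\Lambda_N$, and: 1. For every $N\ge2$ and $t\ge0$, $$\max_{(x,y)\in T_N}|\varphi^N_t(x,y)|\le\max_{(x,y)\in T_N}|\varphi^N_0(x,y)|+\sup_{r\ge0}\max_{1\le z\le N-2}|g^N_r(z,z+1)|\max_{(x,y)\in T_N}\mathcal T_N(x,y).$$ 2. Suppose, in the case $d\ne0$, that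 $\max_{0\le x\le N-1}|\varrho^N_0(x+1)-\varrho^N_0(x)|\lesssim\frac1N$. If $\max_{(x,y)\in(\Lambda_N)^2}|\varphi^N_0(x,y)|\lesssim\frac1N$, then for every $T>0$ $$\sup_{t\in[0,T]}\ \max_{(x,y)\in(\Lambda_N)^2}|\varphi^N_t(x,y)|\lesssim\frac1N .$$ Here $a_N\lesssim 1/N$ means that there is a constant $C$, independent of $N$, with $a_N\le C/N$ for all $N\ge2$; maxima over empty sets are $0$. -/

import Mathlib

open MeasureTheory ProbabilityTheory Topology Filter
open scoped NNReal ENNReal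

noncomputable section

namespace BoundaryDriven

/-- The parameters of the model: the constants `c`, `d` of the bulk rates, the reservoir couplings
`lamL`, `lamR` (at the left and at the right end) and the reservoir densities `rhoL`, `rhoR`.
None of them depends on the scaling parameter `N`. -/
structure Params where
  c : ℝ
  d : ℝ
  lamL : ℝ
  lamR : ℝ
  rhoL : ℝ
  rhoR : ℝ
  c_pos : 0 < c
  /-- For `d < 0` the set of occupation numbers is `{0, …, κ}` with `c + d κ = 0`
  (no particle jumps to a full site). -/
  exclusion : d < 0 → ∃ κ : ℕ, c + d * κ = 0
  lamL_pos : 0 < lamL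
  lamL_le : lamL ≤ 1
  lamR_pos : 0 < lamR
  lamR_le : lamR ≤ 1
  rhoL_pos : 0 < rhoL
  rhoL_lt : d < 0 → rhoL < -c / d
  rhoR_pos : 0 < rhoR
  rhoR_lt : d < 0 → rhoR < -c / d

/-- The bulk `{1, …, N - 1}`. -/
abbrev Bulk (N : ℕ) : Type := Set.Ioo 0 N

/-- Configurations: the number of particles at every site of the bulk. -/
abbrev Config (N : ℕ) : Type := Bulk N → ℕ

/-- The state space of the particle system: `S ^ Bulk` with `S = {k : ℕ | 0 ≤ c + d k}`, that is
`S = ℕ` for `0 ≤ d` and `S = {0, …, -c / d}` for `d < 0`. -/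
def stateSpace (π : Params) (N : ℕ) : Set (Config N) :=
  {η | ∀ x, 0 ≤ π.c + π.d * η x}

/-- `η + δ_x`. -/
def addAt {N : ℕ} (η : Config N) (x : Bulk N) : Config N :=
  Function.update η x (η x + 1)

/-- `η - δ_x`; it is only used with a rate that vanishes when `η x = 0`. -/
def removeAt {N : ℕ} (η : Config N) (x : Bulk N) : Config N :=
  Function.update η x (η x - 1)

/-- `η - δ_x + δ_y`. -/
def move {N : ℕ} (η : Config N) (x y : Bulk N) : Config N :=
  addAt (removeAt η x) y

/-- The rate `η(x) (c + d η(y))` of a jump from `x` to `y`. -/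
def rate (π : Params) {N : ℕ} (η : Config N) (x y : Bulk N) : ℝ :=
  η x * (π.c + π.d * η y)

/-- The bulk generator: the sum over the bonds `{x, x + 1}` inside the bulk. -/
def bulkGen (π : Params) (N : ℕ) (f : Config N → ℝ) (η : Config N) : ℝ :=
  ∑ x : Bulk N, ∑ y : Bulk N,
    if (y : ℕ) = x + 1 then
      rate π η x y * (f (move η x y) - f η) + rate π η y x * (f (move η y x) - f η)
    else 0

/-- The contribution of a reservoir with coupling `lam` and density `rho` attached to `x`. -/
def reservoirGen (π : Params) (lam rho : ℝ) {N : ℕ} (x : Bulk N) (f : Config N → ℝ)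
    (η : Config N) : ℝ :=
  lam * rho * (π.c + π.d * η x) * (f (addAt η x) - f η)
    + lam * η x * (π.c + π.d * rho) * (f (removeAt η x) - f η)

/-- The boundary generator: reservoirs at the sites `1` and `N - 1`. -/
def boundaryGen (π : Params) (N : ℕ) (f : Config N → ℝ) (η : Config N) : ℝ :=
  ∑ x : Bulk N,
    ((if (x : ℕ) = 1 then reservoirGen π π.lamL π.rhoL x f η else 0)
      + (if (x : ℕ) + 1 = N then reservoirGen π π.lamR π.rhoR x f η else 0))

/-- The generator of the particle system in the diffusive time scale `t N²`. -/
def particleGen (π : Params) (N : ℕ) (f : Config N → ℝ) (η : Config N) : ℝ :=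
  (N : ℝ) ^ 2 * (bulkGen π N f η + boundaryGen π N f η)

/-- `X` is, under `P`, a continuous-time Markov jump process with state space `S` (a subset of the
countable discrete space `E`) and generator `L`: its trajectories are càdlàg in `S`, and it solves
the martingale problem for `L`, with the finitely supported functions as test functions. -/
structure IsJumpProcess {Ω E : Type*} [MeasurableSpace Ω] [TopologicalSpace E] [MeasurableSpace E]
    (S : Set E) (L : (E → ℝ) → E → ℝ) (P : Measure Ω) (X : ℝ≥0 → Ω → E) : Prop where
  isProbabilityMeasure : IsProbabilityMeasure P
  mem : ∀ t ω, X t ω ∈ S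
  rightContinuous : ∀ ω t, ContinuousWithinAt (fun s => X s ω) (Set.Ici t) t
  leftLimits : ∀ ω t, ∃ l, Tendsto (fun s => X s ω) (𝓝[<] t) (𝓝 l)
  martingale : ∃ ℱ : Filtration ℝ≥0 (inferInstance : MeasurableSpace Ω),
    (∀ t, Measurable[ℱ t] (X t)) ∧
    ∀ f : E → ℝ, f.support.Finite →
      Martingale (fun (t : ℝ≥0) ω => f (X t ω) - ∫ s in (0 : ℝ)..t, L f (X s.toNNReal ω)) ℱ P

section Correlations

variable (π : Params) {N : ℕ} {Ω : Type*} [MeasurableSpace Ω] (P : Measure Ω)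
  (η : ℝ≥0 → Ω → Config N)

/-- The discrete density profile at time `t`, with the reservoir densities at `0` and at `N`
(the value beyond `N` is never used). -/
def density (t : ℝ≥0) (x : ℕ) : ℝ :=
  if h : x ∈ Set.Ioo 0 N then ∫ ω, (η t ω ⟨x, h⟩ : ℝ) ∂P
  else if x = 0 then π.rhoL else π.rhoR

/-- The two-points correlation function at time `t`. The value on the diagonal is only meaningful,
and only used, when `c + d ≠ 0`. -/
def corr (t : ℝ≥0) (x y : Bulk N) : ℝ :=
  if x = y then
    ∫ ω, π.c / (π.c + π.d) * ((η t ω x : ℝ) * ((η t ω x : ℝ) - 1)) ∂P - density π P η t x ^ 2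
  else
    ∫ ω, ((η t ω x : ℝ) - density π P η t x) * ((η t ω y : ℝ) - density π P η t y) ∂P

/-- The value at `(z, z + 1)` of the source term in the evolution equation of the correlations. -/
def source (t : ℝ≥0) (z : ℕ) : ℝ :=
  π.d * (N : ℝ) ^ 2 * (density π P η t (z + 1) - density π P η t z) ^ 2

end Correlations

/-- The pairs of sites where the correlation function is defined: all pairs, except those on the
diagonal when `c + d = 0` (at most one particle per site). -/
def pairs (π : Params) (N : ℕ) : Set (Bulk N × Bulk N) :=
  {p | p.1 = p.2 → π.c + π.d ≠ 0}

/-- The pairs `(x, y)` with `x ≤ y` where the correlation function is defined. -/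
def triangle (π : Params) (N : ℕ) : Set (Bulk N × Bulk N) :=
  {p | p ∈ pairs π N ∧ p.1 ≤ p.2}

/-- The closed triangle `{(x, y) | 0 ≤ x ≤ y ≤ N}`, state space of the random walk. -/
def closedTriangle (N : ℕ) : Set (ℕ × ℕ) :=
  {p | p.1 ≤ p.2 ∧ p.2 ≤ N}

/-- The upper diagonal `{(x, x + 1) | 1 ≤ x, x + 1 ≤ N - 1}`. -/
def upperDiagonal (N : ℕ) : Set (ℕ × ℕ) :=
  {p | 0 < p.1 ∧ p.2 = p.1 + 1 ∧ p.2 < N}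

/-- The rate `c_{z, z - 1}`. -/
def rateDown (π : Params) (z : ℕ) : ℝ := if z = 1 then π.c * π.lamL else π.c

/-- The rate `c_{z, z + 1}`. -/
def rateUp (π : Params) (N z : ℕ) : ℝ := if z + 1 = N then π.c * π.lamR else π.c

/-- The symmetric extension of a function on the closed triangle. -/
def symmExt (f : ℕ × ℕ → ℝ) (x y : ℕ) : ℝ := f (min x y, max x y)

/-- The generator, in the time scale `t N²`, of the two-dimensional random walk on the closed
triangle, absorbed at the points `(0, y)` and `(x, N)`. -/
def walkGen (π : Params) (N : ℕ) (f : ℕ × ℕ → ℝ) (p : ℕ × ℕ) : ℝ :=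
  if p.1 = 0 ∨ p.2 = N then 0
  else (N : ℝ) ^ 2 *
    (rateDown π p.1 * (symmExt f (p.1 - 1) p.2 - f p)
      + rateUp π N p.1 * (symmExt f (p.1 + 1) p.2 - f p)
      + rateDown π p.2 * (symmExt f p.1 (p.2 - 1) - f p)
      + rateUp π N p.2 * (symmExt f p.1 (p.2 + 1) - f p)
      + (if p.2 = p.1 + 1 then π.d * (f (p.1, p.1) + f (p.2, p.2) - 2 * f p) else 0))

/-- The process `X` with the measures `Q p` is the random walk in the time scale `t N²`, started
from `p` under `Q p`. -/
def IsTriangleWalk (π : Params) (N : ℕ) {W : Type*} [MeasurableSpace W]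
    (Q : ℕ × ℕ → Measure W) (X : ℝ≥0 → W → ℕ × ℕ) : Prop :=
  ∀ p ∈ closedTriangle N,
    IsJumpProcess (closedTriangle N) (walkGen π N) (Q p) X ∧ ∀ᵐ w ∂(Q p), X 0 w = p

/-- The expected time that the walk spends in the upper diagonal when it starts from `p`. -/
def occupationTime (N : ℕ) {W : Type*} [MeasurableSpace W]
    (Q : ℕ × ℕ → Measure W) (X : ℝ≥0 → W → ℕ × ℕ) (p : ℕ × ℕ) : ℝ≥0∞ :=
  ∫⁻ w, (∫⁻ t in Set.Ici (0 : ℝ),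
    (upperDiagonal N).indicator (fun _ => (1 : ℝ≥0∞)) (X t.toNNReal w)) ∂(Q p)

end BoundaryDriven

end

open BoundaryDriven

noncomputable section

namespace BoundaryDriven

/-! ### Measurability and Dynkin's formula for jump processes -/

section JumpProcess

variable {Ω E : Type*} [MeasurableSpace Ω] [TopologicalSpace E] [MeasurableSpace E]
  {S : Set E} {L : (E → ℝ) → E → ℝ}
  {P : Measure Ω} {X : ℝ≥0 → Ω → E}

/-! The model is dual to at most two particles. The net current through a bond is linear, since `η x
(c + d η y) - η y (c + d η x) = c (η x - η y)`, so the density solves a closed discrete heat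
equation (`particleGen_coord`). With the factor `c / (c + d)` on the diagonal the quadratic
functions `dual` are also closed: on them the particle generator acts as the generator of the
two-dimensional walk (`particleGen_dual_of_lt`, `particleGen_dual_self`). The product of two
densities misses this equation only on the upper diagonal, by `d N² (∇ρ)²` (`walkGen_tensor`). Hence
the correlations solve an inhomogeneous equation for the walk with this source
(`hasDerivAt_corrExt`), and they vanish on the absorbing boundary, where occupation numbers are
deterministic.

The first bound is the norm of Duhamel's formula `corrExt_eq_walk`: the initial correlations are
averaged over the walk, and the source is integrated along the time the walk spends in the upper
diagonal.

The second bound uses no walk, but the parabolic maximum principle `le_of_deriv_nonpos_at_max`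
twice. Applied to the flux, that is, conductance times gradient, it propagates the `1 / N` bound on
the density gradient (`abs_density_gradient_le`), so that the source is bounded uniformly in `N`.
Applied to the correlations minus a multiple of an explicit supersolution, it yields
`abs_corrExt_le`: by `walkGen_barrier_le` the function `barrier` is superharmonic and decreases at
rate of order `N³` on the upper diagonal, while its size is of order `N²`. A bounded source
therefore contributes `O(1 / N)`, uniformly in time.

If `c + d = 0` the rate of entering the diagonal is `c + d = 0`, so the diagonal drops out of both
arguments.

The process is only given through its martingale problem with finitely supported test functions.
Bulk jumps conserve the number of particles and the drift due to the reservoirs is bounded above, so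
second moments stay finite; a cutoff in the number of particles then extends Dynkin's formula to
functions of quadratic growth (`IsJumpProcess.dynkin_quadratic`). -/

lemma IsJumpProcess.measurable_eval (h : IsJumpProcess S L P X) (t : ℝ≥0) : Measurable (X t) := by
  obtain ⟨ℱ, hm, -⟩ := h.martingale
  exact (hm t).mono (ℱ.le t) le_rfl

variable [DiscreteMeasurableSpace E]

lemma IsJumpProcess.measurable_comp (h : IsJumpProcess S L P X) (g : E → ℝ) (t : ℝ≥0) :
    Measurable (fun ω => g (X t ω)) :=
  (Measurable.of_discrete (f := g)).comp (h.measurable_eval t)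

/-- A right-continuous process with values in a discrete space is jointly measurable. -/
lemma IsJumpProcess.measurable_uncurry [DiscreteTopology E] (h : IsJumpProcess S L P X)
    (g : E → ℝ) : Measurable (fun p : ℝ × Ω => g (X p.1.toNNReal p.2)) := by
  suffices H : Measurable (fun p : ℝ≥0 × Ω => g (X p.1 p.2)) from
    H.comp (measurable_real_toNNReal.prodMap measurable_id)
  -- The next point to the right of `t` on the grid of mesh `1 / (n + 1)`: right-continuity gives
  -- the limit in `n`, and for fixed `n` only countably many times occur, which makes joint
  -- measurability elementary.
  let a : ℕ → ℝ≥0 → ℝ≥0 := fun n t => ((⌊t * (n + 1)⌋₊ : ℝ≥0) + 1) / (n + 1)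
  have hlt : ∀ n t, t ≤ a n t := fun n t => by
    have h1 : (0 : ℝ≥0) < n + 1 := by positivity
    rw [le_div_iff₀ h1]
    exact (Nat.lt_floor_add_one _).le
  have hle : ∀ n t, a n t ≤ t + 1 / (n + 1) := fun n t => by
    have h1 : (0 : ℝ≥0) < n + 1 := by positivity
    rw [div_le_iff₀ h1, add_mul, one_div_mul_cancel h1.ne']
    gcongr
    exact Nat.floor_le (by positivity)
  have ha : ∀ t, Tendsto (fun n => a n t) atTop (𝓝[≥] t) := fun t => by
    refine tendsto_nhdsWithin_iff.2 ⟨?_, Eventually.of_forall fun n => hlt n t⟩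
    refine tendsto_of_tendsto_of_tendsto_of_le_of_le tendsto_const_nhds ?_
      (fun n => hlt n t) (fun n => hle n t)
    have : Tendsto (fun n : ℕ => (1 : ℝ≥0) / (n + 1)) atTop (𝓝 0) :=
      tendsto_one_div_add_atTop_nhds_zero_nat
    simpa using this.const_add t
  refine measurable_of_tendsto_metrizable (f := fun n p => g (X (a n p.1) p.2)) (fun n => ?_) ?_
  · have h1 : Measurable (fun q : ℕ × Ω => g (X (((q.1 : ℝ≥0) + 1) / (n + 1)) q.2)) :=
      measurable_from_prod_countable_right fun k =>
        h.measurable_comp g (((k : ℝ≥0) + 1) / (n + 1))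
    have h2 : Measurable (fun p : ℝ≥0 × Ω => ((⌊p.1 * (n + 1)⌋₊, p.2) : ℕ × Ω)) :=
      (Nat.measurable_floor.comp (measurable_fst.mul_const _)).prodMk measurable_snd
    have h3 := h1.comp h2
    simpa only [Function.comp_def, a] using h3
  · rw [tendsto_pi_nhds]
    rintro ⟨t, ω⟩
    have h1 : Tendsto (fun n => X (a n t) ω) atTop (𝓝 (X t ω)) :=
      (h.rightContinuous ω t).tendsto.comp (ha t)
    exact ((continuous_of_discreteTopology (f := g)).tendsto _).comp h1

/-- The expectation of a bounded function of the process is a measurable function of time. -/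
lemma IsJumpProcess.stronglyMeasurable_integral [DiscreteTopology E]
    (h : IsJumpProcess S L P X) (g : E → ℝ) :
    StronglyMeasurable (fun s : ℝ => ∫ ω, g (X s.toNNReal ω) ∂P) := by
  have := h.isProbabilityMeasure
  exact (h.measurable_uncurry g).stronglyMeasurable.integral_prod_right'

lemma IsJumpProcess.integrable_comp (h : IsJumpProcess S L P X) {g : E → ℝ} {C : ℝ}
    (hC : ∀ e ∈ S, |g e| ≤ C) (t : ℝ≥0) : Integrable (fun ω => g (X t ω)) P := by
  have := h.isProbabilityMeasure
  exact Integrable.of_bound (h.measurable_comp g t).aestronglyMeasurable C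
    (Eventually.of_forall fun ω => hC _ (h.mem t ω))

/-- Dynkin's formula for a finitely supported function. -/
theorem IsJumpProcess.dynkin [DiscreteTopology E] (h : IsJumpProcess S L P X) {f : E → ℝ}
    (hf : f.support.Finite) {C : ℝ} (hC : ∀ e ∈ S, |L f e| ≤ C) (t : ℝ≥0) :
    ∫ ω, f (X t ω) ∂P
      = ∫ ω, f (X 0 ω) ∂P + ∫ s in (0 : ℝ)..t, ∫ ω, L f (X s.toNNReal ω) ∂P := by
  have := h.isProbabilityMeasure
  obtain ⟨ℱ, -, hm⟩ := h.martingale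
  have hmart := hm f hf
  obtain ⟨D, hD⟩ : ∃ D, ∀ e, |f e| ≤ D := by
    obtain ⟨D, hD⟩ := (hf.image (fun e => |f e|)).bddAbove
    refine ⟨max D 0, fun e => ?_⟩
    by_cases he : f e = 0
    · simp [he]
    · exact le_max_of_le_left (hD ⟨e, he, rfl⟩)
  have hfi : ∀ t, Integrable (fun ω => f (X t ω)) P :=
    h.integrable_comp (fun e _ => hD e)
  -- The time integral is the difference of two integrable variables, `f (X t)` and the martingale.
  have hint : Integrable (fun ω => ∫ s in (0 : ℝ)..t, L f (X s.toNNReal ω)) P := by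
    refine ((hfi t).sub (hmart.integrable t)).congr (Eventually.of_forall fun ω => ?_)
    simp
  have key : ∫ ω, (f (X t ω) - ∫ s in (0 : ℝ)..t, L f (X s.toNNReal ω)) ∂P
      = ∫ ω, f (X 0 ω) ∂P := by
    have h1 := hmart.setIntegral_eq (zero_le (a := t)) (MeasurableSet.univ)
    simpa using h1.symm
  rw [integral_sub (hfi t) hint] at key
  have hswap : ∫ ω, (∫ s in (0 : ℝ)..t, L f (X s.toNNReal ω)) ∂P
      = ∫ s in (0 : ℝ)..t, ∫ ω, L f (X s.toNNReal ω) ∂P := by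
    simp only [intervalIntegral.integral_of_le t.coe_nonneg]
    refine integral_integral_swap ?_
    refine Integrable.of_bound (C := C) ?_ ?_
    · have h2 := (h.measurable_uncurry (L f)).comp (measurable_swap (α := Ω) (β := ℝ))
      exact h2.aestronglyMeasurable
    · exact Eventually.of_forall fun p => hC _ (h.mem _ _)
  linarith

end JumpProcess

/-! ### Particle number and its conservation in the bulk -/

section Configurations

variable {N : ℕ}

/-- The total number of particles. -/
def mass (η : Config N) : ℕ := ∑ x, η x

lemma le_mass (η : Config N) (x : Bulk N) : η x ≤ mass η :=
  Finset.single_le_sum (f := η) (fun _ _ => Nat.zero_le _) (Finset.mem_univ x)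

lemma mass_addAt (η : Config N) (x : Bulk N) : mass (addAt η x) = mass η + 1 := by
  unfold mass addAt
  rw [Finset.sum_update_of_mem (Finset.mem_univ x),
    Finset.sum_eq_add_sum_sdiff_singleton_of_mem (Finset.mem_univ x) η]
  ring

lemma addAt_removeAt {η : Config N} {x : Bulk N} (h : η x ≠ 0) : addAt (removeAt η x) x = η := by
  ext y
  by_cases hy : y = x
  · subst hy; simp [addAt, removeAt]; omega
  · simp [addAt, removeAt, hy]

lemma mass_removeAt {η : Config N} {x : Bulk N} (h : η x ≠ 0) :
    mass (removeAt η x) + 1 = mass η := by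
  rw [← mass_addAt _ x, addAt_removeAt h]

lemma mass_move {η : Config N} {x : Bulk N} (h : η x ≠ 0) (y : Bulk N) :
    mass (move η x y) = mass η := by
  rw [move, mass_addAt, mass_removeAt h]

lemma finite_mass_le (N n : ℕ) : {η : Config N | mass η ≤ n}.Finite :=
  (Set.finite_Iic (fun _ : Bulk N => n)).subset fun η hη x => (le_mass η x).trans hη

lemma rate_eq_zero (π : Params) {η : Config N} {x : Bulk N} (h : η x = 0) (y : Bulk N) :
    rate π η x y = 0 := by simp [rate, h]

lemma sum_ite_coe_eq (k : ℕ) (g : Bulk N → ℝ) :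
    ∑ x : Bulk N, (if (x : ℕ) = k then g x else 0)
      = if h : k ∈ Set.Ioo 0 N then g ⟨k, h⟩ else 0 := by
  split_ifs with h
  · rw [Finset.sum_eq_single ⟨k, h⟩]
    · simp
    · intro b _ hb
      rw [if_neg]
      exact fun hk => hb (Subtype.ext hk)
    · simp
  · refine Finset.sum_eq_zero fun x _ => if_neg ?_
    rintro rfl
    exact h x.2

/-- Every bulk jump of nonzero rate conserves the number of particles, so functions of `mass` act as
constants. Thus a cutoff in `mass` creates no commutator with the bulk dynamics. -/
lemma bulkGen_mul_mass (π : Params) (f : Config N → ℝ) (χ : ℕ → ℝ) (η : Config N) :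
    bulkGen π N (fun η => f η * χ (mass η)) η = bulkGen π N f η * χ (mass η) := by
  have key : ∀ x y : Bulk N, rate π η x y
      * (f (move η x y) * χ (mass (move η x y)) - f η * χ (mass η))
      = rate π η x y * (f (move η x y) - f η) * χ (mass η) := fun x y => by
    by_cases hx : η x = 0
    · simp [rate_eq_zero π hx]
    · rw [mass_move hx]; ring
  simp only [bulkGen, key, Finset.sum_mul, ite_mul, zero_mul, add_mul]

lemma bulkGen_comp_mass (π : Params) (F : ℕ → ℝ) (η : Config N) :
    bulkGen π N (fun η => F (mass η)) η = 0 := by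
  have := bulkGen_mul_mass π (fun _ => 1) F η
  simpa [bulkGen] using this

lemma boundaryGen_eq (π : Params) (f : Config N → ℝ) (η : Config N) :
    boundaryGen π N f η =
      (if h : 1 ∈ Set.Ioo 0 N then reservoirGen π π.lamL π.rhoL ⟨1, h⟩ f η else 0) +
      (if h : N - 1 ∈ Set.Ioo 0 N then reservoirGen π π.lamR π.rhoR ⟨N - 1, h⟩ f η else 0) := by
  rw [boundaryGen, Finset.sum_add_distrib, sum_ite_coe_eq,
    ← sum_ite_coe_eq (N - 1) (fun x => reservoirGen π π.lamR π.rhoR x f η)]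
  congr 1
  refine Finset.sum_congr rfl fun x _ => ?_
  have := x.2.1
  have := x.2.2
  congr 1
  exact propext (by omega)

lemma boundaryGen_le (π : Params) {f : Config N → ℝ} {η : Config N} {B : ℝ} (hB : 0 ≤ B)
    (hL : ∀ x, reservoirGen π π.lamL π.rhoL x f η ≤ B)
    (hR : ∀ x, reservoirGen π π.lamR π.rhoR x f η ≤ B) : boundaryGen π N f η ≤ 2 * B := by
  rw [boundaryGen_eq, two_mul]
  refine add_le_add ?_ ?_
  · split_ifs with h
    exacts [hL _, hB]
  · split_ifs with h
    exacts [hR _, hB]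

lemma abs_boundaryGen_le (π : Params) {f : Config N → ℝ} {η : Config N} {B : ℝ} (hB : 0 ≤ B)
    (hL : ∀ x, |reservoirGen π π.lamL π.rhoL x f η| ≤ B)
    (hR : ∀ x, |reservoirGen π π.lamR π.rhoR x f η| ≤ B) : |boundaryGen π N f η| ≤ 2 * B := by
  rw [boundaryGen_eq, two_mul]
  refine (abs_add_le _ _).trans (add_le_add ?_ ?_)
  · split_ifs with h
    exacts [hL _, by simpa using hB]
  · split_ifs with h
    exacts [hR _, by simpa using hB]

lemma particleGen_sub_const (π : Params) (f : Config N → ℝ) (k : ℝ) (η : Config N) :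
    particleGen π N (fun η => f η - k) η = particleGen π N f η := by
  simp [particleGen, bulkGen, boundaryGen, reservoirGen]

/-- A jump changes `mass` by at most one: if `f` lives on `mass ≤ n`, then `particleGen π N f` lives
on `mass ≤ n + 1`, a finite set. -/
lemma exists_abs_particleGen_le (π : Params) {f : Config N → ℝ} (hf : f.support.Finite) :
    ∃ C, ∀ η, |particleGen π N f η| ≤ C := by
  obtain ⟨n, hn⟩ := (hf.image mass).bddAbove
  have hz : ∀ η, n < mass η → f η = 0 := fun η h => by
    by_contra h'
    exact absurd (hn ⟨η, h', rfl⟩) (by omega)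
  have hgen : ∀ η, n + 1 < mass η → particleGen π N f η = 0 := fun η h => by
    have h0 : f η = 0 := hz _ (by omega)
    have hm : ∀ x y, rate π η x y * (f (move η x y) - f η) = 0 := fun x y => by
      by_cases hx : η x = 0
      · simp [rate_eq_zero π hx]
      · rw [h0, hz _ (by rw [mass_move hx]; omega)]; simp
    have hr : ∀ lam rho x, reservoirGen π lam rho x f η = 0 := fun lam rho x => by
      rw [reservoirGen, h0, hz (addAt η x) (by rw [mass_addAt]; omega)]
      by_cases hx : η x = 0
      · simp [hx]
      · rw [hz _ (by have := mass_removeAt hx; omega)]; simp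
    simp [particleGen, bulkGen, boundaryGen, hm, hr]
  obtain ⟨C, hC⟩ := ((finite_mass_le N (n + 1)).image
    (fun η => |particleGen π N f η|)).bddAbove
  refine ⟨max C 0, fun η => ?_⟩
  by_cases h : mass η ≤ n + 1
  · exact le_max_of_le_left (hC ⟨η, h, rfl⟩)
  · simp [hgen η (by omega)]

end Configurations

/-! ### Reservoir rates and the drift of the truncated particle number -/

section Rates

variable (π : Params) {N : ℕ}

lemma Params.rhoL_rate_nonneg : 0 ≤ π.c + π.d * π.rhoL := by
  rcases lt_or_ge π.d 0 with h | h
  · have := π.rhoL_lt h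
    rw [lt_div_iff_of_neg h] at this
    linarith
  · have := π.c_pos
    have := π.rhoL_pos
    positivity

lemma Params.rhoR_rate_nonneg : 0 ≤ π.c + π.d * π.rhoR := by
  rcases lt_or_ge π.d 0 with h | h
  · have := π.rhoR_lt h
    rw [lt_div_iff_of_neg h] at this
    linarith
  · have := π.c_pos
    have := π.rhoR_pos
    positivity

/-- A coupling and a density of a reservoir for which the rates are nonnegative. -/
structure Params.Admissible (lam rho : ℝ) : Prop where
  lam_pos : 0 < lam
  lam_le : lam ≤ 1
  rho_pos : 0 < rho
  rate_nonneg : 0 ≤ π.c + π.d * rho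

lemma Params.admissible_left : π.Admissible π.lamL π.rhoL :=
  ⟨π.lamL_pos, π.lamL_le, π.rhoL_pos, π.rhoL_rate_nonneg⟩

lemma Params.admissible_right : π.Admissible π.lamR π.rhoR :=
  ⟨π.lamR_pos, π.lamR_le, π.rhoR_pos, π.rhoR_rate_nonneg⟩

variable {π} {lam rho : ℝ}

lemma birth_nonneg (h : π.Admissible lam rho) {η : Config N} (hη : η ∈ stateSpace π N)
    (x : Bulk N) : 0 ≤ lam * rho * (π.c + π.d * η x) :=
  mul_nonneg (mul_nonneg h.lam_pos.le h.rho_pos.le) (hη x)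

lemma death_nonneg (h : π.Admissible lam rho) (η : Config N) (x : Bulk N) :
    0 ≤ lam * η x * (π.c + π.d * rho) :=
  mul_nonneg (mul_nonneg h.lam_pos.le (Nat.cast_nonneg _)) h.rate_nonneg

lemma birth_le (h : π.Admissible lam rho) (η : Config N) (x : Bulk N) :
    lam * rho * (π.c + π.d * η x) ≤ (π.c + |π.d|) * (1 + rho) * (1 + mass η) := by
  have h1 : (η x : ℝ) ≤ mass η := by exact_mod_cast le_mass η x
  have h2 := π.c_pos
  have h3 : π.c + π.d * η x ≤ (π.c + |π.d|) * (1 + mass η) := by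
    have : π.d * η x ≤ |π.d| * mass η :=
      mul_le_mul (le_abs_self _) h1 (Nat.cast_nonneg _) (abs_nonneg _)
    nlinarith [abs_nonneg π.d, (Nat.cast_nonneg (mass η) : (0 : ℝ) ≤ _)]
  have h4 : lam * rho ≤ 1 + rho := by nlinarith [h.lam_le, h.rho_pos]
  calc lam * rho * (π.c + π.d * η x) ≤ lam * rho * ((π.c + |π.d|) * (1 + mass η)) :=
        mul_le_mul_of_nonneg_left h3 (mul_nonneg h.lam_pos.le h.rho_pos.le)
    _ ≤ (1 + rho) * ((π.c + |π.d|) * (1 + mass η)) := by gcongr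
    _ = _ := by ring

lemma death_le (h : π.Admissible lam rho) (η : Config N) (x : Bulk N) :
    lam * η x * (π.c + π.d * rho) ≤ (π.c + |π.d|) * (1 + rho) * (1 + mass η) := by
  have h1 : (η x : ℝ) ≤ mass η := by exact_mod_cast le_mass η x
  have h2 := π.c_pos
  have h3 : π.c + π.d * rho ≤ (π.c + |π.d|) * (1 + rho) := by
    have : π.d * rho ≤ |π.d| * rho := mul_le_mul_of_nonneg_right (le_abs_self _) h.rho_pos.le
    nlinarith [abs_nonneg π.d, h.rho_pos]
  have h4 : lam * η x ≤ 1 + mass η := by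
    nlinarith [h.lam_le, h.lam_pos, (Nat.cast_nonneg (η x) : (0 : ℝ) ≤ _)]
  calc lam * η x * (π.c + π.d * rho) ≤ (1 + mass η) * ((π.c + |π.d|) * (1 + rho)) :=
        mul_le_mul h4 h3 h.rate_nonneg (by positivity)
    _ = _ := by ring

/-- The reservoirs feed a bounded number of particles per unit of time. -/
lemma reservoirGen_min_mass_le (h : π.Admissible lam rho) {η : Config N}
    (hη : η ∈ stateSpace π N) (x : Bulk N) (n : ℕ) :
    reservoirGen π lam rho x (fun η => ((min (mass η) n : ℕ) : ℝ)) η ≤ π.c * rho := by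
  have hb := birth_nonneg h hη x
  have hd := death_nonneg h η x
  have hc := π.c_pos
  have hl := h.lam_le
  have hl0 := h.lam_pos
  have hr := h.rho_pos
  rw [reservoirGen, mass_addAt]
  by_cases hx : η x = 0
  · rcases lt_or_ge (mass η) n with hn | hn
    · rw [min_eq_left hn, min_eq_left hn.le, hx]
      push_cast
      have : lam * (π.c * rho) ≤ 1 * (π.c * rho) := by gcongr
      linarith
    · rw [min_eq_right hn, min_eq_right (hn.trans (Nat.le_succ _)), hx]
      simp only [sub_self, mul_zero, Nat.cast_zero, zero_mul, zero_add]
      positivity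
  · have hm := mass_removeAt hx
    rcases lt_or_ge (mass η) n with hn | hn
    -- The terms with `d` cancel between birth and death: the drift is `lam * c * (rho - η x)`,
    -- bounded above although each rate may be unbounded.
    · rw [min_eq_left hn, min_eq_left hn.le,
        min_eq_left (show mass (removeAt η x) ≤ n by omega), ← hm]
      push_cast
      have h1 : lam * (π.c * rho) ≤ 1 * (π.c * rho) := by gcongr
      have h2 : 0 ≤ lam * π.c * η x := by positivity
      linarith
    · rw [min_eq_right hn, min_eq_right (hn.trans (Nat.le_succ _)), sub_self, mul_zero, zero_add]
      have h1 : ((min (mass (removeAt η x)) n : ℕ) : ℝ) - n ≤ 0 :=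
        sub_nonpos.2 (by exact_mod_cast min_le_right _ _)
      have h2 := mul_nonpos_of_nonneg_of_nonpos hd h1
      have : 0 ≤ π.c * rho := by positivity
      linarith

/-- The increments of `v ^ 2` are `± 2 v + 1`. The part `± 2 v` meets only the net drift, which is
bounded above, and the part `1` meets the rates, which are linear in `v`. The result is linear in
`v`, hence controlled by the first moment. Above the truncation level the function cannot increase.
-/
lemma reservoirGen_min_mass_sq_le (h : π.Admissible lam rho) {η : Config N}
    (hη : η ∈ stateSpace π N) (x : Bulk N) (n : ℕ) :
    reservoirGen π lam rho x (fun η => ((min (mass η) n : ℕ) : ℝ) ^ 2) η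
      ≤ 4 * ((π.c + |π.d|) * (1 + rho)) * (1 + (min (mass η) n : ℕ)) := by
  have hb := birth_nonneg h hη x
  have hd := death_nonneg h η x
  have hb' := birth_le h η x
  have hd' := death_le h η x
  have hc := π.c_pos
  have hl := h.lam_le
  have hl0 := h.lam_pos
  have hr := h.rho_pos
  set K := (π.c + |π.d|) * (1 + rho) with hK
  have hK0 : 0 ≤ K := by positivity
  have hcK : lam * (π.c * rho) ≤ K := by
    have h1 : lam * (π.c * rho) ≤ 1 * (π.c * rho) := by gcongr
    have h2 : π.c * rho ≤ K := by
      rw [hK]; nlinarith [abs_nonneg π.d, mul_nonneg (abs_nonneg π.d) hr.le]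
    linarith
  rw [reservoirGen, mass_addAt]
  rcases lt_or_ge (mass η) n with hn | hn
  · rw [min_eq_left hn, min_eq_left hn.le]
    have hV : (0 : ℝ) ≤ mass η := Nat.cast_nonneg _
    -- Birth rate minus death rate, times the factor `2 v` from the increment of the square.
    have h3 : lam * π.c * (rho - η x) * (2 * mass η) ≤ K * (2 * mass η) := by
      refine mul_le_mul_of_nonneg_right ?_ (by positivity)
      have : 0 ≤ lam * π.c * η x := by positivity
      linarith
    by_cases hx : η x = 0
    · rw [hx] at h3 hb hb' ⊢
      push_cast at h3 hb hb' ⊢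
      nlinarith
    · have hm := mass_removeAt hx
      rw [min_eq_left (show mass (removeAt η x) ≤ n by omega)]
      have hm' : (mass (removeAt η x) : ℝ) = mass η - 1 := by
        rw [← hm]; push_cast; ring
      rw [hm']
      push_cast
      nlinarith
  · rw [min_eq_right hn, min_eq_right (hn.trans (Nat.le_succ _)), sub_self, mul_zero, zero_add]
    have h1 : ((min (mass (removeAt η x)) n : ℕ) : ℝ) ^ 2 - (n : ℝ) ^ 2 ≤ 0 := by
      have : ((min (mass (removeAt η x)) n : ℕ) : ℝ) ≤ n := by exact_mod_cast min_le_right _ _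
      have := pow_le_pow_left₀ (Nat.cast_nonneg _) this 2
      linarith
    have h2 := mul_nonpos_of_nonneg_of_nonpos hd h1
    have : 0 ≤ 4 * K * (1 + (n : ℝ)) := by positivity
    linarith

variable (π N)

/-- `K` may depend on `N` but not on the truncation level `n`, which is later sent to infinity. -/
lemma exists_particleGen_min_mass_le :
    ∃ K, 0 ≤ K ∧ ∀ (n : ℕ), ∀ η ∈ stateSpace π N,
      particleGen π N (fun η => ((min (mass η) n : ℕ) : ℝ)) η ≤ K := by
  have hc := π.c_pos
  have hL := π.rhoL_pos
  have hR := π.rhoR_pos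
  refine ⟨(N : ℝ) ^ 2 * (2 * (π.c * (π.rhoL + π.rhoR))), by positivity, fun n η hη => ?_⟩
  rw [particleGen, bulkGen_comp_mass π (fun m => ((min m n : ℕ) : ℝ)), zero_add]
  refine mul_le_mul_of_nonneg_left (boundaryGen_le π (by positivity) (fun x => ?_) fun x => ?_)
    (by positivity)
  · refine (reservoirGen_min_mass_le π.admissible_left hη x n).trans ?_
    gcongr; linarith
  · refine (reservoirGen_min_mass_le π.admissible_right hη x n).trans ?_
    gcongr; linarith

lemma exists_particleGen_min_mass_sq_le :
    ∃ K, 0 ≤ K ∧ ∀ (n : ℕ), ∀ η ∈ stateSpace π N,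
      particleGen π N (fun η => ((min (mass η) n : ℕ) : ℝ) ^ 2) η
        ≤ K * (1 + (min (mass η) n : ℕ)) := by
  have hc := π.c_pos
  have hL := π.rhoL_pos
  have hR := π.rhoR_pos
  refine ⟨(N : ℝ) ^ 2 * (2 * (4 * ((π.c + |π.d|) * (1 + (π.rhoL + π.rhoR))))), by positivity,
    fun n η hη => ?_⟩
  rw [particleGen, bulkGen_comp_mass π (fun m => ((min m n : ℕ) : ℝ) ^ 2), zero_add,
    mul_assoc ((N : ℝ) ^ 2), mul_assoc (2 : ℝ)]
  refine mul_le_mul_of_nonneg_left (boundaryGen_le π (by positivity) (fun x => ?_) fun x => ?_)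
    (by positivity)
  · refine (reservoirGen_min_mass_sq_le π.admissible_left hη x n).trans ?_
    gcongr; linarith
  · refine (reservoirGen_min_mass_sq_le π.admissible_right hη x n).trans ?_
    gcongr; linarith

end Rates

/-! ### Propagation of second moments -/

section Moments

variable {π : Params} {N : ℕ} {Ω : Type*} [MeasurableSpace Ω] {P : Measure Ω}
  {X : ℝ≥0 → Ω → Config N}

/-- The bound includes negative `s`, which costs nothing: the integrands in use depend on
`s.toNNReal`, hence are constant there. -/
lemma intervalIntegrable_of_bound_le {G : ℝ → ℝ} (hG : StronglyMeasurable G)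
    (hb : ∀ T : ℝ, ∃ B, ∀ s ≤ T, |G s| ≤ B) (a b : ℝ) : IntervalIntegrable G volume a b := by
  obtain ⟨B, hB⟩ := hb (max a b)
  refine (intervalIntegrable_const (c := B)).mono_fun hG.aestronglyMeasurable ?_
  filter_upwards [ae_restrict_mem measurableSet_uIoc] with s hs
  have := hB s hs.2
  rw [Real.norm_eq_abs, Real.norm_eq_abs]
  exact this.trans (le_abs_self B)

lemma IsJumpProcess.intervalIntegrable_integral {g : Config N → ℝ} {C : ℝ}
    (h : IsJumpProcess (stateSpace π N) (particleGen π N) P X)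
    (hC : ∀ e ∈ stateSpace π N, |g e| ≤ C) (a b : ℝ) :
    IntervalIntegrable (fun s : ℝ => ∫ ω, g (X s.toNNReal ω) ∂P) volume a b := by
  have := h.isProbabilityMeasure
  refine intervalIntegrable_of_bound_le (h.stronglyMeasurable_integral g)
    (fun T => ⟨C, fun s _ => ?_⟩) a b
  have := norm_integral_le_of_norm_le_const (μ := P) (f := fun ω => g (X s.toNNReal ω))
    (Eventually.of_forall fun ω => hC _ (h.mem _ ω))
  simpa using this

/-- Generator and increments do not see constants, so functions that are constant off a finite set,
such as the truncated particle number, are legitimate test functions. -/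
lemma IsJumpProcess.dynkin_sub_const (h : IsJumpProcess (stateSpace π N) (particleGen π N) P X)
    {f : Config N → ℝ} {k : ℝ} (hf : (fun η => f η - k).support.Finite) (t : ℝ≥0) :
    ∫ ω, f (X t ω) ∂P
      = ∫ ω, f (X 0 ω) ∂P
        + ∫ s in (0 : ℝ)..t, ∫ ω, particleGen π N f (X s.toNNReal ω) ∂P := by
  have := h.isProbabilityMeasure
  obtain ⟨C, hC⟩ := exists_abs_particleGen_le π hf
  have key := h.dynkin hf (fun e _ => hC e) t
  obtain ⟨D, hD⟩ := (hf.image (fun η => |f η - k|)).bddAbove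
  have hint : ∀ t, Integrable (fun ω => f (X t ω)) P := h.integrable_comp (C := |k| + max D 0)
    fun η _ => by
      have h1 : |f η - k| ≤ max D 0 := by
        by_cases h0 : f η - k = 0
        · simp [h0]
        · exact le_max_of_le_left (hD ⟨η, h0, rfl⟩)
      calc |f η| = |k + (f η - k)| := by ring_nf
        _ ≤ |k| + |f η - k| := abs_add_le _ _
        _ ≤ _ := by gcongr
  simp only [particleGen_sub_const] at key
  rw [integral_sub (hint t) (integrable_const _), integral_sub (hint 0) (integrable_const _)] at key
  linarith

lemma finite_support_min_mass (F : ℕ → ℝ) (n : ℕ) :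
    (fun η : Config N => F (min (mass η) n) - F n).support.Finite := by
  refine (finite_mass_le N n).subset fun η hη => ?_
  by_contra h
  rw [Set.mem_ofPred_eq, not_le] at h
  exact hη (by simp [min_eq_right h.le])

/-- At every time the second moment of the number of particles is bounded, locally uniformly. -/
theorem IsJumpProcess.exists_integral_mass_sq_le
    (h : IsJumpProcess (stateSpace π N) (particleGen π N) P X)
    (h0 : Integrable (fun ω => (1 + (mass (X 0 ω) : ℝ)) ^ 2) P) (T : ℝ) :
    ∃ B, ∀ t : ℝ≥0, (t : ℝ) ≤ T → Integrable (fun ω => (1 + (mass (X t ω) : ℝ)) ^ 2) P ∧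
      ∫ ω, (1 + (mass (X t ω) : ℝ)) ^ 2 ∂P ≤ B := by
  have := h.isProbabilityMeasure
  obtain ⟨K₁, hK₁, h1⟩ := exists_particleGen_min_mass_le π N
  obtain ⟨K₂, hK₂, h2⟩ := exists_particleGen_min_mass_sq_le π N
  set M := ∫ ω, (1 + (mass (X 0 ω) : ℝ)) ^ 2 ∂P with hM
  have hint : ∀ (F : ℕ → ℝ) (n : ℕ) (t : ℝ≥0),
      Integrable (fun ω => F (min (mass (X t ω)) n)) P := fun F n t => by
    obtain ⟨C, hC⟩ := ((Set.finite_Iic n).image (fun m => |F m|)).bddAbove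
    exact h.integrable_comp (g := fun η => F (min (mass η) n)) (C := C)
      (fun η _ => hC ⟨_, Set.mem_Iic.2 (min_le_right _ _), rfl⟩) t
  have hgen : ∀ (F : ℕ → ℝ) (n : ℕ) a b, IntervalIntegrable (fun s : ℝ => ∫ ω,
      particleGen π N (fun η => F (min (mass η) n)) (X s.toNNReal ω) ∂P) volume a b :=
    fun F n => by
      obtain ⟨C, hC⟩ := exists_abs_particleGen_le π (finite_support_min_mass (N := N) F n)
      simp only [particleGen_sub_const] at hC
      exact h.intervalIntegrable_integral fun η _ => hC η
  have hgen' : ∀ (F : ℕ → ℝ) (n : ℕ) t, Integrable (fun ω =>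
      particleGen π N (fun η => F (min (mass η) n)) (X t ω)) P :=
    fun F n => by
      obtain ⟨C, hC⟩ := exists_abs_particleGen_le π (finite_support_min_mass (N := N) F n)
      simp only [particleGen_sub_const] at hC
      exact h.integrable_comp fun η _ => hC η
  have hmin : ∀ m n : ℕ, ((min m n : ℕ) : ℝ) ≤ m := fun m n => by exact_mod_cast min_le_left m n
  have hfirst : ∀ (n : ℕ) (t : ℝ≥0), (t : ℝ) ≤ T →
      ∫ ω, ((min (mass (X t ω)) n : ℕ) : ℝ) ∂P ≤ M + K₁ * T := fun n t ht => by
    rw [h.dynkin_sub_const (finite_support_min_mass (fun m => (m : ℝ)) n) t]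
    refine add_le_add ?_ ?_
    · refine integral_mono (hint (fun m => (m : ℝ)) n 0) h0 fun ω => ?_
      have := hmin (mass (X 0 ω)) n
      have h3 : (0 : ℝ) ≤ mass (X 0 ω) := Nat.cast_nonneg _
      dsimp only
      nlinarith
    · calc _ ≤ ∫ s in (0 : ℝ)..t, K₁ := by
            refine intervalIntegral.integral_mono_on t.coe_nonneg (hgen (fun m => (m : ℝ)) n _ _)
              intervalIntegrable_const fun s _ => ?_
            calc _ ≤ ∫ _, K₁ ∂P := integral_mono (hgen' (fun m => (m : ℝ)) n _)
                  (integrable_const _) fun ω => h1 n _ (h.mem _ ω)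
              _ = K₁ := by simp
        _ = K₁ * t := by simp [mul_comm]
        _ ≤ K₁ * T := by gcongr
  have hsecond : ∀ (n : ℕ) (t : ℝ≥0), (t : ℝ) ≤ T →
      ∫ ω, ((min (mass (X t ω)) n : ℕ) : ℝ) ^ 2 ∂P ≤ M + K₂ * (1 + (M + K₁ * T)) * T :=
    fun n t ht => by
    have hT : 0 ≤ T := t.coe_nonneg.trans ht
    have hM0 : 0 ≤ M := integral_nonneg fun ω => by positivity
    rw [h.dynkin_sub_const (finite_support_min_mass (fun m => (m : ℝ) ^ 2) n) t]
    refine add_le_add ?_ ?_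
    · refine integral_mono (hint (fun m => (m : ℝ) ^ 2) n 0) h0 fun ω => ?_
      have := hmin (mass (X 0 ω)) n
      dsimp only
      gcongr
      linarith
    · calc _ ≤ ∫ s in (0 : ℝ)..t, K₂ * (1 + (M + K₁ * T)) := by
            refine intervalIntegral.integral_mono_on t.coe_nonneg
              (hgen (fun m => (m : ℝ) ^ 2) n _ _) intervalIntegrable_const fun s hs => ?_
            have hs' : (s.toNNReal : ℝ) ≤ T := by
              rw [Real.coe_toNNReal s hs.1]; exact hs.2.trans ht
            calc _ ≤ ∫ ω, K₂ * (1 + ((min (mass (X s.toNNReal ω)) n : ℕ) : ℝ)) ∂P :=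
                  integral_mono (hgen' (fun m => (m : ℝ) ^ 2) n _)
                    (((integrable_const _).add (hint (fun m => (m : ℝ)) n _)).const_mul _)
                    fun ω => h2 n _ (h.mem _ ω)
              _ = K₂ * (1 + ∫ ω, ((min (mass (X s.toNNReal ω)) n : ℕ) : ℝ) ∂P) := by
                  rw [integral_const_mul,
                    integral_add (integrable_const _) (hint (fun m => (m : ℝ)) n _)]
                  simp
              _ ≤ _ := by have := hfirst n _ hs'; gcongr
        _ = K₂ * (1 + (M + K₁ * T)) * t := by
            rw [intervalIntegral.integral_const, smul_eq_mul]; ring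
        _ ≤ _ := by gcongr
  -- From `(1 + v) ^ 2 ≤ 2 + 2 * v ^ 2`.
  set B := 2 + 2 * (M + K₂ * (1 + (M + K₁ * T)) * T) with hB
  refine ⟨B, fun t ht => ?_⟩
  have hT : 0 ≤ T := t.coe_nonneg.trans ht
  have hM0 : 0 ≤ M := integral_nonneg fun ω => by positivity
  have hB0 : 0 ≤ B := by positivity
  -- Monotone convergence removes the truncation; integrability of the limit is not yet known, hence
  -- the lower integral.
  have hlim : Tendsto (fun n : ℕ => ∫⁻ ω,
      ENNReal.ofReal ((1 + ((min (mass (X t ω)) n : ℕ) : ℝ)) ^ 2) ∂P) atTop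
      (𝓝 (∫⁻ ω, ENNReal.ofReal ((1 + (mass (X t ω) : ℝ)) ^ 2) ∂P)) := by
    refine lintegral_tendsto_of_tendsto_of_monotone (fun n => ?_) ?_ ?_
    · exact (h.measurable_comp (fun η => (1 + ((min (mass η) n : ℕ) : ℝ)) ^ 2)
        t).ennreal_ofReal.aemeasurable
    · refine Eventually.of_forall fun ω m n hmn => ENNReal.ofReal_le_ofReal ?_
      have : ((min (mass (X t ω)) m : ℕ) : ℝ) ≤ (min (mass (X t ω)) n : ℕ) := by
        exact_mod_cast min_le_min_left _ hmn
      gcongr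
    · refine Eventually.of_forall fun ω => tendsto_const_nhds.congr' ?_
      filter_upwards [eventually_ge_atTop (mass (X t ω))] with n hn
      rw [min_eq_left hn]
  have hle : ∫⁻ ω, ENNReal.ofReal ((1 + (mass (X t ω) : ℝ)) ^ 2) ∂P ≤ ENNReal.ofReal B := by
    refine le_of_tendsto' hlim fun n => ?_
    rw [← ofReal_integral_eq_lintegral_ofReal (hint (fun m => (1 + (m : ℝ)) ^ 2) n t)
      (Eventually.of_forall fun ω => by positivity)]
    refine ENNReal.ofReal_le_ofReal ?_
    calc _ ≤ ∫ ω, (2 + 2 * ((min (mass (X t ω)) n : ℕ) : ℝ) ^ 2) ∂P := by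
          refine integral_mono (hint (fun m => (1 + (m : ℝ)) ^ 2) n t)
            ((integrable_const _).add ((hint (fun m => (m : ℝ) ^ 2) n t).const_mul _)) fun ω => ?_
          dsimp only
          nlinarith [sq_nonneg (((min (mass (X t ω)) n : ℕ) : ℝ) - 1)]
      _ = 2 + 2 * ∫ ω, ((min (mass (X t ω)) n : ℕ) : ℝ) ^ 2 ∂P := by
          rw [integral_add (integrable_const _) ((hint (fun m => (m : ℝ) ^ 2) n t).const_mul _),
            integral_const_mul]
          simp
      _ ≤ B := by have := hsecond n t ht; rw [hB]; gcongr
  have hmeas := (h.measurable_comp (fun η => (1 + (mass η : ℝ)) ^ 2) t).aestronglyMeasurable (μ := P)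
  have hI : Integrable (fun ω => (1 + (mass (X t ω) : ℝ)) ^ 2) P :=
    (lintegral_ofReal_ne_top_iff_integrable hmeas
      (Eventually.of_forall fun ω => by positivity)).1 (hle.trans_lt ENNReal.ofReal_lt_top).ne
  refine ⟨hI, ?_⟩
  rw [← ofReal_integral_eq_lintegral_ofReal hI (Eventually.of_forall fun ω => by positivity)] at hle
  exact (ENNReal.ofReal_le_ofReal_iff hB0).1 hle

end Moments

/-! ### Dynkin's formula for functions of quadratic growth -/

section QuadraticGrowth

variable {N : ℕ}

/-- The cutoff `(1 - v / (n + 1))⁺`. -/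
def cutoff (n v : ℕ) : ℝ := max 0 (1 - v / (n + 1))

lemma cutoff_nonneg (n v : ℕ) : 0 ≤ cutoff n v := le_max_left _ _

lemma cutoff_le_one (n v : ℕ) : cutoff n v ≤ 1 :=
  max_le zero_le_one (by have : (0 : ℝ) ≤ v / (n + 1) := by positivity
                         linarith)

lemma cutoff_eq_zero {n v : ℕ} (h : n + 1 ≤ v) : cutoff n v = 0 := by
  refine max_eq_left ?_
  have h1 : (0 : ℝ) < n + 1 := by positivity
  have : (1 : ℝ) ≤ v / (n + 1) := by
    rw [le_div_iff₀ h1]; exact_mod_cast (by omega : 1 * (n + 1) ≤ v)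
  linarith

/-- The slope is at most `1 / (n + 1)`, and there is no slope beyond `v = n`. This gain of a factor
`1 + v`, uniform in `n`, brings a quadratically growing function times the increment of the cutoff
down to linear growth. -/
lemma cutoff_step (n v : ℕ) : |cutoff n (v + 1) - cutoff n v| * (1 + v) ≤ 1 := by
  rcases le_or_gt (n + 1) v with h | h
  · simp [cutoff_eq_zero h, cutoff_eq_zero (h.trans (Nat.le_succ v))]
  · have h1 : (0 : ℝ) < n + 1 := by positivity
    have h2 : |cutoff n (v + 1) - cutoff n v| ≤ 1 / (n + 1) := by
      rw [cutoff, cutoff, max_comm 0, max_comm 0]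
      refine (abs_max_sub_max_le_abs _ _ _).trans (le_of_eq ?_)
      rw [show (1 - ((v + 1 : ℕ) : ℝ) / (n + 1)) - (1 - v / (n + 1)) = -(1 / (n + 1)) by
        push_cast; field_simp; ring, abs_neg, abs_of_pos (by positivity)]
    have h3 : (1 : ℝ) + v ≤ n + 1 := by exact_mod_cast (by omega : 1 + v ≤ n + 1)
    calc _ ≤ 1 / ((n : ℝ) + 1) * (n + 1) := by gcongr
      _ = 1 := by field_simp

lemma tendsto_cutoff (v : ℕ) : Tendsto (fun n => cutoff n v) atTop (𝓝 1) := by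
  have h1 : Tendsto (fun n : ℕ => (v : ℝ) / (n + 1)) atTop (𝓝 0) := by
    have := (tendsto_one_div_add_atTop_nhds_zero_nat (𝕜 := ℝ)).const_mul (v : ℝ)
    simpa [div_eq_mul_inv] using this
  have := (tendsto_const_nhds (x := (0 : ℝ))).max ((tendsto_const_nhds (x := (1 : ℝ))).sub h1)
  simpa [cutoff] using this

/-- `f` grows at most quadratically, its increments at most linearly, and its bulk generator at
most quadratically. -/
structure QuadraticGrowth (π : Params) (f : Config N → ℝ) (C : ℝ) : Prop where
  bound : ∀ η, |f η| ≤ C * (1 + mass η) ^ 2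
  step : ∀ η x, |f (addAt η x) - f η| ≤ C * (1 + mass η)
  bulk : ∀ η ∈ stateSpace π N, |bulkGen π N f η| ≤ C * (1 + mass η) ^ 2

variable {π : Params}

lemma QuadraticGrowth.nonneg {f : Config N → ℝ} {C : ℝ} (h : QuadraticGrowth π f C) : 0 ≤ C := by
  have h1 := (abs_nonneg _).trans (h.bound 0)
  exact nonneg_of_mul_nonneg_left h1 (by positivity)

lemma abs_reservoirGen_le {lam rho : ℝ} (h : π.Admissible lam rho) {f : Config N → ℝ} {D : ℝ}
    (hf : ∀ η x, |f (addAt η x) - f η| ≤ D * (1 + mass η)) {η : Config N}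
    (hη : η ∈ stateSpace π N) (x : Bulk N) :
    |reservoirGen π lam rho x f η|
      ≤ 2 * ((π.c + |π.d|) * (1 + rho)) * D * (1 + mass η) ^ 2 := by
  have hb := birth_nonneg h hη x
  have hd := death_nonneg h η x
  have hb' := birth_le h η x
  have hd' := death_le h η x
  have hc := π.c_pos
  have hr := h.rho_pos
  set K := (π.c + |π.d|) * (1 + rho)
  have hK : 0 ≤ K := by positivity
  have hD : 0 ≤ D := nonneg_of_mul_nonneg_left ((abs_nonneg _).trans (hf η x)) (by positivity)
  have h1 : |lam * rho * (π.c + π.d * η x) * (f (addAt η x) - f η)|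
      ≤ K * (1 + mass η) * (D * (1 + mass η)) := by
    rw [abs_mul, abs_of_nonneg hb]
    exact mul_le_mul hb' (hf η x) (abs_nonneg _) (by positivity)
  have h2 : |lam * η x * (π.c + π.d * rho) * (f (removeAt η x) - f η)|
      ≤ K * (1 + mass η) * (D * (1 + mass η)) := by
    by_cases hx : η x = 0
    · simp only [hx, Nat.cast_zero, mul_zero, zero_mul, abs_zero]; positivity
    · rw [abs_mul, abs_of_nonneg hd, abs_sub_comm]
      refine mul_le_mul hd' ?_ (abs_nonneg _) (by positivity)
      have h3 := hf (removeAt η x) x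
      rw [addAt_removeAt hx] at h3
      refine h3.trans ?_
      have h4 := mass_removeAt hx
      have h5 : (mass (removeAt η x) : ℝ) ≤ mass η := by exact_mod_cast (by omega)
      gcongr
  calc _ ≤ _ := abs_add_le _ _
    _ ≤ _ := add_le_add h1 h2
    _ = _ := by ring

lemma abs_particleGen_le {f : Config N → ℝ} {C D : ℝ}
    (hf : ∀ η x, |f (addAt η x) - f η| ≤ D * (1 + mass η)) {η : Config N}
    (hη : η ∈ stateSpace π N) (hbulk : |bulkGen π N f η| ≤ C * (1 + mass η) ^ 2) :
    |particleGen π N f η|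
      ≤ (N : ℝ) ^ 2 * (C + 4 * ((π.c + |π.d|) * (1 + (π.rhoL + π.rhoR))) * |D|)
        * (1 + mass η) ^ 2 := by
  have hc := π.c_pos
  have hL := π.rhoL_pos
  have hR := π.rhoR_pos
  have hb : |boundaryGen π N f η|
      ≤ 2 * (2 * ((π.c + |π.d|) * (1 + (π.rhoL + π.rhoR))) * |D| * (1 + mass η) ^ 2) := by
    have hf' : ∀ η x, |f (addAt η x) - f η| ≤ |D| * (1 + mass η) := fun η x =>
      (hf η x).trans (by gcongr; exact le_abs_self D)
    refine abs_boundaryGen_le π (by positivity) (fun x => ?_) fun x => ?_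
    · refine (abs_reservoirGen_le π.admissible_left hf' hη x).trans ?_
      gcongr; linarith
    · refine (abs_reservoirGen_le π.admissible_right hf' hη x).trans ?_
      gcongr; linarith
  rw [particleGen, abs_mul, abs_of_nonneg (by positivity : (0 : ℝ) ≤ (N : ℝ) ^ 2), mul_assoc]
  refine mul_le_mul_of_nonneg_left ?_ (by positivity)
  refine (abs_add_le _ _).trans ((add_le_add hbulk hb).trans (le_of_eq ?_))
  ring

/-- Discrete Leibniz rule with `cutoff_step` for the increment of the cutoff. The constant does not
depend on `n`, as dominated convergence requires. -/
lemma QuadraticGrowth.step_cutoff {f : Config N → ℝ} {C : ℝ} (h : QuadraticGrowth π f C) (n : ℕ)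
    (η : Config N) (x : Bulk N) :
    |f (addAt η x) * cutoff n (mass (addAt η x)) - f η * cutoff n (mass η)|
      ≤ 2 * C * (1 + mass η) := by
  have hC := h.nonneg
  rw [mass_addAt, show f (addAt η x) * cutoff n (mass η + 1) - f η * cutoff n (mass η)
    = (f (addAt η x) - f η) * cutoff n (mass η + 1)
      + f η * (cutoff n (mass η + 1) - cutoff n (mass η)) by ring]
  have h1 : |(f (addAt η x) - f η) * cutoff n (mass η + 1)| ≤ C * (1 + mass η) := by
    rw [abs_mul, abs_of_nonneg (cutoff_nonneg _ _), ← mul_one (C * (1 + (mass η : ℝ)))]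
    exact mul_le_mul (h.step η x) (cutoff_le_one _ _) (cutoff_nonneg _ _) (by positivity)
  have h2 : |f η * (cutoff n (mass η + 1) - cutoff n (mass η))| ≤ C * (1 + mass η) := by
    rw [abs_mul]
    calc _ ≤ C * (1 + mass η) ^ 2 * |cutoff n (mass η + 1) - cutoff n (mass η)| := by
          gcongr; exact h.bound η
      _ = C * (1 + mass η) * (|cutoff n (mass η + 1) - cutoff n (mass η)| * (1 + mass η)) := by
          ring
      _ ≤ C * (1 + mass η) * 1 := by gcongr; exact cutoff_step _ _
      _ = _ := mul_one _
  calc _ ≤ _ := abs_add_le _ _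
    _ ≤ _ := add_le_add h1 h2
    _ = _ := by ring

lemma tendsto_particleGen {f : Config N → ℝ} {g : ℕ → Config N → ℝ}
    (hg : ∀ η, Tendsto (fun n => g n η) atTop (𝓝 (f η))) (η : Config N) :
    Tendsto (fun n => particleGen π N (g n) η) atTop (𝓝 (particleGen π N f η)) := by
  unfold particleGen bulkGen boundaryGen reservoirGen
  refine ((tendsto_finsetSum _ fun x _ => tendsto_finsetSum _ fun y _ => ?_).add
    (tendsto_finsetSum _ fun x _ => Tendsto.add ?_ ?_)).const_mul _
  · split_ifs
    · exact (((hg _).sub (hg _)).const_mul _).add (((hg _).sub (hg _)).const_mul _)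
    · exact tendsto_const_nhds
  · split_ifs
    · exact (((hg _).sub (hg _)).const_mul _).add (((hg _).sub (hg _)).const_mul _)
    · exact tendsto_const_nhds
  · split_ifs
    · exact (((hg _).sub (hg _)).const_mul _).add (((hg _).sub (hg _)).const_mul _)
    · exact tendsto_const_nhds

variable {Ω : Type*} [MeasurableSpace Ω] {P : Measure Ω} {X : ℝ≥0 → Ω → Config N}

/-- Integrability and Dynkin's formula for functions of quadratic growth. -/
theorem IsJumpProcess.dynkin_quadratic
    (h : IsJumpProcess (stateSpace π N) (particleGen π N) P X)
    (h0 : Integrable (fun ω => (1 + (mass (X 0 ω) : ℝ)) ^ 2) P) {f : Config N → ℝ} {C : ℝ}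
    (hf : QuadraticGrowth π f C) :
    (∀ t, Integrable (fun ω => f (X t ω)) P) ∧
    Continuous (fun s : ℝ => ∫ ω, f (X s.toNNReal ω) ∂P) ∧
    ∀ t : ℝ≥0, ∫ ω, f (X t ω) ∂P = ∫ ω, f (X 0 ω) ∂P
        + ∫ s in (0 : ℝ)..t, ∫ ω, particleGen π N f (X s.toNNReal ω) ∂P := by
  have := h.isProbabilityMeasure
  have hC := hf.nonneg
  have hq : ∀ t, Integrable (fun ω => (1 + (mass (X t ω) : ℝ)) ^ 2) P := fun t =>
    ((h.exists_integral_mass_sq_le h0 t).choose_spec t le_rfl).1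
  have hdom : ∀ {g : Config N → ℝ} {D : ℝ}, (∀ η ∈ stateSpace π N, |g η| ≤ D * (1 + mass η) ^ 2) →
      ∀ t, Integrable (fun ω => g (X t ω)) P := fun {g D} hg t =>
    ((hq t).const_mul D).mono' (h.measurable_comp g t).aestronglyMeasurable
      (Eventually.of_forall fun ω => hg _ (h.mem t ω))
  have hloc : ∀ {g : Config N → ℝ} {D : ℝ}, 0 ≤ D →
      (∀ η ∈ stateSpace π N, |g η| ≤ D * (1 + mass η) ^ 2) → ∀ T : ℝ, ∀ B : ℝ,
      (∀ t : ℝ≥0, (t : ℝ) ≤ T → ∫ ω, (1 + (mass (X t ω) : ℝ)) ^ 2 ∂P ≤ B) →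
      ∀ t : ℝ≥0, (t : ℝ) ≤ T → |∫ ω, g (X t ω) ∂P| ≤ D * B := fun {g D} hD hg T B hB t ht => by
    refine (abs_integral_le_integral_abs).trans ?_
    calc _ ≤ ∫ ω, D * (1 + (mass (X t ω) : ℝ)) ^ 2 ∂P :=
          integral_mono (hdom hg t).abs ((hq t).const_mul D) fun ω => hg _ (h.mem t ω)
      _ = D * ∫ ω, (1 + (mass (X t ω) : ℝ)) ^ 2 ∂P := integral_const_mul _ _
      _ ≤ _ := by gcongr; exact hB t ht
  set D := (N : ℝ) ^ 2 * (C + 4 * ((π.c + |π.d|) * (1 + (π.rhoL + π.rhoR))) * |2 * C|) with hD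
  have hD0 : 0 ≤ D := by
    have hc := π.c_pos
    have hL := π.rhoL_pos
    have hR := π.rhoR_pos
    positivity
  have hLf : ∀ η ∈ stateSpace π N, |particleGen π N f η| ≤ D * (1 + mass η) ^ 2 := fun η hη =>
    abs_particleGen_le (fun η x => (hf.step η x).trans (by gcongr; linarith)) hη (hf.bulk η hη)
  -- The same `D` for all `n`: in the bulk the cutoff factors out, at the reservoirs its increments
  -- are absorbed by `step_cutoff`.
  have hLfn : ∀ n : ℕ, ∀ η ∈ stateSpace π N,
      |particleGen π N (fun η => f η * cutoff n (mass η)) η| ≤ D * (1 + mass η) ^ 2 :=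
    fun n η hη => abs_particleGen_le (hf.step_cutoff n) hη (by
      rw [bulkGen_mul_mass, abs_mul, abs_of_nonneg (cutoff_nonneg _ _)]
      calc _ ≤ |bulkGen π N f η| * 1 := by gcongr; exact cutoff_le_one _ _
        _ ≤ _ := by rw [mul_one]; exact hf.bulk η hη)
  have hfn : ∀ η, Tendsto (fun n => f η * cutoff n (mass η)) atTop (𝓝 (f η)) := fun η => by
    simpa using (tendsto_cutoff (mass η)).const_mul (f η)
  have hlim : ∀ t, Tendsto (fun n => ∫ ω, f (X t ω) * cutoff n (mass (X t ω)) ∂P) atTop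
      (𝓝 (∫ ω, f (X t ω) ∂P)) := fun t => by
    refine tendsto_integral_of_dominated_convergence
      (fun ω => C * (1 + (mass (X t ω) : ℝ)) ^ 2) (fun n => ?_) ((hq t).const_mul C)
      (fun n => Eventually.of_forall fun ω => ?_) (Eventually.of_forall fun ω => hfn _)
    · exact (h.measurable_comp (fun η => f η * cutoff n (mass η)) t).aestronglyMeasurable
    · rw [Real.norm_eq_abs, abs_mul, abs_of_nonneg (cutoff_nonneg _ _)]
      calc _ ≤ |f (X t ω)| * 1 := by gcongr; exact cutoff_le_one _ _
        _ ≤ _ := by rw [mul_one]; exact hf.bound _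
  have hlim' : ∀ t, Tendsto (fun n => ∫ ω,
      particleGen π N (fun η => f η * cutoff n (mass η)) (X t ω) ∂P) atTop
      (𝓝 (∫ ω, particleGen π N f (X t ω) ∂P)) := fun t => by
    refine tendsto_integral_of_dominated_convergence
      (fun ω => D * (1 + (mass (X t ω) : ℝ)) ^ 2) (fun n => ?_) ((hq t).const_mul D)
      (fun n => Eventually.of_forall fun ω => hLfn n _ (h.mem t ω))
      (Eventually.of_forall fun ω => tendsto_particleGen hfn _)
    exact (h.measurable_comp (particleGen π N fun η => f η * cutoff n (mass η))
      t).aestronglyMeasurable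
  have hdyn : ∀ t : ℝ≥0, ∫ ω, f (X t ω) ∂P = ∫ ω, f (X 0 ω) ∂P
        + ∫ s in (0 : ℝ)..t, ∫ ω, particleGen π N f (X s.toNNReal ω) ∂P := fun t => by
    have hsupp : ∀ n, (fun η : Config N => f η * cutoff n (mass η) - 0).support.Finite := fun n => by
      refine (finite_mass_le N n).subset fun η hη => ?_
      by_contra hlt
      rw [Set.mem_ofPred_eq, not_le] at hlt
      exact hη (by simp [cutoff_eq_zero (n := n) (v := mass η) hlt])
    refine tendsto_nhds_unique (hlim t) ?_
    -- Dynkin's formula for the finitely supported `f * cutoff n`; both sides converge by dominated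
    -- convergence, on the product of time and probability space in two stages.
    simp_rw [fun n => h.dynkin_sub_const (hsupp n) t]
    refine (hlim 0).add ?_
    obtain ⟨B, hB⟩ := h.exists_integral_mass_sq_le h0 t
    refine intervalIntegral.tendsto_integral_filter_of_dominated_convergence
      (fun _ => D * B) (Eventually.of_forall fun n => ?_) (Eventually.of_forall fun n => ?_)
      intervalIntegrable_const (Eventually.of_forall fun s _ => hlim' _)
    · exact (h.stronglyMeasurable_integral _).aestronglyMeasurable
    · refine Eventually.of_forall fun s hs => ?_
      rw [Set.uIoc_of_le t.coe_nonneg] at hs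
      refine hloc hD0 (hLfn n) t B (fun r hr => (hB r hr).2) _ ?_
      rw [Real.coe_toNNReal s hs.1.le]
      exact hs.2
  refine ⟨hdom (D := C) fun η _ => hf.bound η, ?_, hdyn⟩
  have hcont := intervalIntegral.continuous_primitive (intervalIntegrable_of_bound_le
    (h.stronglyMeasurable_integral (particleGen π N f)) fun T => by
      obtain ⟨B, hB⟩ := h.exists_integral_mass_sq_le h0 (max T 0)
      refine ⟨D * B, fun s hs => hloc hD0 hLf (max T 0) B (fun r hr => (hB r hr).2) _ ?_⟩
      rw [Real.coe_toNNReal']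
      exact max_le_max_right 0 hs) 0
  -- Continuity in time is read off from Dynkin's formula.
  have h2 : (fun s : ℝ => ∫ ω, f (X s.toNNReal ω) ∂P) = fun s => ∫ ω, f (X 0 ω) ∂P
      + ∫ r in (0 : ℝ)..(s.toNNReal : ℝ), ∫ ω, particleGen π N f (X r.toNNReal ω) ∂P :=
    funext fun s => hdyn _
  rw [h2]
  exact continuous_const.add (hcont.comp (NNReal.continuous_coe.comp continuous_real_toNNReal))

end QuadraticGrowth

/-! ### Generators and carré du champ of the occupation numbers -/

section Carre

variable (π : Params) {N : ℕ}

/-- The occupation numbers, extended by the reservoir densities to `0` and `N`. -/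
def extend (η : Config N) (x : ℕ) : ℝ :=
  if h : x ∈ Set.Ioo 0 N then (η ⟨x, h⟩ : ℝ) else if x = 0 then π.rhoL else π.rhoR

lemma extend_coe (η : Config N) (x : Bulk N) : extend π η x = η x := by
  rw [extend, dif_pos x.2]

lemma extend_zero (η : Config N) : extend π η 0 = π.rhoL := by simp [extend]

lemma extend_self (hN : N ≠ 0) (η : Config N) : extend π η N = π.rhoR := by simp [extend, hN]

/-- The carré du champ of the bulk generator. -/
def bulkCarre (f g : Config N → ℝ) (η : Config N) : ℝ :=
  ∑ x : Bulk N, ∑ y : Bulk N,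
    if (y : ℕ) = x + 1 then
      rate π η x y * ((f (move η x y) - f η) * (g (move η x y) - g η))
        + rate π η y x * ((f (move η y x) - f η) * (g (move η y x) - g η))
    else 0

/-- The carré du champ of the generator of a reservoir. -/
def reservoirCarre (lam rho : ℝ) (x : Bulk N) (f g : Config N → ℝ) (η : Config N) : ℝ :=
  lam * rho * (π.c + π.d * η x) * ((f (addAt η x) - f η) * (g (addAt η x) - g η))
    + lam * η x * (π.c + π.d * rho) * ((f (removeAt η x) - f η) * (g (removeAt η x) - g η))

/-- The carré du champ of the boundary generator. -/
def boundaryCarre (f g : Config N → ℝ) (η : Config N) : ℝ :=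
  ∑ x : Bulk N,
    ((if (x : ℕ) = 1 then reservoirCarre π π.lamL π.rhoL x f g η else 0)
      + (if (x : ℕ) + 1 = N then reservoirCarre π π.lamR π.rhoR x f g η else 0))

lemma bulkGen_mul (f g : Config N → ℝ) (η : Config N) :
    bulkGen π N (fun η => f η * g η) η
      = f η * bulkGen π N g η + g η * bulkGen π N f η + bulkCarre π f g η := by
  simp only [bulkGen, bulkCarre, Finset.mul_sum, ← Finset.sum_add_distrib]
  refine Finset.sum_congr rfl fun x _ => Finset.sum_congr rfl fun y _ => ?_
  split_ifs <;> ring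

lemma boundaryGen_mul (f g : Config N → ℝ) (η : Config N) :
    boundaryGen π N (fun η => f η * g η) η
      = f η * boundaryGen π N g η + g η * boundaryGen π N f η + boundaryCarre π f g η := by
  simp only [boundaryGen, boundaryCarre, reservoirGen, reservoirCarre, Finset.mul_sum,
    ← Finset.sum_add_distrib]
  refine Finset.sum_congr rfl fun x _ => ?_
  split_ifs <;> ring

lemma particleGen_mul (f g : Config N → ℝ) (η : Config N) :
    particleGen π N (fun η => f η * g η) η
      = f η * particleGen π N g η + g η * particleGen π N f η
        + (N : ℝ) ^ 2 * (bulkCarre π f g η + boundaryCarre π f g η) := by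
  rw [particleGen, particleGen, particleGen, bulkGen_mul, boundaryGen_mul]
  ring

lemma bulkGen_add (f g : Config N → ℝ) (η : Config N) :
    bulkGen π N (fun η => f η + g η) η = bulkGen π N f η + bulkGen π N g η := by
  simp only [bulkGen, ← Finset.sum_add_distrib]
  refine Finset.sum_congr rfl fun x _ => Finset.sum_congr rfl fun y _ => ?_
  split_ifs <;> ring

lemma bulkGen_const_mul (k : ℝ) (f : Config N → ℝ) (η : Config N) :
    bulkGen π N (fun η => k * f η) η = k * bulkGen π N f η := by
  simp only [bulkGen, Finset.mul_sum]
  refine Finset.sum_congr rfl fun x _ => Finset.sum_congr rfl fun y _ => ?_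
  split_ifs <;> ring

lemma boundaryGen_add (f g : Config N → ℝ) (η : Config N) :
    boundaryGen π N (fun η => f η + g η) η = boundaryGen π N f η + boundaryGen π N g η := by
  simp only [boundaryGen, reservoirGen, ← Finset.sum_add_distrib]
  refine Finset.sum_congr rfl fun x _ => ?_
  split_ifs <;> ring

lemma boundaryGen_const_mul (k : ℝ) (f : Config N → ℝ) (η : Config N) :
    boundaryGen π N (fun η => k * f η) η = k * boundaryGen π N f η := by
  simp only [boundaryGen, reservoirGen, Finset.mul_sum]
  refine Finset.sum_congr rfl fun x _ => ?_
  split_ifs <;> ring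

lemma particleGen_add (f g : Config N → ℝ) (η : Config N) :
    particleGen π N (fun η => f η + g η) η = particleGen π N f η + particleGen π N g η := by
  rw [particleGen, particleGen, particleGen, bulkGen_add, boundaryGen_add]; ring

lemma particleGen_const_mul (k : ℝ) (f : Config N → ℝ) (η : Config N) :
    particleGen π N (fun η => k * f η) η = k * particleGen π N f η := by
  rw [particleGen, particleGen, bulkGen_const_mul, boundaryGen_const_mul]; ring

lemma bond_sum_right (F : Bulk N → Bulk N → ℝ) (z : Bulk N) :
    ∑ x : Bulk N, ∑ y : Bulk N, (if (y : ℕ) = x + 1 then if z = y then F x y else 0 else 0)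
      = if h : (z : ℕ) - 1 ∈ Set.Ioo 0 N then F ⟨z - 1, h⟩ z else 0 := by
  rw [← sum_ite_coe_eq ((z : ℕ) - 1) (fun x => F x z)]
  refine Finset.sum_congr rfl fun x _ => ?_
  rw [Finset.sum_eq_single z]
  · have := x.2.1
    simp only [if_true]
    congr 1
    exact propext (by omega)
  · intro y _ hy
    simp [Ne.symm hy]
  · simp

lemma bond_sum_left (F : Bulk N → Bulk N → ℝ) (z : Bulk N) :
    ∑ x : Bulk N, ∑ y : Bulk N, (if (y : ℕ) = x + 1 then if z = x then F x y else 0 else 0)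
      = if h : (z : ℕ) + 1 ∈ Set.Ioo 0 N then F z ⟨z + 1, h⟩ else 0 := by
  rw [Finset.sum_eq_single z]
  · rw [← sum_ite_coe_eq ((z : ℕ) + 1) (fun y => F z y)]
    simp
  · intro x _ hx
    simp [Ne.symm hx]
  · simp

/-- Truncated subtraction in `removeAt` differs from the true one only at an empty site, where the
rate vanishes. Jumps may thus be computed with the vector `δ_y - δ_x`. -/
lemma rate_mul_move {x y : Bulk N} (hxy : x ≠ y) (G : (Bulk N → ℝ) → ℝ) (η : Config N) :
    rate π η x y * G (fun z => (move η x y z : ℝ) - η z)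
      = rate π η x y * G (fun z => (if z = y then 1 else 0) - (if z = x then 1 else 0)) := by
  by_cases hx : η x = 0
  · simp [rate_eq_zero π hx]
  · congr 2
    ext z
    simp only [move, addAt, removeAt, Function.update_apply]
    by_cases hy : z = y
    · subst hy
      simp [Ne.symm hxy]
    · by_cases hz : z = x
      · subst hz
        simp only [if_neg hy, if_true]
        rw [Nat.cast_sub (Nat.one_le_iff_ne_zero.2 hx)]
        simp
      · simp [hy, hz]

/-- The products `d η(x) η(y)` cancel in the net current of a bond, leaving `c` times a discrete
gradient; this is why the density equation closes. -/
lemma bulkGen_coord (z : Bulk N) (η : Config N) :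
    bulkGen π N (fun η => (η z : ℝ)) η =
      (if h : (z : ℕ) - 1 ∈ Set.Ioo 0 N then π.c * ((η ⟨z - 1, h⟩ : ℝ) - η z) else 0)
      + (if h : (z : ℕ) + 1 ∈ Set.Ioo 0 N then π.c * ((η ⟨z + 1, h⟩ : ℝ) - η z) else 0) := by
  rw [← bond_sum_right (fun x y => π.c * ((η x : ℝ) - η y)),
    ← bond_sum_left (fun x y => π.c * ((η y : ℝ) - η x)), bulkGen]
  simp only [← Finset.sum_add_distrib]
  refine Finset.sum_congr rfl fun x _ => Finset.sum_congr rfl fun y _ => ?_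
  by_cases hxy : (y : ℕ) = x + 1
  · have hne : x ≠ y := fun h => by rw [h] at hxy; omega
    simp only [if_pos hxy]
    rw [rate_mul_move π hne (fun u => u z), rate_mul_move π hne.symm (fun u => u z)]
    simp only [rate]
    by_cases h1 : z = y
    · have h2 : z ≠ x := fun h => hne (h.symm.trans h1)
      simp only [h1, if_true, if_neg hne.symm]; ring
    · by_cases h2 : z = x
      · simp only [h2, if_true, if_neg hne]; ring
      · simp [h1, h2]
  · simp [hxy]

lemma bulkCarre_coord_self (z : Bulk N) (η : Config N) :
    bulkCarre π (fun η => (η z : ℝ)) (fun η => (η z : ℝ)) η =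
      (if h : (z : ℕ) - 1 ∈ Set.Ioo 0 N then
        rate π η ⟨z - 1, h⟩ z + rate π η z ⟨z - 1, h⟩ else 0)
      + (if h : (z : ℕ) + 1 ∈ Set.Ioo 0 N then
        rate π η z ⟨z + 1, h⟩ + rate π η ⟨z + 1, h⟩ z else 0) := by
  rw [← bond_sum_right (fun x y => rate π η x y + rate π η y x),
    ← bond_sum_left (fun x y => rate π η x y + rate π η y x), bulkCarre]
  simp only [← Finset.sum_add_distrib]
  refine Finset.sum_congr rfl fun x _ => Finset.sum_congr rfl fun y _ => ?_
  by_cases hxy : (y : ℕ) = x + 1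
  · have hne : x ≠ y := fun h => by rw [h] at hxy; omega
    simp only [if_pos hxy]
    rw [rate_mul_move π hne (fun u => u z * u z), rate_mul_move π hne.symm (fun u => u z * u z)]
    by_cases h1 : z = y
    · have h2 : z ≠ x := fun h => hne (h.symm.trans h1)
      simp only [h1, if_true, if_neg hne.symm]; ring
    · by_cases h2 : z = x
      · simp only [h2, if_true, if_neg hne]; ring
      · simp [h1, h2]
  · simp [hxy]

/-- Only jumps across a bond joining `z` and `w` change both numbers, and by opposite amounts. -/
lemma bulkCarre_coord_of_lt {z w : Bulk N} (hzw : z < w) (η : Config N) :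
    bulkCarre π (fun η => (η z : ℝ)) (fun η => (η w : ℝ)) η =
      if (w : ℕ) = z + 1 then -(rate π η z w + rate π η w z) else 0 := by
  have hzw' : (z : ℕ) < w := hzw
  have key : (if h : (z : ℕ) + 1 ∈ Set.Ioo 0 N then
      (if w = (⟨z + 1, h⟩ : Bulk N) then -(rate π η z w + rate π η w z) else 0) else 0)
      = if (w : ℕ) = z + 1 then -(rate π η z w + rate π η w z) else 0 := by
    by_cases h : (w : ℕ) = z + 1
    · have h' : (z : ℕ) + 1 ∈ Set.Ioo 0 N := h ▸ w.2
      rw [dif_pos h', if_pos h, if_pos (Subtype.ext h)]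
    · rw [if_neg h]
      split_ifs with h1 h2
      · exact absurd (congrArg Subtype.val h2) h
      · rfl
      · rfl
  rw [← key, ← bond_sum_left (fun x y => if w = y then -(rate π η x w + rate π η w x) else 0),
    bulkCarre]
  refine Finset.sum_congr rfl fun x _ => Finset.sum_congr rfl fun y _ => ?_
  by_cases hxy : (y : ℕ) = x + 1
  · have hne : x ≠ y := fun h => by rw [h] at hxy; omega
    simp only [if_pos hxy]
    rw [rate_mul_move π hne (fun u => u z * u w), rate_mul_move π hne.symm (fun u => u z * u w)]
    have hzne : z ≠ w := hzw.ne
    by_cases h1 : z = y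
    · have h2 : z ≠ x := fun h => hne (h.symm.trans h1)
      have h3 : w ≠ y := fun h => hzne (h1.trans h.symm)
      have h4 : w ≠ x := fun h => by rw [h, h1] at hzw'; omega
      simp [h2, h3, h4]
    · by_cases h2 : z = x
      · by_cases h3 : w = y
        · simp only [h2, h3, if_true, if_neg hne, if_neg hne.symm]; ring
        · have h4 : w ≠ x := fun h => hzne (h2.trans h.symm)
          simp [h3, h4]
      · simp [h1, h2]
  · simp [hxy]

/-- A reservoir behaves like a neighbour with occupation number frozen at `rho` and with rates
multiplied by `lam`, so the same cancellation occurs. This motivates `extend`. -/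
lemma boundaryGen_coord (z : Bulk N) (η : Config N) :
    boundaryGen π N (fun η => (η z : ℝ)) η =
      (if (z : ℕ) = 1 then π.lamL * π.c * (π.rhoL - η z) else 0)
      + (if (z : ℕ) + 1 = N then π.lamR * π.c * (π.rhoR - η z) else 0) := by
  have key : ∀ lam rho (x : Bulk N), reservoirGen π lam rho x (fun η => (η z : ℝ)) η
      = if z = x then lam * π.c * (rho - η z) else 0 := fun lam rho x => by
    simp only [reservoirGen, addAt, removeAt, Function.update_apply]
    split_ifs with h
    · subst h
      rcases Nat.eq_zero_or_pos (η z) with h0 | h0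
      · simp [h0]; ring
      · rw [Nat.cast_sub h0]; push_cast; ring
    · simp
  rw [boundaryGen, Finset.sum_eq_single z]
  · simp only [key, if_true]
  · intro x _ hx
    simp [key, Ne.symm hx]
  · simp

lemma boundaryCarre_coord_self (z : Bulk N) (η : Config N) :
    boundaryCarre π (fun η => (η z : ℝ)) (fun η => (η z : ℝ)) η =
      (if (z : ℕ) = 1 then
        π.lamL * (π.rhoL * (π.c + π.d * η z) + η z * (π.c + π.d * π.rhoL)) else 0)
      + (if (z : ℕ) + 1 = N then
        π.lamR * (π.rhoR * (π.c + π.d * η z) + η z * (π.c + π.d * π.rhoR)) else 0) := by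
  have key : ∀ lam rho (x : Bulk N),
      reservoirCarre π lam rho x (fun η => (η z : ℝ)) (fun η => (η z : ℝ)) η
      = if z = x then lam * (rho * (π.c + π.d * η z) + η z * (π.c + π.d * rho)) else 0 :=
    fun lam rho x => by
      simp only [reservoirCarre, addAt, removeAt, Function.update_apply]
      split_ifs with h
      · subst h
        rcases Nat.eq_zero_or_pos (η z) with h0 | h0
        · simp [h0]; ring
        · rw [Nat.cast_sub h0]; push_cast; ring
      · simp
  rw [boundaryCarre, Finset.sum_eq_single z]
  · simp only [key, if_true]
  · intro x _ hx
    simp [key, Ne.symm hx]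
  · simp

lemma boundaryCarre_coord_of_ne {z w : Bulk N} (hzw : z ≠ w) (η : Config N) :
    boundaryCarre π (fun η => (η z : ℝ)) (fun η => (η w : ℝ)) η = 0 := by
  have key : ∀ lam rho (x : Bulk N),
      reservoirCarre π lam rho x (fun η => (η z : ℝ)) (fun η => (η w : ℝ)) η = 0 :=
    fun lam rho x => by
      simp only [reservoirCarre, addAt, removeAt, Function.update_apply]
      by_cases h : z = x
      · have : w ≠ x := fun h' => hzw (h.trans h'.symm)
        simp [this]
      · simp [h]
  simp [boundaryCarre, key]

/-- The discrete heat equation, before taking expectations. -/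
lemma particleGen_coord (z : Bulk N) (η : Config N) :
    particleGen π N (fun η => (η z : ℝ)) η = (N : ℝ) ^ 2 *
      (rateDown π z * (extend π η (z - 1) - extend π η z)
        + rateUp π N z * (extend π η (z + 1) - extend π η z)) := by
  rw [particleGen, bulkGen_coord, boundaryGen_coord, extend_coe]
  have h0 := z.2.1
  have hN := z.2.2
  congr 1
  rw [add_add_add_comm]
  congr 1
  · rw [rateDown]
    by_cases h : (z : ℕ) = 1
    · have h' : ¬ (z : ℕ) - 1 ∈ Set.Ioo 0 N := fun h' => by have := h'.1; omega
      have e : extend π η (z - 1) = π.rhoL := by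
        rw [show (z : ℕ) - 1 = 0 by omega, extend_zero]
      rw [dif_neg h', if_pos h, if_pos h, e]; ring
    · have h' : (z : ℕ) - 1 ∈ Set.Ioo 0 N := ⟨by omega, by omega⟩
      rw [if_neg h, if_neg h, dif_pos h', extend, dif_pos h', add_zero]
  · rw [rateUp]
    by_cases h : (z : ℕ) + 1 = N
    · have h' : ¬ (z : ℕ) + 1 ∈ Set.Ioo 0 N := fun h' => by have := h'.2; omega
      rw [if_pos h, if_pos h, dif_neg h', extend, dif_neg h', if_neg (by omega)]; ring
    · have h' : (z : ℕ) + 1 ∈ Set.Ioo 0 N := ⟨by omega, by omega⟩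
      rw [if_neg h, if_neg h, dif_pos h', extend, dif_pos h', add_zero]

/-- The carré du champ of an occupation number; both reservoirs are treated as sites. -/
lemma carre_coord_self (z : Bulk N) (η : Config N) :
    π.c * (bulkCarre π (fun η => (η z : ℝ)) (fun η => (η z : ℝ)) η
      + boundaryCarre π (fun η => (η z : ℝ)) (fun η => (η z : ℝ)) η) =
    rateDown π z * (extend π η (z - 1) * (π.c + π.d * extend π η z)
        + extend π η z * (π.c + π.d * extend π η (z - 1)))
      + rateUp π N z * (extend π η (z + 1) * (π.c + π.d * extend π η z)
        + extend π η z * (π.c + π.d * extend π η (z + 1))) := by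
  rw [bulkCarre_coord_self, boundaryCarre_coord_self, extend_coe]
  have h0 := z.2.1
  have hN := z.2.2
  rw [add_add_add_comm, mul_add]
  congr 1
  · rw [rateDown]
    by_cases h : (z : ℕ) = 1
    · have h' : ¬ (z : ℕ) - 1 ∈ Set.Ioo 0 N := fun h' => by have := h'.1; omega
      have e : extend π η (z - 1) = π.rhoL := by
        rw [show (z : ℕ) - 1 = 0 by omega, extend_zero]
      rw [dif_neg h', if_pos h, if_pos h, e]; ring
    · have h' : (z : ℕ) - 1 ∈ Set.Ioo 0 N := ⟨by omega, by omega⟩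
      rw [if_neg h, if_neg h, dif_pos h', extend, dif_pos h', add_zero, rate, rate]
  · rw [rateUp]
    by_cases h : (z : ℕ) + 1 = N
    · have h' : ¬ (z : ℕ) + 1 ∈ Set.Ioo 0 N := fun h' => by have := h'.2; omega
      rw [if_pos h, if_pos h, dif_neg h', extend, dif_neg h', if_neg (by omega)]; ring
    · have h' : (z : ℕ) + 1 ∈ Set.Ioo 0 N := ⟨by omega, by omega⟩
      rw [if_neg h, if_neg h, dif_pos h', extend, dif_pos h', add_zero, rate, rate]; ring

end Carre

/-! ### Duality with two particles -/

section Duality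

variable (π : Params) {N : ℕ}

/-- The duality functions with two particles. -/
def dual (η : Config N) (p : ℕ × ℕ) : ℝ :=
  if p.1 = p.2 ∧ p.1 ∈ Set.Ioo 0 N then
    π.c / (π.c + π.d) * (extend π η p.1 * (extend π η p.1 - 1))
  else extend π η p.1 * extend π η p.2

lemma dual_of_ne (η : Config N) {x y : ℕ} (h : x ≠ y) :
    dual π η (x, y) = extend π η x * extend π η y := by simp [dual, h]

lemma dual_self (η : Config N) (x : Bulk N) :
    dual π η (x, x) = π.c / (π.c + π.d) * ((η x : ℝ) * ((η x : ℝ) - 1)) := by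
  have := x.2
  simp only [dual, true_and, if_pos this, extend_coe]

/-- For `c + d = 0` both sides vanish, the right one because occupation numbers are `0` or `1`. The
off-diagonal equation sees the diagonal only through this product, so it holds in that case too. -/
lemma mul_dual_self {η : Config N} (hη : η ∈ stateSpace π N) (x : Bulk N) :
    (π.c + π.d) * dual π η (x, x) = π.c * ((η x : ℝ) * ((η x : ℝ) - 1)) := by
  rw [dual_self]
  by_cases h : π.c + π.d = 0
  · rw [h, zero_mul]
    have h1 := hη x
    have hc := π.c_pos
    have hd : π.d = -π.c := by linarith
    rw [hd] at h1
    have h2 : (η x : ℝ) ≤ 1 := by nlinarith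
    have h3 : η x ≤ 1 := by exact_mod_cast h2
    interval_cases η x <;> simp
  · rw [← mul_assoc, mul_div_cancel₀ _ h]

lemma walkGen_of_interior {x y : ℕ} (hx : 0 < x) (hy : y < N) (f : ℕ × ℕ → ℝ) :
    walkGen π N f (x, y) = (N : ℝ) ^ 2 *
      (rateDown π x * (symmExt f (x - 1) y - f (x, y))
        + rateUp π N x * (symmExt f (x + 1) y - f (x, y))
        + rateDown π y * (symmExt f x (y - 1) - f (x, y))
        + rateUp π N y * (symmExt f x (y + 1) - f (x, y))
        + (if y = x + 1 then π.d * (f (x, x) + f (y, y) - 2 * f (x, y)) else 0)) := by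
  rw [walkGen, if_neg]
  exact fun h => h.elim hx.ne' hy.ne

/-- At distance at least two the carré du champ vanishes and the product rule is exact. For
neighbours `z`, `w` the product rule produces `c η(z)² + c η(w)²`, and the carré du champ subtracts
`c η(z) + c η(w) + 2 d η(z) η(w)`; together these are `c + d` times the two diagonal values minus `2
d` times the off-diagonal one. -/
lemma particleGen_dual_of_lt {η : Config N} (hη : η ∈ stateSpace π N) {z w : Bulk N}
    (hzw : z < w) :
    particleGen π N (fun η => dual π η (z, w)) η = walkGen π N (dual π η) (z, w) := by
  have hlt : (z : ℕ) < w := hzw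
  have hz0 := z.2.1
  have hwN := w.2.2
  have h1 : (fun η : Config N => dual π η (z, w)) = fun η => (η z : ℝ) * η w := by
    ext η; rw [dual_of_ne π η hlt.ne, extend_coe, extend_coe]
  rw [h1, particleGen_mul, particleGen_coord, particleGen_coord, bulkCarre_coord_of_lt π hzw,
    boundaryCarre_coord_of_ne π hzw.ne, walkGen_of_interior π hz0 hwN]
  have e1 : symmExt (dual π η) (z - 1) w = extend π η (z - 1) * extend π η w := by
    rw [symmExt, min_eq_left (by omega), max_eq_right (by omega), dual_of_ne _ _ (by omega)]
  have e2 : symmExt (dual π η) z (w + 1) = extend π η z * extend π η (w + 1) := by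
    rw [symmExt, min_eq_left (by omega), max_eq_right (by omega), dual_of_ne _ _ (by omega)]
  rw [e1, e2, dual_of_ne π η hlt.ne]
  by_cases h : (w : ℕ) = z + 1
  · have d1 := mul_dual_self π hη z
    have d2 := mul_dual_self π hη w
    have e3 : symmExt (dual π η) (z + 1) w = dual π η (w, w) := by
      rw [symmExt, ← h, min_self, max_self]
    have e4 : symmExt (dual π η) z (w - 1) = dual π η (z, z) := by
      rw [symmExt, h, Nat.add_sub_cancel, min_self, max_self]
    rw [e3, e4, if_pos h, if_pos h]
    have r1 : rateUp π N z = π.c := by rw [rateUp, if_neg (by omega)]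
    have r2 : rateDown π w = π.c := by rw [rateDown, if_neg (by omega)]
    have x1 : extend π η (z + 1) = η w := by rw [← h, extend_coe]
    have x2 : extend π η (w - 1) = η z := by rw [h, Nat.add_sub_cancel, extend_coe]
    rw [r1, r2, x1, x2, rate, rate, extend_coe, extend_coe]
    linear_combination (-(N : ℝ) ^ 2) * d1 - (N : ℝ) ^ 2 * d2
  · have e3 : symmExt (dual π η) (z + 1) w = extend π η (z + 1) * extend π η w := by
      rw [symmExt, min_eq_left (by omega), max_eq_right (by omega), dual_of_ne _ _ (by omega)]
    have e4 : symmExt (dual π η) z (w - 1) = extend π η z * extend π η (w - 1) := by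
      rw [symmExt, min_eq_left (by omega), max_eq_right (by omega), dual_of_ne _ _ (by omega)]
    rw [e3, e4, if_neg h, if_neg h, extend_coe, extend_coe]
    ring

/-- Each neighbouring occupation number `η'` at rate `c` contributes `2 (c + d) η η' - 2 c η (η -
1)` to the generator of `η (η - 1)`. The factor `c / (c + d)` turns this into `2 c` times the
difference of two values of `dual`. -/
lemma particleGen_dual_self (hcd : π.c + π.d ≠ 0) (η : Config N) (z : Bulk N) :
    particleGen π N (fun η => dual π η (z, z)) η = walkGen π N (dual π η) (z, z) := by
  have hz0 := z.2.1
  have hzN := z.2.2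
  have h1 : (fun η : Config N => dual π η (z, z))
      = fun η => π.c / (π.c + π.d) * ((η z : ℝ) * η z + (-1) * η z) := by
    ext η; rw [dual_self]; ring
  rw [h1, particleGen_const_mul, particleGen_add, particleGen_mul, particleGen_const_mul,
    particleGen_coord, walkGen_of_interior π hz0 hzN]
  have e1 : symmExt (dual π η) (z - 1) z = extend π η (z - 1) * extend π η z := by
    rw [symmExt, min_eq_left (by omega), max_eq_right (by omega), dual_of_ne _ _ (by omega)]
  have e2 : symmExt (dual π η) z (z + 1) = extend π η z * extend π η (z + 1) := by
    rw [symmExt, min_eq_left (by omega), max_eq_right (by omega), dual_of_ne _ _ (by omega)]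
  have e3 : symmExt (dual π η) (z + 1) z = extend π η z * extend π η (z + 1) := by
    rw [symmExt, min_eq_right (by omega), max_eq_left (by omega), dual_of_ne _ _ (by omega)]
  have e4 : symmExt (dual π η) z (z - 1) = extend π η (z - 1) * extend π η z := by
    rw [symmExt, min_eq_right (by omega), max_eq_left (by omega), dual_of_ne _ _ (by omega)]
  rw [e1, e2, e3, e4, if_neg (by omega), dual_self]
  have hk := carre_coord_self π z η
  have hc := π.c_pos.ne'
  rw [extend_coe] at hk ⊢
  field_simp
  linear_combination (N : ℝ) ^ 2 * hk

end Duality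

/-! ### Quadratic growth of the duality functions -/

section Growth

variable {π : Params} {N : ℕ}

lemma one_le_mass_sq (η : Config N) : (1 : ℝ) ≤ (1 + (mass η : ℝ)) ^ 2 :=
  one_le_pow₀ (by have : (0 : ℝ) ≤ mass η := Nat.cast_nonneg _
                  linarith)

lemma coe_le_mass (η : Config N) (x : Bulk N) : (η x : ℝ) ≤ mass η := by
  exact_mod_cast le_mass η x

lemma quadraticGrowth_const (k : ℝ) : QuadraticGrowth π (fun _ : Config N => k) |k| where
  bound η := le_mul_of_one_le_right (abs_nonneg _) (one_le_mass_sq η)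
  step η x := by rw [sub_self, abs_zero]; positivity
  bulk η _ := by
    have : bulkGen π N (fun _ => k) η = 0 := by simp [bulkGen]
    rw [this, abs_zero]; positivity

lemma QuadraticGrowth.add {f g : Config N → ℝ} {C D : ℝ} (hf : QuadraticGrowth π f C)
    (hg : QuadraticGrowth π g D) : QuadraticGrowth π (fun η => f η + g η) (C + D) where
  bound η := by
    rw [add_mul]; exact (abs_add_le _ _).trans (add_le_add (hf.bound η) (hg.bound η))
  step η x := by
    rw [add_mul, add_sub_add_comm]
    exact (abs_add_le _ _).trans (add_le_add (hf.step η x) (hg.step η x))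
  bulk η hη := by
    rw [add_mul, bulkGen_add]
    exact (abs_add_le _ _).trans (add_le_add (hf.bulk η hη) (hg.bulk η hη))

lemma QuadraticGrowth.const_mul {f : Config N → ℝ} {C : ℝ} (k : ℝ) (hf : QuadraticGrowth π f C) :
    QuadraticGrowth π (fun η => k * f η) (|k| * C) where
  bound η := by
    rw [abs_mul, mul_assoc]; exact mul_le_mul_of_nonneg_left (hf.bound η) (abs_nonneg _)
  step η x := by
    rw [← mul_sub, abs_mul, mul_assoc]
    exact mul_le_mul_of_nonneg_left (hf.step η x) (abs_nonneg _)
  bulk η hη := by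
    rw [bulkGen_const_mul, abs_mul, mul_assoc]
    exact mul_le_mul_of_nonneg_left (hf.bulk η hη) (abs_nonneg _)

lemma abs_bulkGen_coord_le (z : Bulk N) (η : Config N) :
    |bulkGen π N (fun η => (η z : ℝ)) η| ≤ 2 * π.c * mass η := by
  have hc := π.c_pos
  have key : ∀ w : Bulk N, |π.c * ((η w : ℝ) - η z)| ≤ π.c * mass η := fun w => by
    rw [abs_mul, abs_of_pos hc]
    refine mul_le_mul_of_nonneg_left ?_ hc.le
    have h1 := coe_le_mass η z
    have h2 := coe_le_mass η w
    have h3 : (0 : ℝ) ≤ η z := Nat.cast_nonneg _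
    have h4 : (0 : ℝ) ≤ η w := Nat.cast_nonneg _
    rw [abs_le]; constructor <;> linarith
  have h0 : |(0 : ℝ)| ≤ π.c * mass η := by rw [abs_zero]; positivity
  rw [bulkGen_coord, two_mul, add_mul]
  refine (abs_add_le _ _).trans (add_le_add ?_ ?_)
  · split_ifs
    exacts [key _, h0]
  · split_ifs
    exacts [key _, h0]

lemma addAt_coord_sub (η : Config N) (x z : Bulk N) :
    ((addAt η x z : ℕ) : ℝ) - η z = if z = x then 1 else 0 := by
  simp only [addAt, Function.update_apply]
  split_ifs with h
  · subst h; push_cast; ring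
  · simp

lemma quadraticGrowth_coord (z : Bulk N) :
    QuadraticGrowth π (fun η : Config N => (η z : ℝ)) (1 + 2 * π.c) where
  bound η := by
    have hc := π.c_pos
    have h1 := coe_le_mass η z
    have h2 : (0 : ℝ) ≤ mass η := Nat.cast_nonneg _
    rw [Nat.abs_cast]
    nlinarith [mul_nonneg hc.le (sq_nonneg (1 + (mass η : ℝ)))]
  step η x := by
    have hc := π.c_pos
    have h2 : (0 : ℝ) ≤ mass η := Nat.cast_nonneg _
    rw [addAt_coord_sub]
    have : |(if z = x then (1 : ℝ) else 0)| ≤ 1 := by split_ifs <;> simp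
    nlinarith [mul_nonneg hc.le h2]
  bulk η _ := by
    have hc := π.c_pos
    have h2 : (0 : ℝ) ≤ mass η := Nat.cast_nonneg _
    refine (abs_bulkGen_coord_le z η).trans ?_
    nlinarith [mul_nonneg hc.le h2, mul_nonneg hc.le (sq_nonneg (mass η : ℝ))]

lemma abs_rate_le (η : Config N) (x y : Bulk N) :
    |rate π η x y| ≤ (π.c + |π.d|) * (1 + mass η) ^ 2 := by
  have hc := π.c_pos
  have h1 := coe_le_mass η x
  have h2 := coe_le_mass η y
  have h3 : (0 : ℝ) ≤ η y := Nat.cast_nonneg _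
  have h4 : (0 : ℝ) ≤ mass η := Nat.cast_nonneg _
  have h5 : |π.c + π.d * η y| ≤ (π.c + |π.d|) * (1 + mass η) := by
    refine (abs_add_le _ _).trans ?_
    rw [abs_of_pos hc, abs_mul, Nat.abs_cast]
    nlinarith [abs_nonneg π.d, mul_le_mul_of_nonneg_left h2 (abs_nonneg π.d), mul_nonneg hc.le h4]
  rw [rate, abs_mul, Nat.abs_cast]
  calc _ ≤ (1 + (mass η : ℝ)) * ((π.c + |π.d|) * (1 + mass η)) :=
        mul_le_mul (by linarith) h5 (abs_nonneg _) (by positivity)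
    _ = _ := by ring

lemma quadraticGrowth_coord_mul_of_carre {z w : Bulk N}
    (h : ∀ η, |bulkCarre π (fun η : Config N => (η z : ℝ)) (fun η => (η w : ℝ)) η|
      ≤ 4 * ((π.c + |π.d|) * (1 + mass η) ^ 2)) :
    QuadraticGrowth π (fun η : Config N => (η z : ℝ) * η w) (2 + 8 * (π.c + |π.d|)) where
  bound η := by
    have hc := π.c_pos
    have hd := abs_nonneg π.d
    have h1 := coe_le_mass η z
    have h2 := coe_le_mass η w
    have h3 : (0 : ℝ) ≤ mass η := Nat.cast_nonneg _
    rw [abs_mul, Nat.abs_cast, Nat.abs_cast]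
    calc (η z : ℝ) * η w ≤ (1 + mass η) * (1 + mass η) := by gcongr <;> linarith
      _ = 1 * (1 + (mass η : ℝ)) ^ 2 := by ring
      _ ≤ _ := by gcongr; linarith
  step η x := by
    have hc := π.c_pos
    have hd := abs_nonneg π.d
    have h1 := coe_le_mass η z
    have h2 := coe_le_mass η w
    have h3 : (0 : ℝ) ≤ mass η := Nat.cast_nonneg _
    have e1 := addAt_coord_sub η x z
    have e2 := addAt_coord_sub η x w
    -- In this form all three terms are nonnegative, the increments being `0` or `1`.
    rw [show ((addAt η x z : ℕ) : ℝ) * (addAt η x w : ℕ) - η z * η w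
      = ((addAt η x z : ℕ) - η z) * ((addAt η x w : ℕ) - η w)
        + η z * ((addAt η x w : ℕ) - η w) + η w * ((addAt η x z : ℕ) - (η z : ℝ)) by ring, e1, e2]
    have h4 : (0 : ℝ) ≤ η z := Nat.cast_nonneg _
    have h5 : (0 : ℝ) ≤ η w := Nat.cast_nonneg _
    have h6 : 2 * (1 + (mass η : ℝ)) ≤ (2 + 8 * (π.c + |π.d|)) * (1 + mass η) := by
      gcongr; linarith
    refine le_trans ?_ h6
    rw [abs_of_nonneg]
    · split_ifs <;> linarith
    · split_ifs <;> linarith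
  bulk η _ := by
    have hc := π.c_pos
    have hd := abs_nonneg π.d
    have h1 := coe_le_mass η z
    have h2 := coe_le_mass η w
    have h3 : (0 : ℝ) ≤ mass η := Nat.cast_nonneg _
    rw [bulkGen_mul]
    have key : ∀ u v : Bulk N, |(η u : ℝ) * bulkGen π N (fun η => (η v : ℝ)) η|
        ≤ 2 * π.c * (1 + mass η) ^ 2 := fun u v => by
      rw [abs_mul, Nat.abs_cast]
      calc _ ≤ (1 + (mass η : ℝ)) * (2 * π.c * (1 + mass η)) := by
            refine mul_le_mul ?_ ((abs_bulkGen_coord_le v η).trans ?_) (abs_nonneg _)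
              (by positivity)
            · linarith [coe_le_mass η u]
            · gcongr; linarith
        _ = _ := by ring
    calc _ ≤ _ := (abs_add_le _ _).trans (add_le_add_left (abs_add_le _ _) _)
      _ ≤ _ := add_le_add (add_le_add (key _ _) (key _ _)) (h η)
      _ ≤ _ := by
        have : 0 ≤ |π.d| * (1 + (mass η : ℝ)) ^ 2 := by positivity
        have : 0 ≤ π.c * (1 + (mass η : ℝ)) ^ 2 := by positivity
        nlinarith [sq_nonneg (1 + (mass η : ℝ))]

lemma quadraticGrowth_coord_mul_of_le {z w : Bulk N} (hzw : z ≤ w) :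
    QuadraticGrowth π (fun η : Config N => (η z : ℝ) * η w) (2 + 8 * (π.c + |π.d|)) := by
  refine quadraticGrowth_coord_mul_of_carre fun η => ?_
  have hc := π.c_pos
  have key : ∀ x y : Bulk N, |rate π η x y + rate π η y x|
      ≤ 2 * ((π.c + |π.d|) * (1 + mass η) ^ 2) := fun x y => by
    rw [two_mul]
    exact (abs_add_le _ _).trans (add_le_add (abs_rate_le η x y) (abs_rate_le η y x))
  have h0 : |(0 : ℝ)| ≤ 2 * ((π.c + |π.d|) * (1 + (mass η : ℝ)) ^ 2) := by
    rw [abs_zero]; positivity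
  rcases hzw.eq_or_lt with rfl | hlt
  · rw [bulkCarre_coord_self]
    calc _ ≤ _ := abs_add_le _ _
      _ ≤ 2 * ((π.c + |π.d|) * (1 + mass η) ^ 2) + 2 * ((π.c + |π.d|) * (1 + mass η) ^ 2) := by
        refine add_le_add ?_ ?_
        · split_ifs
          exacts [key _ _, h0]
        · split_ifs
          exacts [key _ _, h0]
      _ = _ := by ring
  · rw [bulkCarre_coord_of_lt π hlt]
    have h2 : 2 * ((π.c + |π.d|) * (1 + (mass η : ℝ)) ^ 2)
        ≤ 4 * ((π.c + |π.d|) * (1 + mass η) ^ 2) := by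
      have : 0 ≤ (π.c + |π.d|) * (1 + (mass η : ℝ)) ^ 2 := by positivity
      linarith
    refine le_trans ?_ h2
    split_ifs
    · rw [abs_neg]; exact key _ _
    · exact h0

lemma quadraticGrowth_coord_mul (z w : Bulk N) :
    QuadraticGrowth π (fun η : Config N => (η z : ℝ) * η w) (2 + 8 * (π.c + |π.d|)) := by
  rcases le_total z w with h | h
  · exact quadraticGrowth_coord_mul_of_le h
  · simpa only [mul_comm] using quadraticGrowth_coord_mul_of_le (π := π) h

lemma QuadraticGrowth.exists_congr {f g : Config N → ℝ} {C : ℝ} (h : QuadraticGrowth π f C)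
    (e : ∀ η, g η = f η) : ∃ C, QuadraticGrowth π g C :=
  ⟨C, (funext e : g = f) ▸ h⟩

lemma exists_quadraticGrowth_extend (π : Params) (N x : ℕ) :
    ∃ C, QuadraticGrowth π (fun η : Config N => extend π η x) C := by
  by_cases h : x ∈ Set.Ioo 0 N
  · exact (quadraticGrowth_coord (⟨x, h⟩ : Bulk N)).exists_congr fun η => by rw [extend, dif_pos h]
  · exact (quadraticGrowth_const (if x = 0 then π.rhoL else π.rhoR)).exists_congr
      fun η => by rw [extend, dif_neg h]

lemma exists_quadraticGrowth_extend_mul (π : Params) (N x y : ℕ) :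
    ∃ C, QuadraticGrowth π (fun η : Config N => extend π η x * extend π η y) C := by
  by_cases hx : x ∈ Set.Ioo 0 N
  · by_cases hy : y ∈ Set.Ioo 0 N
    · exact (quadraticGrowth_coord_mul (⟨x, hx⟩ : Bulk N) ⟨y, hy⟩).exists_congr
        fun η => by rw [extend, extend, dif_pos hx, dif_pos hy]
    · obtain ⟨C, hC⟩ := exists_quadraticGrowth_extend π N x
      exact (hC.const_mul (if y = 0 then π.rhoL else π.rhoR)).exists_congr
        fun η => by rw [mul_comm, extend, dif_neg hy]
  · obtain ⟨C, hC⟩ := exists_quadraticGrowth_extend π N y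
    exact (hC.const_mul (if x = 0 then π.rhoL else π.rhoR)).exists_congr
      fun η => by rw [extend, dif_neg hx]

lemma exists_quadraticGrowth_dual (π : Params) (N : ℕ) (p : ℕ × ℕ) :
    ∃ C, QuadraticGrowth π (fun η : Config N => dual π η p) C := by
  unfold dual
  split_ifs with h
  · obtain ⟨C, hC⟩ := exists_quadraticGrowth_extend π N p.1
    obtain ⟨D, hD⟩ := exists_quadraticGrowth_extend_mul π N p.1 p.1
    exact ((hD.add (hC.const_mul (-1))).const_mul (π.c / (π.c + π.d))).exists_congr
      fun η => by ring
  · exact exists_quadraticGrowth_extend_mul π N p.1 p.2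

end Growth

/-! ### Algebra of the generator of the two-dimensional walk -/

section WalkGenerator

variable (π : Params) (N : ℕ)

lemma walkGen_of_boundary {p : ℕ × ℕ} (hp : p.1 = 0 ∨ p.2 = N) (f : ℕ × ℕ → ℝ) :
    walkGen π N f p = 0 := if_pos hp

lemma walkGen_add (f g : ℕ × ℕ → ℝ) (p : ℕ × ℕ) :
    walkGen π N (fun q => f q + g q) p = walkGen π N f p + walkGen π N g p := by
  simp only [walkGen, symmExt]
  split_ifs <;> ring

lemma walkGen_const_mul (k : ℝ) (f : ℕ × ℕ → ℝ) (p : ℕ × ℕ) :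
    walkGen π N (fun q => k * f q) p = k * walkGen π N f p := by
  simp only [walkGen, symmExt]
  split_ifs <;> ring

lemma walkGen_sub (f g : ℕ × ℕ → ℝ) (p : ℕ × ℕ) :
    walkGen π N (fun q => f q - g q) p = walkGen π N f p - walkGen π N g p := by
  simp only [walkGen, symmExt]
  split_ifs <;> ring

variable {π N}

lemma continuous_walkGen {f : ℝ → ℕ × ℕ → ℝ} (hf : ∀ q, Continuous fun s => f s q) (p : ℕ × ℕ) :
    Continuous fun s => walkGen π N (f s) p := by
  simp only [walkGen, symmExt]
  split_ifs <;> fun_prop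

lemma integral_walkGen {Ω : Type*} [MeasurableSpace Ω] {P : Measure Ω} {F : Ω → ℕ × ℕ → ℝ}
    (hF : ∀ q, Integrable (fun ω => F ω q) P) (p : ℕ × ℕ) :
    ∫ ω, walkGen π N (F ω) p ∂P = walkGen π N (fun q => ∫ ω, F ω q ∂P) p := by
  simp only [walkGen, symmExt]
  split_ifs
  · simp
  · rw [integral_const_mul, integral_add (by fun_prop) (by fun_prop),
      integral_add (by fun_prop) (by fun_prop), integral_add (by fun_prop) (by fun_prop),
      integral_add (by fun_prop) (by fun_prop)]
    simp only [integral_const_mul]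
    rw [integral_sub (by fun_prop) (by fun_prop), integral_sub (by fun_prop) (by fun_prop),
      integral_sub (by fun_prop) (by fun_prop), integral_sub (by fun_prop) (by fun_prop),
      integral_sub (by fun_prop) (by fun_prop), integral_add (by fun_prop) (by fun_prop),
      integral_const_mul]
  · simp only [add_zero]
    rw [integral_const_mul, integral_add (by fun_prop) (by fun_prop),
      integral_add (by fun_prop) (by fun_prop), integral_add (by fun_prop) (by fun_prop)]
    simp only [integral_const_mul]
    rw [integral_sub (by fun_prop) (by fun_prop), integral_sub (by fun_prop) (by fun_prop),
      integral_sub (by fun_prop) (by fun_prop), integral_sub (by fun_prop) (by fun_prop)]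

/-- The one-dimensional generator, at a site of the bulk. -/
def siteGen (π : Params) (N : ℕ) (r : ℕ → ℝ) (x : ℕ) : ℝ :=
  (N : ℝ) ^ 2 * (rateDown π x * (r (x - 1) - r x) + rateUp π N x * (r (x + 1) - r x))

/-- Without the term in `d` the two coordinates move independently and a tensor square obeys the
product rule, on the diagonal as well. The defect on the upper diagonal is `d (r(x)² + r(y)² - 2
r(x) r(y))`, the origin of the source. -/
lemma walkGen_tensor (r : ℕ → ℝ) {x y : ℕ} (hx : 0 < x) (hy : y < N) :
    walkGen π N (fun q => r q.1 * r q.2) (x, y) = siteGen π N r x * r y + r x * siteGen π N r y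
      + if y = x + 1 then π.d * (N : ℝ) ^ 2 * (r (x + 1) - r x) ^ 2 else 0 := by
  have hs : ∀ a b, symmExt (fun q => r q.1 * r q.2) a b = r a * r b := fun a b => by
    rcases le_total a b with h | h
    · simp only [symmExt, min_eq_left h, max_eq_right h]
    · simp only [symmExt, min_eq_right h, max_eq_left h, mul_comm]
  rw [walkGen_of_interior π hx hy, hs, hs, hs, hs, siteGen, siteGen]
  simp only
  split_ifs with h
  · rw [h]; ring
  · ring

end WalkGenerator

/-! ### Evolution equations of density and correlations -/

section Evolution

variable {π : Params} {N : ℕ} {Ω : Type*} [MeasurableSpace Ω] {P : Measure Ω}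
  {X : ℝ≥0 → Ω → Config N}

/-- The fundamental theorem of calculus applied to Dynkin's formula. Positive `s` is needed because
time is clamped at `0` by `toNNReal`. -/
theorem IsJumpProcess.hasDerivAt_integral
    (h : IsJumpProcess (stateSpace π N) (particleGen π N) P X)
    (h0 : Integrable (fun ω => (1 + (mass (X 0 ω) : ℝ)) ^ 2) P) {f : Config N → ℝ} {C : ℝ}
    (hf : QuadraticGrowth π f C)
    (hcont : Continuous fun s : ℝ => ∫ ω, particleGen π N f (X s.toNNReal ω) ∂P)
    {s : ℝ} (hs : 0 < s) :
    HasDerivAt (fun s : ℝ => ∫ ω, f (X s.toNNReal ω) ∂P)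
      (∫ ω, particleGen π N f (X s.toNNReal ω) ∂P) s := by
  have h1 := (hcont.integral_hasStrictDerivAt 0 s).hasDerivAt.const_add (∫ ω, f (X 0 ω) ∂P)
  refine h1.congr_of_eventuallyEq ?_
  filter_upwards [lt_mem_nhds hs] with r hr
  rw [(h.dynkin_quadratic h0 hf).2.2 r.toNNReal, Real.coe_toNNReal r hr.le]

lemma density_eq_integral_extend [IsProbabilityMeasure P] (t : ℝ≥0) (x : ℕ) :
    density π P X t x = ∫ ω, extend π (X t ω) x ∂P := by
  unfold density extend
  split_ifs <;> simp

lemma density_zero (t : ℝ≥0) : density π P X t 0 = π.rhoL := by simp [density]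

lemma density_self (hN : N ≠ 0) (t : ℝ≥0) : density π P X t N = π.rhoR := by simp [density, hN]

lemma integrable_extend (h : IsJumpProcess (stateSpace π N) (particleGen π N) P X)
    (h0 : Integrable (fun ω => (1 + (mass (X 0 ω) : ℝ)) ^ 2) P) (t : ℝ≥0) (x : ℕ) :
    Integrable (fun ω => extend π (X t ω) x) P := by
  obtain ⟨C, hC⟩ := exists_quadraticGrowth_extend π N x
  exact (h.dynkin_quadratic h0 hC).1 t

lemma integrable_dual (h : IsJumpProcess (stateSpace π N) (particleGen π N) P X)
    (h0 : Integrable (fun ω => (1 + (mass (X 0 ω) : ℝ)) ^ 2) P) (t : ℝ≥0) (p : ℕ × ℕ) :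
    Integrable (fun ω => dual π (X t ω) p) P := by
  obtain ⟨C, hC⟩ := exists_quadraticGrowth_dual π N p
  exact (h.dynkin_quadratic h0 hC).1 t

lemma continuous_density (h : IsJumpProcess (stateSpace π N) (particleGen π N) P X)
    (h0 : Integrable (fun ω => (1 + (mass (X 0 ω) : ℝ)) ^ 2) P) (x : ℕ) :
    Continuous fun s : ℝ => density π P X s.toNNReal x := by
  have := h.isProbabilityMeasure
  obtain ⟨C, hC⟩ := exists_quadraticGrowth_extend π N x
  simp only [density_eq_integral_extend]
  exact (h.dynkin_quadratic h0 hC).2.1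

lemma continuous_integral_dual (h : IsJumpProcess (stateSpace π N) (particleGen π N) P X)
    (h0 : Integrable (fun ω => (1 + (mass (X 0 ω) : ℝ)) ^ 2) P) (p : ℕ × ℕ) :
    Continuous fun s : ℝ => ∫ ω, dual π (X s.toNNReal ω) p ∂P := by
  obtain ⟨C, hC⟩ := exists_quadraticGrowth_dual π N p
  exact (h.dynkin_quadratic h0 hC).2.1

/-- The discrete heat equation for the density. -/
theorem hasDerivAt_density (h : IsJumpProcess (stateSpace π N) (particleGen π N) P X)
    (h0 : Integrable (fun ω => (1 + (mass (X 0 ω) : ℝ)) ^ 2) P) {x : ℕ} (hx : x ∈ Set.Ioo 0 N)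
    {s : ℝ} (hs : 0 < s) :
    HasDerivAt (fun s : ℝ => density π P X s.toNNReal x)
      (siteGen π N (density π P X s.toNNReal) x) s := by
  have := h.isProbabilityMeasure
  have key : ∀ t : ℝ≥0, ∫ ω, particleGen π N (fun η => extend π η x) (X t ω) ∂P
      = siteGen π N (density π P X t) x := fun t => by
    have hI := integrable_extend h h0 t
    have e : (fun η : Config N => extend π η x) = fun η => (η ⟨x, hx⟩ : ℝ) := by
      ext η; exact extend_coe π η ⟨x, hx⟩
    simp only [e, particleGen_coord, siteGen, density_eq_integral_extend]
    rw [integral_const_mul, integral_add (by fun_prop) (by fun_prop), integral_const_mul,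
      integral_const_mul, integral_sub (by fun_prop) (by fun_prop),
      integral_sub (by fun_prop) (by fun_prop)]
  obtain ⟨C, hC⟩ := exists_quadraticGrowth_extend π N x
  have hd := h.hasDerivAt_integral h0 hC (by
    simp only [key, siteGen]
    have := continuous_density h h0
    fun_prop) hs
  rw [key] at hd
  simpa only [density_eq_integral_extend] using hd

/-- The two-points correlation function, extended to the closed triangle. -/
def corrExt (π : Params) (P : Measure Ω) (X : ℝ≥0 → Ω → Config N) (t : ℝ≥0) (p : ℕ × ℕ) : ℝ :=
  ∫ ω, dual π (X t ω) p ∂P - density π P X t p.1 * density π P X t p.2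

lemma corrExt_coe (h : IsJumpProcess (stateSpace π N) (particleGen π N) P X)
    (h0 : Integrable (fun ω => (1 + (mass (X 0 ω) : ℝ)) ^ 2) P) (t : ℝ≥0) (x y : Bulk N) :
    corrExt π P X t (x, y) = corr π P X t x y := by
  have := h.isProbabilityMeasure
  rw [corrExt, corr]
  split_ifs with hxy
  · subst hxy
    simp only [dual_self, sq]
  · have hne : (x : ℕ) ≠ y := fun e => hxy (Subtype.ext e)
    have hx := integrable_extend h h0 t x
    have hy := integrable_extend h h0 t y
    have hd := integrable_dual h h0 t (x, y)
    simp only [dual_of_ne _ _ hne, ← extend_coe π] at hd ⊢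
    set a := density π P X t x with ha
    set b := density π P X t y with hb
    have e : ∀ ω, (extend π (X t ω) x - a) * (extend π (X t ω) y - b)
        = extend π (X t ω) x * extend π (X t ω) y - b * extend π (X t ω) x
          - a * extend π (X t ω) y + a * b := fun ω => by ring
    simp only [e]
    rw [integral_add (by fun_prop) (by fun_prop), integral_sub (by fun_prop) (by fun_prop),
      integral_sub (by fun_prop) (by fun_prop),
      integral_const_mul, integral_const_mul, ← density_eq_integral_extend,
      ← density_eq_integral_extend, ← ha, ← hb]
    simp only [integral_const, probReal_univ, smul_eq_mul]
    ring

/-- One coordinate is at a reservoir, where `extend` is deterministic and equal to the density. The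
corners `(0, 0)` and `(N, N)` fit because `dual` corrects only interior diagonal points. -/
lemma corrExt_boundary (h : IsJumpProcess (stateSpace π N) (particleGen π N) P X) (hN : N ≠ 0)
    {p : ℕ × ℕ} (hp : p.1 = 0 ∨ p.2 = N) (t : ℝ≥0) : corrExt π P X t p = 0 := by
  have := h.isProbabilityMeasure
  obtain ⟨x, y⟩ := p
  have hnd : ¬ (x = y ∧ x ∈ Set.Ioo 0 N) := by
    rintro ⟨rfl, h1, h2⟩
    simp only at hp
    omega
  simp only [corrExt, dual, if_neg hnd]
  rcases hp with hp | hp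
  · simp only at hp
    subst hp
    simp only [extend_zero, density_zero]
    rw [integral_const_mul, ← density_eq_integral_extend, sub_self]
  · simp only at hp
    subst hp
    simp only [extend_self _ hN, density_self hN]
    rw [integral_mul_const, ← density_eq_integral_extend, sub_self]

lemma continuous_corrExt (h : IsJumpProcess (stateSpace π N) (particleGen π N) P X)
    (h0 : Integrable (fun ω => (1 + (mass (X 0 ω) : ℝ)) ^ 2) P) (p : ℕ × ℕ) :
    Continuous fun s : ℝ => corrExt π P X s.toNNReal p :=
  (continuous_integral_dual h h0 p).sub
    ((continuous_density h h0 p.1).mul (continuous_density h h0 p.2))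

/-- The evolution equation of the correlations. -/
theorem hasDerivAt_corrExt (h : IsJumpProcess (stateSpace π N) (particleGen π N) P X)
    (h0 : Integrable (fun ω => (1 + (mass (X 0 ω) : ℝ)) ^ 2) P) {x y : ℕ} (hx : 0 < x)
    (hxy : x ≤ y) (hy : y < N) (hcd : x = y → π.c + π.d ≠ 0) {s : ℝ} (hs : 0 < s) :
    HasDerivAt (fun s : ℝ => corrExt π P X s.toNNReal (x, y))
      (walkGen π N (corrExt π P X s.toNNReal) (x, y)
        + if y = x + 1 then source π P X s.toNNReal x else 0) s := by
  have := h.isProbabilityMeasure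
  let x' : Bulk N := ⟨x, hx, hxy.trans_lt hy⟩
  let y' : Bulk N := ⟨y, hx.trans_le hxy, hy⟩
  have key : ∀ t : ℝ≥0, ∫ ω, particleGen π N (fun η => dual π η (x, y)) (X t ω) ∂P
      = walkGen π N (fun q => ∫ ω, dual π (X t ω) q ∂P) (x, y) := fun t => by
    rw [← integral_walkGen (integrable_dual h h0 t)]
    refine integral_congr_ae (Eventually.of_forall fun ω => ?_)
    rcases hxy.eq_or_lt with rfl | hlt
    · exact particleGen_dual_self π (hcd rfl) _ x'
    · exact particleGen_dual_of_lt π (h.mem t ω) (z := x') (w := y') hlt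
  obtain ⟨C, hC⟩ := exists_quadraticGrowth_dual π N (x, y)
  have hd := h.hasDerivAt_integral h0 hC (by
    simp only [key]
    exact continuous_walkGen (continuous_integral_dual h h0) _) hs
  rw [key] at hd
  have hdx := hasDerivAt_density h h0 (x := x) x'.2 hs
  have hdy := hasDerivAt_density h h0 (x := y) y'.2 hs
  refine (hd.sub (hdx.mul hdy)).congr_deriv ?_
  unfold corrExt
  -- The time derivative of the product of densities is the tensor part without its defect, so the
  -- defect survives with a plus sign.
  rw [walkGen_sub, walkGen_tensor _ hx hy]
  simp only [source]
  ring

end Evolution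

/-! ### Parabolic maximum principle -/

section MaximumPrinciple

/-- A parabolic maximum principle on a finite set. -/
theorem le_of_deriv_nonpos_at_max {ι : Type*} {s : Finset ι} {u : ℝ → ι → ℝ} {M : ℝ}
    (hc : ∀ i ∈ s, Continuous fun t => u t i)
    (hd : ∀ i ∈ s, ∀ t, 0 < t → M < u t i → (∀ j ∈ s, u t j ≤ u t i) →
      ∃ d ≤ 0, HasDerivAt (fun t => u t i) d t)
    (h0 : ∀ i ∈ s, u 0 i ≤ M) {t : ℝ} (ht : 0 ≤ t) {i : ι} (hi : i ∈ s) : u t i ≤ M := by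
  by_contra! hlt
  -- The penalty `ε * t` makes the derivative strictly negative at a space-time maximum; `ε` is
  -- small enough for the violation at `(t, i)` to survive.
  obtain ⟨ε, hε, hεt⟩ : ∃ ε : ℝ, 0 < ε ∧ M < u t i - ε * t := by
    refine ⟨(u t i - M) / (2 * (t + 1)), div_pos (by linarith) (by linarith), ?_⟩
    have h1 : (u t i - M) / (2 * (t + 1)) * t = (u t i - M) * (t / (2 * (t + 1))) := by ring
    have h2 : t / (2 * (t + 1)) < 1 := by rw [div_lt_one (by linarith)]; linarith
    rw [h1]
    nlinarith
  have hmax : ∀ j ∈ s, ∃ r ∈ Set.Icc 0 t, ∀ r' ∈ Set.Icc 0 t,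
      u r' j - ε * r' ≤ u r j - ε * r := fun j hj => by
    have hcj := hc j hj
    exact isCompact_Icc.exists_isMaxOn (Set.nonempty_Icc.2 ht)
      (f := fun r => u r j - ε * r) (by fun_prop)
  choose! r hr hrmax using hmax
  obtain ⟨j, hj, hjmax⟩ := s.exists_max_image (fun j => u (r j) j - ε * r j) ⟨i, hi⟩
  have hval : M < u (r j) j - ε * r j :=
    hεt.trans_le ((hrmax i hi t (Set.right_mem_Icc.2 ht)).trans (hjmax i hi))
  have hrj : 0 < r j := by
    refine lt_of_le_of_ne (hr j hj).1 fun h => ?_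
    rw [← h] at hval
    have := h0 j hj
    linarith
  have hεr : 0 ≤ ε * r j := by positivity
  obtain ⟨d, hd0, hder⟩ := hd j hj (r j) hrj (by linarith) fun k hk => by
    have h1 := hrmax k hk (r j) (hr j hj)
    have h2 := hjmax k hk
    linarith
  have hv : HasDerivAt (fun x => u x j - ε * x) (d - ε) (r j) := by
    have h1 := (hasDerivAt_id (r j)).const_mul ε
    rw [mul_one] at h1
    exact hder.sub h1
  -- Slopes are taken from the left only, so that the maximum may sit at the final time.
  have hs := (hasDerivAt_iff_tendsto_slope.1 hv).mono_left
    (nhdsWithin_mono (r j) (fun x (hx : x ∈ Set.Iio (r j)) => ne_of_lt hx))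
  have hneg := hs.eventually (gt_mem_nhds (show d - ε < 0 by linarith))
  obtain ⟨x, hx, hx', hx0⟩ := (hneg.and ((eventually_mem_nhdsWithin (a := r j)
    (s := Set.Iio (r j))).and
    (eventually_nhdsWithin_of_eventually_nhds (lt_mem_nhds hrj)))).exists
  have hx' : x < r j := hx'
  have hx0 : 0 < x := hx0
  rw [slope_def_field] at hx
  have h1 := hrmax j hj x ⟨hx0.le, hx'.le.trans (hr j hj).2⟩
  exact absurd hx (not_lt.2 (div_nonneg_of_nonpos (by linarith) (by linarith)))

end MaximumPrinciple

/-! ### Conductances and the density gradient -/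

section Gradient

variable {π : Params} {N : ℕ}

/-- For `d < 0` the maximal occupation `κ = -c / d` is at least `1`. The sum `c + d` is, up to the
time scale, the rate of each jump of the walk from the upper diagonal to the diagonal. -/
lemma Params.c_add_d_nonneg (π : Params) : 0 ≤ π.c + π.d := by
  rcases lt_or_ge π.d 0 with h | h
  · obtain ⟨κ, hκ⟩ := π.exclusion h
    have hc := π.c_pos
    have hκ1 : (1 : ℝ) ≤ κ := by
      rcases Nat.eq_zero_or_pos κ with h0 | h0
      · rw [h0] at hκ; simp at hκ; linarith
      · exact_mod_cast h0
    nlinarith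
  · linarith [π.c_pos]

lemma rateDown_pos (π : Params) (z : ℕ) : 0 < rateDown π z := by
  have := π.c_pos
  have := π.lamL_pos
  unfold rateDown
  split_ifs <;> positivity

lemma rateUp_pos (π : Params) (N z : ℕ) : 0 < rateUp π N z := by
  have := π.c_pos
  have := π.lamR_pos
  unfold rateUp
  split_ifs <;> positivity

lemma rateDown_le (π : Params) (z : ℕ) : rateDown π z ≤ π.c := by
  have := π.c_pos
  have := π.lamL_le
  unfold rateDown
  split_ifs <;> nlinarith

lemma rateUp_le (π : Params) (N z : ℕ) : rateUp π N z ≤ π.c := by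
  have := π.c_pos
  have := π.lamR_le
  unfold rateUp
  split_ifs <;> nlinarith

/-- The conductance of the bond `{x, x + 1}`. -/
def conductance (π : Params) (N x : ℕ) : ℝ := if x = 0 then π.c * π.lamL else rateUp π N x

lemma conductance_pos (π : Params) (N x : ℕ) : 0 < conductance π N x := by
  unfold conductance
  split_ifs
  · exact mul_pos π.c_pos π.lamL_pos
  · exact rateUp_pos π N x

lemma conductance_le (π : Params) (N x : ℕ) : conductance π N x ≤ π.c := by
  have := π.c_pos
  have := π.lamL_le
  unfold conductance
  split_ifs
  · nlinarith
  · exact rateUp_le π N x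

lemma le_conductance (π : Params) (N x : ℕ) :
    π.c * min π.lamL π.lamR ≤ conductance π N x := by
  have hc := π.c_pos
  unfold conductance rateUp
  split_ifs
  · exact mul_le_mul_of_nonneg_left (min_le_left _ _) hc.le
  · exact mul_le_mul_of_nonneg_left (min_le_right _ _) hc.le
  · exact mul_le_of_le_one_right hc.le ((min_le_left _ _).trans π.lamL_le)

/-- Divergence form, each bond being labelled by its left endpoint; hence the unsimplified `x - 1 +
1`. -/
lemma siteGen_eq_conductance (r : ℕ → ℝ) {x : ℕ} (hx : x ∈ Set.Ioo 0 N) :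
    siteGen π N r x = (N : ℝ) ^ 2 * (conductance π N x * (r (x + 1) - r x)
      - conductance π N (x - 1) * (r (x - 1 + 1) - r (x - 1))) := by
  have hx0 := hx.1
  have hxN := hx.2
  have h1 : conductance π N x = rateUp π N x := if_neg hx0.ne'
  have h2 : conductance π N (x - 1) = rateDown π x := by
    unfold conductance rateUp rateDown
    by_cases h : x = 1
    · rw [if_pos (by omega), if_pos h]
    · rw [if_neg (by omega), if_neg (by omega), if_neg h]
  rw [siteGen, h1, h2, Nat.sub_add_cancel hx0]
  ring

variable {Ω : Type*} [MeasurableSpace Ω] {P : Measure Ω} {X : ℝ≥0 → Ω → Config N}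

/-- The density gradient is controlled at all times by its initial value. -/
theorem abs_density_gradient_le (h : IsJumpProcess (stateSpace π N) (particleGen π N) P X)
    (h0 : Integrable (fun ω => (1 + (mass (X 0 ω) : ℝ)) ^ 2) P) {G : ℝ}
    (hG : ∀ x < N, |density π P X 0 (x + 1) - density π P X 0 x| ≤ G) (t : ℝ≥0) {x : ℕ}
    (hx : x < N) :
    |density π P X t (x + 1) - density π P X t x| ≤ G / min π.lamL π.lamR := by
  have hc := π.c_pos
  have hmin : 0 < min π.lamL π.lamR := lt_min π.lamL_pos π.lamR_pos
  have hG0 : 0 ≤ G := (abs_nonneg _).trans (hG x hx)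
  -- Time derivative of the density, zero at the reservoirs.
  let D : ℝ → ℕ → ℝ := fun s y =>
    if y ∈ Set.Ioo 0 N then siteGen π N (density π P X s.toNNReal) y else 0
  have hD : ∀ y ≤ N, ∀ s, 0 < s →
      HasDerivAt (fun s : ℝ => density π P X s.toNNReal y) (D s y) s := fun y hy s hs => by
    by_cases hy' : y ∈ Set.Ioo 0 N
    · simpa only [D, if_pos hy'] using hasDerivAt_density h h0 hy' hs
    · simp only [D, if_neg hy', density, dif_neg hy']
      exact hasDerivAt_const _ _
  -- The maximum principle holds for the flux, not for the gradient itself, because the end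
  -- conductances differ; the sign `σ` yields both inequalities. Converting back costs the factor `1
  -- / min lamL lamR`.
  have key : ∀ σ : ℝ, |σ| ≤ 1 → ∀ s : ℝ, 0 ≤ s → ∀ y ∈ Finset.range N,
      σ * (conductance π N y * (density π P X s.toNNReal (y + 1) - density π P X s.toNNReal y))
        ≤ π.c * G := by
    intro σ hσ s hs y hy
    refine le_of_deriv_nonpos_at_max (s := Finset.range N) (u := fun s y => σ * (conductance π N y
        * (density π P X s.toNNReal (y + 1) - density π P X s.toNNReal y)))
      (fun y _ => ?_) (fun y hy s hs _ hmax => ?_) (fun y hy => ?_) hs hy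
    · have h1 := continuous_density h h0 y
      have h2 := continuous_density h h0 (y + 1)
      fun_prop
    · have hyN := Finset.mem_range.1 hy
      refine ⟨σ * (conductance π N y * (D s (y + 1) - D s y)), ?_,
        (((hD (y + 1) hyN s hs).sub (hD y hyN.le s hs)).const_mul _).const_mul _⟩
      -- `D` is `N²` times a difference of fluxes through adjacent bonds, hence has a sign at either
      -- end of a bond of maximal flux.
      have h1 : σ * D s (y + 1) ≤ 0 := by
        by_cases hy' : y + 1 ∈ Set.Ioo 0 N
        · have := hmax (y + 1) (Finset.mem_range.2 hy'.2)
          simp only [D, if_pos hy']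
          rw [siteGen_eq_conductance _ hy', Nat.add_sub_cancel, mul_left_comm, mul_sub]
          exact mul_nonpos_of_nonneg_of_nonpos (by positivity) (by linarith)
        · simp only [D, if_neg hy', mul_zero, le_refl]
      have h2 : 0 ≤ σ * D s y := by
        by_cases hy' : y ∈ Set.Ioo 0 N
        · have := hmax (y - 1) (Finset.mem_range.2 (by omega))
          simp only [D, if_pos hy']
          rw [siteGen_eq_conductance _ hy', mul_left_comm, mul_sub]
          exact mul_nonneg (by positivity) (by linarith)
        · simp only [D, if_neg hy', mul_zero, le_refl]
      rw [mul_left_comm, mul_sub]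
      exact mul_nonpos_of_nonneg_of_nonpos (conductance_pos π N y).le (by linarith)
    · have h1 := hG y (Finset.mem_range.1 hy)
      rw [Real.toNNReal_zero]
      refine (le_abs_self _).trans ?_
      rw [abs_mul, abs_mul, abs_of_pos (conductance_pos π N y)]
      calc _ ≤ 1 * (conductance π N y * G) := by
            have := (conductance_pos π N y).le
            gcongr
        _ ≤ _ := by rw [one_mul]; gcongr; exact conductance_le π N y
  have k1 := key 1 (by simp) t t.coe_nonneg x (Finset.mem_range.2 hx)
  have k2 := key (-1) (by simp) t t.coe_nonneg x (Finset.mem_range.2 hx)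
  rw [Real.toNNReal_coe] at k1 k2
  have k3 : conductance π N x * |density π P X t (x + 1) - density π P X t x| ≤ π.c * G := by
    rw [← abs_of_pos (conductance_pos π N x), ← abs_mul, abs_le]
    constructor <;> linarith
  rw [le_div_iff₀ hmin]
  have k4 := mul_le_mul_of_nonneg_right (le_conductance π N x)
    (abs_nonneg (density π P X t (x + 1) - density π P X t x))
  have k5 : π.c * (|density π P X t (x + 1) - density π P X t x| * min π.lamL π.lamR)
      ≤ π.c * G := by linarith
  exact le_of_mul_le_mul_left k5 hc

end Gradient

/-! ### An explicit supersolution and the bound on the correlations -/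

section Barrier

variable {π : Params} {N : ℕ}

/-- Since `d` may be negative, the term in `d` has no sign alone; merged with the jumps of rate `c`
it gives rate `c + d ≥ 0` towards each diagonal neighbour. If `c + d = 0` the diagonal values drop
out, so `hw` need not cover them. -/
lemma walkGen_nonpos {x y : ℕ} (hx : 0 < x) (hxy : x ≤ y) (hy : y < N) {w : ℕ × ℕ → ℝ}
    (hw : ∀ q : ℕ × ℕ, q.1 ≤ q.2 → q.2 ≤ N → (q.1 = q.2 → π.c + π.d ≠ 0) → w q ≤ w (x, y)) :
    walkGen π N w (x, y) ≤ 0 := by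
  have hcd := π.c_add_d_nonneg
  have rd := fun z => (rateDown_pos π z).le
  have ru := fun z => (rateUp_pos π N z).le
  rw [walkGen_of_interior π hx hy]
  refine mul_nonpos_of_nonneg_of_nonpos (by positivity) ?_
  have hsym : ∀ a b, a ≤ N → b ≤ N → a ≠ b → symmExt w a b - w (x, y) ≤ 0 := fun a b ha hb hab => by
    refine sub_nonpos.2 (hw _ (min_le_max) (max_le ha hb) fun h => ?_)
    simp only at h
    omega
  rcases hxy.eq_or_lt with rfl | hlt
  · have h1 := mul_nonpos_of_nonneg_of_nonpos (rd x) (hsym (x - 1) x (by omega) hy.le (by omega))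
    have h2 := mul_nonpos_of_nonneg_of_nonpos (ru x) (hsym (x + 1) x (by omega) hy.le (by omega))
    have h3 := mul_nonpos_of_nonneg_of_nonpos (rd x) (hsym x (x - 1) hy.le (by omega) (by omega))
    have h4 := mul_nonpos_of_nonneg_of_nonpos (ru x) (hsym x (x + 1) hy.le (by omega) (by omega))
    rw [if_neg (by omega)]
    linarith
  · have h1 := mul_nonpos_of_nonneg_of_nonpos (rd x) (hsym (x - 1) y (by omega) hy.le (by omega))
    have h4 := mul_nonpos_of_nonneg_of_nonpos (ru y) (hsym x (y + 1) (by omega) hy (by omega))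
    by_cases h : y = x + 1
    · have r1 : rateUp π N x = π.c := by rw [rateUp, if_neg (by omega)]
      have r2 : rateDown π y = π.c := by rw [rateDown, if_neg (by omega)]
      have e3 : symmExt w (x + 1) y = w (y, y) := by
        rw [symmExt, ← h, min_self, max_self]
      have e4 : symmExt w x (y - 1) = w (x, x) := by
        rw [symmExt, h, Nat.add_sub_cancel, min_self, max_self]
      have hdiag : ∀ z ≤ N, (π.c + π.d) * (w (z, z) - w (x, y)) ≤ 0 := fun z hz => by
        by_cases h0 : π.c + π.d = 0
        · rw [h0, zero_mul]
        · exact mul_nonpos_of_nonneg_of_nonpos hcd (sub_nonpos.2 (hw _ le_rfl hz fun _ => h0))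
      have h2 := hdiag x (by omega)
      have h3 := hdiag y hy.le
      rw [r1, r2, e3, e4, if_pos h]
      linarith
    · have h2 := mul_nonpos_of_nonneg_of_nonpos (ru x) (hsym (x + 1) y (by omega) hy.le (by omega))
      have h3 := mul_nonpos_of_nonneg_of_nonpos (rd y) (hsym x (y - 1) (by omega) (by omega)
        (by omega))
      rw [if_neg h]
      linarith

/-- The effective distance to the left reservoir. -/
def distL (π : Params) (x : ℕ) : ℝ := if x = 0 then 0 else x - 1 + 1 / π.lamL

/-- The effective distance to the right reservoir. -/
def distR (π : Params) (N y : ℕ) : ℝ := if y = N then 0 else N - 1 - y + 1 / π.lamR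

/-- The effective length of the system. -/
def effLength (π : Params) (N : ℕ) : ℝ := N - 2 + 1 / π.lamL + 1 / π.lamR

/-- A multiple of this function bounds the expected time spent in the upper diagonal. -/
def barrier (π : Params) (N : ℕ) (p : ℕ × ℕ) : ℝ :=
  distL π p.1 * distR π N p.2 - if p.1 = p.2 ∧ p.1 ∈ Set.Ioo 0 N then effLength π N / 2 else 0

lemma distL_add_one {x : ℕ} (hx : 0 < x) : distL π (x + 1) = distL π x + 1 := by
  rw [distL, distL, if_neg (by omega), if_neg hx.ne']; push_cast; ring

lemma distR_eq {y : ℕ} (hy : y + 1 < N) : distR π N y = distR π N (y + 1) + 1 := by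
  rw [distR, distR, if_neg (by omega), if_neg hy.ne]; push_cast; ring

/-- The end bond has resistance `1 / lamL` relative to a bulk bond, and is given this length in
`distL`, so that all bonds carry the same flux. -/
lemma rateDown_mul_distL {x : ℕ} (hx : 0 < x) :
    rateDown π x * (distL π (x - 1) - distL π x) = -π.c := by
  have := π.lamL_pos.ne'
  by_cases h : x = 1
  · subst h
    simp only [rateDown, distL, if_true, Nat.sub_self, one_ne_zero, if_false]
    push_cast
    field_simp
    ring
  · obtain ⟨z, rfl⟩ := Nat.exists_eq_add_of_lt hx
    rw [zero_add] at h ⊢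
    rw [Nat.add_sub_cancel, distL_add_one (by omega), rateDown, if_neg h]
    ring

lemma rateUp_mul_distR {y : ℕ} (hy : y < N) :
    rateUp π N y * (distR π N (y + 1) - distR π N y) = -π.c := by
  have := π.lamR_pos.ne'
  by_cases h : y + 1 = N
  · subst h
    simp only [rateUp, distR, if_true]
    rw [if_neg (by omega)]
    push_cast
    field_simp
    ring
  · rw [distR_eq (y := y) (by omega), rateUp, if_neg h]
    ring

lemma one_le_distL {x : ℕ} (hx : 0 < x) : 1 ≤ distL π x := by
  have h1 : 1 ≤ 1 / π.lamL := one_le_one_div π.lamL_pos π.lamL_le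
  have h2 : (1 : ℝ) ≤ x := by exact_mod_cast hx
  rw [distL, if_neg hx.ne']
  linarith

lemma one_le_distR {y : ℕ} (hy : y < N) : 1 ≤ distR π N y := by
  have h1 : 1 ≤ 1 / π.lamR := one_le_one_div π.lamR_pos π.lamR_le
  have h2 : (y : ℝ) + 1 ≤ N := by exact_mod_cast hy
  rw [distR, if_neg hy.ne]
  linarith

lemma distL_add_distR {x : ℕ} (hx : 0 < x) (hxN : x < N) :
    distL π x + distR π N x = effLength π N := by
  rw [distL, distR, effLength, if_neg hx.ne', if_neg hxN.ne]
  ring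

lemma le_effLength : (N : ℝ) ≤ effLength π N := by
  have h1 : 1 ≤ 1 / π.lamL := one_le_one_div π.lamL_pos π.lamL_le
  have h2 : 1 ≤ 1 / π.lamR := one_le_one_div π.lamR_pos π.lamR_le
  rw [effLength]
  linarith

lemma barrier_of_ne {x y : ℕ} (h : x ≠ y) : barrier π N (x, y) = distL π x * distR π N y := by
  simp [barrier, h]

lemma barrier_self {x : ℕ} (h : x ∈ Set.Ioo 0 N) :
    barrier π N (x, x) = distL π x * distR π N x - effLength π N / 2 := by
  simp only [barrier, true_and, if_pos h]

lemma barrier_boundary {p : ℕ × ℕ} (hp : p.1 = 0 ∨ p.2 = N) : barrier π N p = 0 := by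
  have h : ¬ (p.1 = p.2 ∧ p.1 ∈ Set.Ioo 0 N) := by
    rintro ⟨h1, h2, h3⟩
    omega
  rw [barrier, if_neg h]
  rcases hp with hp | hp <;> simp [hp, distL, distR]

/-- On the diagonal the two distances are at least `1` and their sum is `effLength ≥ 2`, so their
product is at least `effLength - 1 ≥ effLength / 2`. -/
lemma barrier_nonneg (hN : 2 ≤ N) {x y : ℕ} (hx : 0 < x) (hy : y < N) : 0 ≤ barrier π N (x, y) := by
  have h1 := one_le_distL (π := π) hx
  have h2 := one_le_distR (π := π) hy
  by_cases h : x = y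
  · subst h
    have h3 := distL_add_distR (π := π) hx hy
    have h4 : (2 : ℝ) ≤ effLength π N := le_trans (by exact_mod_cast hN) le_effLength
    rw [barrier_self ⟨hx, hy⟩]
    nlinarith
  · rw [barrier_of_ne h]
    positivity

lemma barrier_le {x y : ℕ} (hx : 0 < x) (hxy : x ≤ y) (hy : y < N) :
    barrier π N (x, y) ≤ effLength π N ^ 2 := by
  have h1 := one_le_distL (π := π) hx
  have h2 := one_le_distR (π := π) hy
  have h3 := distL_add_distR (π := π) hx (hxy.trans_lt hy)
  have h4 := distL_add_distR (π := π) (hx.trans_le hxy) hy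
  have h5 := one_le_distR (π := π) (hxy.trans_lt hy)
  have h6 := one_le_distL (π := π) (hx.trans_le hxy)
  have h7 : barrier π N (x, y) ≤ distL π x * distR π N y := by
    rw [barrier]
    have : (0 : ℝ) ≤ if x = y ∧ x ∈ Set.Ioo 0 N then effLength π N / 2 else 0 := by
      split_ifs <;> linarith
    linarith
  calc _ ≤ _ := h7
    _ ≤ effLength π N * effLength π N := by
      apply mul_le_mul <;> linarith
    _ = _ := by ring

/-- The barrier is a supersolution. -/
lemma walkGen_barrier_le {x y : ℕ} (hx : 0 < x) (hxy : x ≤ y) (hy : y < N) :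
    walkGen π N (barrier π N) (x, y)
      ≤ if y = x + 1 then -((N : ℝ) ^ 2 * (π.c * (N - 1))) else 0 := by
  have hc := π.c_pos
  have hcd := π.c_add_d_nonneg
  have hL := le_effLength (π := π) (N := N)
  have hx1 := rateDown_mul_distL (π := π) hx
  have hy1 := rateUp_mul_distR (π := π) hy
  rw [walkGen_of_interior π hx hy]
  rcases hxy.eq_or_lt with rfl | hlt
  · have e1 : symmExt (barrier π N) (x - 1) x = distL π (x - 1) * distR π N x := by
      rw [symmExt, min_eq_left (by omega), max_eq_right (by omega), barrier_of_ne (by omega)]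
    have e2 : symmExt (barrier π N) x (x - 1) = distL π (x - 1) * distR π N x := by
      rw [symmExt, min_eq_right (by omega), max_eq_left (by omega), barrier_of_ne (by omega)]
    have e3 : symmExt (barrier π N) (x + 1) x = distL π x * distR π N (x + 1) := by
      rw [symmExt, min_eq_right (by omega), max_eq_left (by omega), barrier_of_ne (by omega)]
    have e4 : symmExt (barrier π N) x (x + 1) = distL π x * distR π N (x + 1) := by
      rw [symmExt, min_eq_left (by omega), max_eq_right (by omega), barrier_of_ne (by omega)]
    rw [e1, e2, e3, e4, barrier_self ⟨hx, hy⟩, if_neg (by omega), if_neg (by omega)]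
    refine mul_nonpos_of_nonneg_of_nonpos (by positivity) ?_
    have h3 := distL_add_distR (π := π) hx hy
    -- The product of distances yields `-2 c * effLength`, and lowering the diagonal by `effLength /
    -- 2` returns at most `2 c * effLength`, as the rates do not exceed `c`.
    have h4 : (rateDown π x + rateUp π N x) * effLength π N ≤ (π.c + π.c) * effLength π N := by
      have : (0 : ℝ) ≤ N := Nat.cast_nonneg N
      refine mul_le_mul_of_nonneg_right (add_le_add (rateDown_le π x) (rateUp_le π N x)) ?_
      linarith
    have h5 : rateDown π x * (distL π (x - 1) * distR π N x
        - (distL π x * distR π N x - effLength π N / 2))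
        = -π.c * distR π N x + rateDown π x * (effLength π N / 2) := by
      rw [← hx1]; ring
    have h6 : rateUp π N x * (distL π x * distR π N (x + 1)
        - (distL π x * distR π N x - effLength π N / 2))
        = -π.c * distL π x + rateUp π N x * (effLength π N / 2) := by
      rw [← hy1]; ring
    rw [h5, h6]
    nlinarith
  · have e1 : symmExt (barrier π N) (x - 1) y = distL π (x - 1) * distR π N y := by
      rw [symmExt, min_eq_left (by omega), max_eq_right (by omega), barrier_of_ne (by omega)]
    have e4 : symmExt (barrier π N) x (y + 1) = distL π x * distR π N (y + 1) := by
      rw [symmExt, min_eq_left (by omega), max_eq_right (by omega), barrier_of_ne (by omega)]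
    have h5 : rateDown π x * (distL π (x - 1) * distR π N y - distL π x * distR π N y)
        = -π.c * distR π N y := by
      rw [← hx1]; ring
    have h6 : rateUp π N y * (distL π x * distR π N (y + 1) - distL π x * distR π N y)
        = -π.c * distL π x := by
      rw [← hy1]; ring
    have r1 : rateUp π N x = π.c := by rw [rateUp, if_neg (by omega)]
    have r2 : rateDown π y = π.c := by rw [rateDown, if_neg (by omega)]
    have hx2 := distL_add_one (π := π) hx
    rw [e1, e4, barrier_of_ne hlt.ne, h5, h6, r1, r2]
    by_cases h : y = x + 1
    · have e2 : symmExt (barrier π N) (x + 1) y = barrier π N (y, y) := by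
        rw [symmExt, ← h, min_self, max_self]
      have e3 : symmExt (barrier π N) x (y - 1) = barrier π N (x, x) := by
        rw [symmExt, h, Nat.add_sub_cancel, min_self, max_self]
      have h3 := distL_add_distR (π := π) hx (hxy.trans_lt hy)
      have h7 : distR π N x = distR π N y + 1 := by rw [h]; exact distR_eq (h ▸ hy)
      rw [e2, e3, barrier_self ⟨hx, hxy.trans_lt hy⟩, barrier_self ⟨hx.trans hlt, hy⟩, if_pos h,
        if_pos h, ← mul_neg, h7]
      refine mul_le_mul_of_nonneg_left ?_ (by positivity)
      rw [h7] at h3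
      have h8 : distL π y = distL π x + 1 := by rw [h, hx2]
      -- With `a = distL π x`, `b = distR π N y` and `L = a + b + 1` the bracket equals `-c (a + b)
      -- + (c + d) (a + b - L) = -c (L - 1) - (c + d)`, where `L ≥ N`.
      have h9 : effLength π N = distL π x + distR π N y + 1 := by linarith
      rw [h8, h9]
      rw [h9] at hL
      nlinarith
    · have e2 : symmExt (barrier π N) (x + 1) y = distL π (x + 1) * distR π N y := by
        rw [symmExt, min_eq_left (by omega), max_eq_right (by omega), barrier_of_ne (by omega)]
      have e3 : symmExt (barrier π N) x (y - 1) = distL π x * distR π N (y - 1) := by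
        rw [symmExt, min_eq_left (by omega), max_eq_right (by omega), barrier_of_ne (by omega)]
      have h7 : distR π N (y - 1) = distR π N y + 1 := by
        have := distR_eq (π := π) (N := N) (y := y - 1) (by omega)
        rwa [Nat.sub_add_cancel (by omega)] at this
      rw [e2, e3, if_neg h, if_neg h, hx2, h7]
      refine le_of_eq ?_
      ring

variable {Ω : Type*} [MeasurableSpace Ω] {P : Measure Ω} {X : ℝ≥0 → Ω → Config N}

/-- A bound on the correlations through the barrier. -/
theorem abs_corrExt_le (h : IsJumpProcess (stateSpace π N) (particleGen π N) P X)
    (h0 : Integrable (fun ω => (1 + (mass (X 0 ω) : ℝ)) ^ 2) P) (hN : 2 ≤ N) {M G : ℝ}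
    (hM0 : 0 ≤ M) (hG0 : 0 ≤ G)
    (hM : ∀ x y : ℕ, 0 < x → x ≤ y → y < N → (x = y → π.c + π.d ≠ 0) →
      |corrExt π P X 0 (x, y)| ≤ M)
    (hG : ∀ t : ℝ≥0, ∀ z : ℕ, 0 < z → z + 1 < N → |source π P X t z| ≤ G) (t : ℝ≥0) {x y : ℕ}
    (hx : 0 < x) (hxy : x ≤ y) (hy : y < N) (hcd : x = y → π.c + π.d ≠ 0) :
    |corrExt π P X t (x, y)|
      ≤ M + G / ((N : ℝ) ^ 2 * (π.c * (N - 1))) * effLength π N ^ 2 := by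
  have hc := π.c_pos
  have hN1 : (0 : ℝ) < N - 1 := by
    have : (2 : ℝ) ≤ N := by exact_mod_cast hN
    linarith
  have hN0 : (0 : ℝ) < N := by linarith
  -- The decay of the barrier on the upper diagonal; `B = G / K` is chosen so that `B * barrier`
  -- absorbs a source of size `G`.
  set K := (N : ℝ) ^ 2 * (π.c * (N - 1)) with hK
  have hK0 : 0 < K := by positivity
  set B := G / K with hB
  have hB0 : 0 ≤ B := by positivity
  classical
  let s : Finset (ℕ × ℕ) := (Finset.range N ×ˢ Finset.range N).filter fun q =>
    0 < q.1 ∧ q.1 ≤ q.2 ∧ (q.1 = q.2 → π.c + π.d ≠ 0)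
  have hs : ∀ q : ℕ × ℕ, q ∈ s ↔ 0 < q.1 ∧ q.1 ≤ q.2 ∧ q.2 < N ∧
      (q.1 = q.2 → π.c + π.d ≠ 0) := fun q => by
    simp only [s, Finset.mem_filter, Finset.mem_product, Finset.mem_range]
    constructor
    · tauto
    · rintro ⟨h1, h2, h3, h4⟩
      exact ⟨⟨h2.trans_lt h3, h3⟩, h1, h2, h4⟩
  have key : ∀ σ : ℝ, |σ| = 1 → σ * corrExt π P X t (x, y) - B * barrier π N (x, y) ≤ M := by
    intro σ hσ
    have := le_of_deriv_nonpos_at_max (s := s) (M := M)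
      (u := fun r q => σ * corrExt π P X r.toNNReal q - B * barrier π N q)
      (fun q _ => ?_) (fun q hq r hr hlt hmax => ?_) (fun q hq => ?_) t.coe_nonneg
      ((hs (x, y)).2 ⟨hx, hxy, hy, hcd⟩)
    · simpa only [Real.toNNReal_coe] using this
    · have := continuous_corrExt h h0 q
      fun_prop
    · obtain ⟨a, b⟩ := q
      obtain ⟨ha, hab, hb, hq'⟩ := (hs _).1 hq
      simp only at ha hab hb hq'
      refine ⟨_, ?_, ((hasDerivAt_corrExt h h0 ha hab hb hq' hr).const_mul σ).sub_const _⟩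
      have hw : walkGen π N (fun q => σ * corrExt π P X r.toNNReal q - B * barrier π N q) (a, b)
          ≤ 0 := by
        refine walkGen_nonpos ha hab hb fun q h1 h2 h3 => ?_
        -- On the absorbing boundary the comparison function is `0 ≤ M`, below the value at a
        -- maximum that violates the bound.
        by_cases hqb : q.1 = 0 ∨ q.2 = N
        · have e : σ * corrExt π P X r.toNNReal q - B * barrier π N q = 0 := by
            rw [corrExt_boundary h (by omega) hqb, barrier_boundary hqb]; ring
          rw [e]
          exact hM0.trans hlt.le
        · push Not at hqb
          exact hmax q ((hs q).2 ⟨Nat.pos_of_ne_zero hqb.1, h1, lt_of_le_of_ne h2 hqb.2, h3⟩)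
      rw [walkGen_sub π N (fun q => σ * corrExt π P X r.toNNReal q) (fun q => B * barrier π N q),
        walkGen_const_mul, walkGen_const_mul] at hw
      have hbar := mul_le_mul_of_nonneg_left (walkGen_barrier_le (π := π) ha hab hb) hB0
      by_cases hba : b = a + 1
      · rw [if_pos hba] at hbar ⊢
        have hBK : B * -((N : ℝ) ^ 2 * (π.c * (N - 1))) = -G := by
          rw [mul_neg, ← hK, hB, div_mul_cancel₀ _ hK0.ne']
        have hsrc : σ * source π P X r.toNNReal a ≤ G := by
          refine (le_abs_self _).trans ?_
          rw [abs_mul, hσ, one_mul]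
          exact hG _ a ha (by omega)
        rw [hBK] at hbar
        rw [mul_add]
        linarith
      · rw [if_neg hba] at hbar ⊢
        rw [add_zero]
        linarith
    · obtain ⟨ha, hab, hb, hq'⟩ := (hs _).1 hq
      have h1 : σ * corrExt π P X 0 q ≤ M := by
        refine (le_abs_self _).trans ?_
        rw [abs_mul, hσ, one_mul]
        exact hM _ _ ha hab hb hq'
      have h2 := mul_nonneg hB0 (barrier_nonneg (π := π) hN ha hb)
      simp only [Real.toNNReal_zero]
      linarith
  have hle := mul_le_mul_of_nonneg_left (barrier_le (π := π) hx hxy hy) hB0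
  have k1 := key 1 (by simp)
  have k2 := key (-1) (by simp)
  rw [abs_le]
  constructor <;> linarith

end Barrier

/-! ### The random walk and Duhamel's formula -/

section Walk

variable {π : Params} {N : ℕ}

lemma finite_closedTriangle (N : ℕ) : (closedTriangle N).Finite :=
  (Set.finite_Iic (N, N)).subset fun _ hp => ⟨hp.1.trans hp.2, hp.2⟩

lemma walkGen_congr {f g : ℕ × ℕ → ℝ} (h : ∀ q ∈ closedTriangle N, f q = g q) {p : ℕ × ℕ}
    (hp : p ∈ closedTriangle N) : walkGen π N f p = walkGen π N g p := by
  obtain ⟨h1, h2⟩ := hp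
  by_cases hb : p.1 = 0 ∨ p.2 = N
  · rw [walkGen_of_boundary _ _ hb, walkGen_of_boundary _ _ hb]
  · push Not at hb
    have hlt : p.2 < N := lt_of_le_of_ne h2 hb.2
    have hs : ∀ a b, a ≤ N → b ≤ N → symmExt f a b = symmExt g a b := fun a b ha hb =>
      h _ ⟨min_le_max, max_le ha hb⟩
    have hp' : f p = g p := h p ⟨h1, h2⟩
    have hd : ∀ z ≤ N, f (z, z) = g (z, z) := fun z hz => h _ ⟨le_rfl, hz⟩
    unfold walkGen
    rw [hs _ _ (by omega) h2, hs _ _ (by omega) h2, hs _ _ (by omega) (by omega),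
      hs _ _ (by omega) (by omega), hp', hd _ (by omega), hd _ h2]

lemma walkGen_sum {ι : Type*} (s : Finset ι) (k : ι → ℝ) (f : ι → ℕ × ℕ → ℝ) (p : ℕ × ℕ) :
    walkGen π N (fun q => ∑ i ∈ s, k i * f i q) p = ∑ i ∈ s, k i * walkGen π N (f i) p := by
  classical
  induction s using Finset.induction_on with
  | empty => simpa using walkGen_const_mul π N 0 0 p
  | insert a s ha ih =>
    simp only [Finset.sum_insert ha]
    rw [walkGen_add π N (fun q => k a * f a q) (fun q => ∑ i ∈ s, k i * f i q),
      walkGen_const_mul, ih]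

/-- The indicator function of a point. -/
def pointMass (q : ℕ × ℕ) (p : ℕ × ℕ) : ℝ := if p = q then 1 else 0

lemma sum_mul_pointMass (f : ℕ × ℕ → ℝ) {p : ℕ × ℕ} (hp : p ∈ closedTriangle N) :
    ∑ q ∈ (finite_closedTriangle N).toFinset, f q * pointMass q p = f p := by
  rw [Finset.sum_eq_single p]
  · simp [pointMass]
  · intro q _ hq
    simp [pointMass, Ne.symm hq]
  · intro h
    exact absurd ((finite_closedTriangle N).mem_toFinset.2 hp) h

lemma sum_mul_walkGen_pointMass (f : ℕ × ℕ → ℝ) {p : ℕ × ℕ} (hp : p ∈ closedTriangle N) :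
    ∑ q ∈ (finite_closedTriangle N).toFinset, f q * walkGen π N (pointMass q) p
      = walkGen π N f p := by
  rw [← walkGen_sum]
  exact walkGen_congr (fun q hq => sum_mul_pointMass f hq) hp

lemma exists_abs_le_on_closedTriangle (N : ℕ) (f : ℕ × ℕ → ℝ) :
    ∃ C, ∀ p ∈ closedTriangle N, |f p| ≤ C := by
  obtain ⟨C, hC⟩ := ((finite_closedTriangle N).image fun p => |f p|).bddAbove
  exact ⟨C, fun p hp => hC ⟨p, hp, rfl⟩⟩

variable {W : Type*} [MeasurableSpace W] {μ : Measure W} {Y : ℝ≥0 → W → ℕ × ℕ}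

lemma integrable_walk (h : IsJumpProcess (closedTriangle N) (walkGen π N) μ Y) (f : ℕ × ℕ → ℝ)
    (t : ℝ≥0) : Integrable (fun w => f (Y t w)) μ := by
  obtain ⟨C, hC⟩ := exists_abs_le_on_closedTriangle N f
  exact h.integrable_comp hC t

/-- The closed triangle is finite and `walkGen` at its points sees only its points, so any `f` may
be replaced by a finitely supported one. -/
lemma walk_dynkin (h : IsJumpProcess (closedTriangle N) (walkGen π N) μ Y) (f : ℕ × ℕ → ℝ)
    (t : ℝ≥0) : ∫ w, f (Y t w) ∂μ = ∫ w, f (Y 0 w) ∂μ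
      + ∫ s in (0 : ℝ)..t, ∫ w, walkGen π N f (Y s.toNNReal w) ∂μ := by
  have he : ∀ q ∈ closedTriangle N, (closedTriangle N).indicator f q = f q := fun q hq =>
    Set.indicator_of_mem hq f
  obtain ⟨C, hC⟩ := exists_abs_le_on_closedTriangle N
    (walkGen π N ((closedTriangle N).indicator f))
  have key := h.dynkin (f := (closedTriangle N).indicator f)
    ((finite_closedTriangle N).subset Set.support_indicator_subset) hC t
  simpa only [fun t w => he _ (h.mem t w), fun t w => walkGen_congr (π := π) he (h.mem t w)]
    using key

lemma continuous_walk (h : IsJumpProcess (closedTriangle N) (walkGen π N) μ Y)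
    (f : ℕ × ℕ → ℝ) : Continuous fun s : ℝ => ∫ w, f (Y s.toNNReal w) ∂μ := by
  have := h.isProbabilityMeasure
  obtain ⟨C, hC⟩ := exists_abs_le_on_closedTriangle N (walkGen π N f)
  have hcont := intervalIntegral.continuous_primitive (intervalIntegrable_of_bound_le
    (h.stronglyMeasurable_integral (walkGen π N f)) fun T => ⟨C, fun s _ => by
      have := norm_integral_le_of_norm_le_const (μ := μ)
        (f := fun w => walkGen π N f (Y s.toNNReal w))
        (Eventually.of_forall fun w => hC _ (h.mem _ w))
      simpa using this⟩) 0
  simp only [fun s : ℝ => walk_dynkin h f s.toNNReal]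
  exact continuous_const.add (hcont.comp (NNReal.continuous_coe.comp continuous_real_toNNReal))

lemma hasDerivAt_walk (h : IsJumpProcess (closedTriangle N) (walkGen π N) μ Y)
    (f : ℕ × ℕ → ℝ) {s : ℝ} (hs : 0 < s) :
    HasDerivAt (fun s : ℝ => ∫ w, f (Y s.toNNReal w) ∂μ)
      (∫ w, walkGen π N f (Y s.toNNReal w) ∂μ) s := by
  have h1 := ((continuous_walk h (walkGen π N f)).integral_hasStrictDerivAt 0
    s).hasDerivAt.const_add (∫ w, f (Y 0 w) ∂μ)
  refine h1.congr_of_eventuallyEq ?_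
  filter_upwards [lt_mem_nhds hs] with r hr
  rw [walk_dynkin h f r.toNNReal, Real.coe_toNNReal r hr.le]

lemma integral_walk_eq_sum (h : IsJumpProcess (closedTriangle N) (walkGen π N) μ Y)
    (f : ℕ × ℕ → ℝ) (t : ℝ≥0) :
    ∫ w, f (Y t w) ∂μ
      = ∑ q ∈ (finite_closedTriangle N).toFinset, f q * ∫ w, pointMass q (Y t w) ∂μ := by
  simp only [← integral_const_mul]
  rw [← integral_finsetSum _ fun q _ => (integrable_walk h (pointMass q) t).const_mul _]
  exact integral_congr_ae (Eventually.of_forall fun w => (sum_mul_pointMass f (h.mem t w)).symm)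

lemma integral_walkGen_walk_eq_sum (h : IsJumpProcess (closedTriangle N) (walkGen π N) μ Y)
    (f : ℕ × ℕ → ℝ) (t : ℝ≥0) :
    ∫ w, walkGen π N f (Y t w) ∂μ
      = ∑ q ∈ (finite_closedTriangle N).toFinset,
          f q * ∫ w, walkGen π N (pointMass q) (Y t w) ∂μ := by
  simp only [← integral_const_mul]
  rw [← integral_finsetSum _ fun q _ =>
    (integrable_walk h (walkGen π N (pointMass q)) t).const_mul _]
  exact integral_congr_ae (Eventually.of_forall fun w =>
    (sum_mul_walkGen_pointMass f (h.mem t w)).symm)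

/-- If `c + d = 0` then the walk does not enter the diagonal. -/
lemma walk_ae_ne_diagonal (h : IsJumpProcess (closedTriangle N) (walkGen π N) μ Y) {p : ℕ × ℕ}
    (hp : p.1 = p.2 → π.c + π.d ≠ 0) (h0 : ∀ᵐ w ∂μ, Y 0 w = p) (t : ℝ≥0) :
    ∀ᵐ w ∂μ, (Y t w).1 = (Y t w).2 → (Y t w).1 ∈ Set.Ioo 0 N → π.c + π.d ≠ 0 := by
  by_cases hcd : π.c + π.d = 0
  · have hp' : p.1 ≠ p.2 := fun e => hp e hcd
    let f : ℕ × ℕ → ℝ := fun q => if q.1 = q.2 ∧ q.1 ∈ Set.Ioo 0 N then 1 else 0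
    have hf0 : ∀ q, 0 ≤ f q := fun q => by simp only [f]; split_ifs <;> norm_num
    have hf1 : ∀ q, f q ≤ 1 := fun q => by simp only [f]; split_ifs <;> norm_num
    -- Off the diagonal `f` vanishes and the rate into the diagonal is `c + d = 0`; on it `f` is
    -- maximal. So the probability of being on the interior diagonal cannot grow from `0`.
    have hgen : ∀ q ∈ closedTriangle N, walkGen π N f q ≤ 0 := by
      rintro ⟨x, y⟩ ⟨hxy, hyN⟩
      simp only at hxy hyN
      by_cases hb : (x, y).1 = 0 ∨ (x, y).2 = N
      · rw [walkGen_of_boundary _ _ hb]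
      · push Not at hb
        simp only at hb
        refine walkGen_nonpos (by omega) hxy (by omega) fun q _ _ hq3 => ?_
        have hq : q.1 ≠ q.2 := fun e => hq3 e hcd
        have : f q = 0 := by simp only [f, hq, false_and, if_false]
        rw [this]
        exact hf0 _
    have h1 : ∫ w, f (Y 0 w) ∂μ = 0 := by
      refine integral_eq_zero_of_ae ?_
      filter_upwards [h0] with w hw
      simp [f, hw, hp']
    have h2 : ∫ w, f (Y t w) ∂μ ≤ 0 := by
      rw [walk_dynkin h f t, h1, zero_add]
      have h3 : 0 ≤ ∫ s in (0 : ℝ)..t, -∫ w, walkGen π N f (Y s.toNNReal w) ∂μ :=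
        intervalIntegral.integral_nonneg t.coe_nonneg fun s _ =>
          neg_nonneg.2 (integral_nonpos fun w => hgen _ (h.mem _ w))
      rw [intervalIntegral.integral_neg] at h3
      linarith
    have h4 := (integral_eq_zero_iff_of_nonneg (fun w => hf0 (Y t w)) (integrable_walk h f t)).1
      (le_antisymm h2 (integral_nonneg fun w => hf0 _))
    filter_upwards [h4] with w hw e1 e2
    simp only [f, e1, true_and, Pi.zero_apply] at hw
    rw [e1] at e2
    simp [e2.1, e2.2] at hw
  · exact Eventually.of_forall fun w _ _ => hcd

variable {Ω : Type*} [MeasurableSpace Ω] {P : Measure Ω} {X : ℝ≥0 → Ω → Config N}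

/-- The source term, as a function on the closed triangle. -/
def sourceExt (π : Params) (P : Measure Ω) (X : ℝ≥0 → Ω → Config N) (t : ℝ≥0) : ℕ × ℕ → ℝ :=
  (upperDiagonal N).indicator fun q => source π P X t q.1

lemma hasDerivAt_corrExt_closedTriangle
    (h : IsJumpProcess (stateSpace π N) (particleGen π N) P X)
    (h0 : Integrable (fun ω => (1 + (mass (X 0 ω) : ℝ)) ^ 2) P) (hN : N ≠ 0) {q : ℕ × ℕ}
    (hq : q ∈ closedTriangle N) (hcd : q.1 = q.2 → q.1 ∈ Set.Ioo 0 N → π.c + π.d ≠ 0) {s : ℝ}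
    (hs : 0 < s) :
    HasDerivAt (fun s : ℝ => corrExt π P X s.toNNReal q)
      (walkGen π N (corrExt π P X s.toNNReal) q + sourceExt π P X s.toNNReal q) s := by
  by_cases hb : q.1 = 0 ∨ q.2 = N
  · have hnot : q ∉ upperDiagonal N := by
      rintro ⟨h1, h2, h3⟩
      omega
    rw [walkGen_of_boundary _ _ hb, sourceExt, Set.indicator_of_notMem hnot, add_zero]
    simp only [corrExt_boundary h hN hb]
    exact hasDerivAt_const _ _
  · push Not at hb
    obtain ⟨x, y⟩ := q
    obtain ⟨hxy, hyN⟩ := hq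
    simp only at hb hxy hyN hcd
    have hx : 0 < x := Nat.pos_of_ne_zero hb.1
    have hy : y < N := lt_of_le_of_ne hyN hb.2
    refine (hasDerivAt_corrExt h h0 hx hxy hy (fun e => hcd e ⟨hx, by omega⟩) hs).congr_deriv ?_
    congr 1
    by_cases hd : y = x + 1
    · rw [if_pos hd, sourceExt, Set.indicator_of_mem (show (x, y) ∈ upperDiagonal N from
        ⟨hx, hd, hy⟩)]
    · rw [if_neg hd, sourceExt, Set.indicator_of_notMem fun hm => hd hm.2.1]

/-- Duhamel's formula: the correlations through the random walk. -/
theorem corrExt_eq_walk (h : IsJumpProcess (stateSpace π N) (particleGen π N) P X)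
    (h0 : Integrable (fun ω => (1 + (mass (X 0 ω) : ℝ)) ^ 2) P) (hN : N ≠ 0)
    (hY : IsJumpProcess (closedTriangle N) (walkGen π N) μ Y) {p : ℕ × ℕ}
    (hp : p.1 = p.2 → π.c + π.d ≠ 0) (hY0 : ∀ᵐ w ∂μ, Y 0 w = p) (t : ℝ≥0) :
    corrExt π P X t p = ∫ w, corrExt π P X 0 (Y t w) ∂μ
      + ∫ s in (0 : ℝ)..t, ∫ w, sourceExt π P X ((t : ℝ) - s).toNNReal (Y s.toNNReal w) ∂μ := by
  have := hY.isProbabilityMeasure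
  set m : ℝ → ℕ × ℕ → ℝ := fun s q => ∫ w, pointMass q (Y s.toNNReal w) ∂μ with hm
  -- The expectation of `corrExt` at time `t - s` evaluated at the walk at time `s`, expanded over
  -- point masses to reduce differentiation to finite sums of products.
  set F : ℝ → ℝ := fun s => ∑ q ∈ (finite_closedTriangle N).toFinset,
    corrExt π P X ((t : ℝ) - s).toNNReal q * m s q with hF
  have hmc : ∀ q, Continuous fun s => m s q := fun q => continuous_walk hY (pointMass q)
  have hcorr : ∀ q, Continuous fun s : ℝ => corrExt π P X ((t : ℝ) - s).toNNReal q := fun q =>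
    (continuous_corrExt h h0 q).comp (continuous_const.sub continuous_id)
  have hsource : ∀ q, Continuous fun s : ℝ => sourceExt π P X ((t : ℝ) - s).toNNReal q :=
    fun q => by
      have hc : ∀ x, Continuous fun s : ℝ => density π P X ((t : ℝ) - s).toNNReal x := fun x =>
        (continuous_density h h0 x).comp (continuous_const.sub continuous_id)
      by_cases hq : q ∈ upperDiagonal N
      · simp only [sourceExt, Set.indicator_of_mem hq, source]
        exact continuous_const.mul (((hc _).sub (hc _)).pow 2)
      · simp only [sourceExt, Set.indicator_of_notMem hq]
        exact continuous_const
  have hderiv : ∀ s ∈ Set.Ioo (0 : ℝ) t, HasDerivAt F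
      (-∫ w, sourceExt π P X ((t : ℝ) - s).toNNReal (Y s.toNNReal w) ∂μ) s := by
    rintro s ⟨hs0, hst⟩
    have hterm : ∀ q ∈ (finite_closedTriangle N).toFinset, HasDerivAt
        (fun s => corrExt π P X ((t : ℝ) - s).toNNReal q * m s q)
        (-(walkGen π N (corrExt π P X ((t : ℝ) - s).toNNReal) q
            + sourceExt π P X ((t : ℝ) - s).toNNReal q) * m s q
          + corrExt π P X ((t : ℝ) - s).toNNReal q
            * ∫ w, walkGen π N (pointMass q) (Y s.toNNReal w) ∂μ) s := by
      intro q hq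
      have hq' := (finite_closedTriangle N).mem_toFinset.1 hq
      have hmd := hasDerivAt_walk hY (pointMass q) hs0
      by_cases hcd : q.1 = q.2 → q.1 ∈ Set.Ioo 0 N → π.c + π.d ≠ 0
      · have hcd' := hasDerivAt_corrExt_closedTriangle h h0 hN hq' hcd
          (s := (t : ℝ) - s) (by linarith)
        exact (hcd'.comp_const_sub (t : ℝ) s).mul hmd
      -- On the diagonal with `c + d = 0` there is no evolution equation for the correlations, but
      -- the walk gives such points no mass.
      · have hm0 : ∀ r, m r q = 0 := fun r => by
          refine integral_eq_zero_of_ae ?_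
          filter_upwards [walk_ae_ne_diagonal hY hp hY0 r.toNNReal] with w hw
          refine if_neg fun e => hcd ?_
          rw [← e]
          exact hw
        have hz : ∫ w, walkGen π N (pointMass q) (Y s.toNNReal w) ∂μ = 0 := by
          have hmd' : HasDerivAt (fun r => m r q)
            (∫ w, walkGen π N (pointMass q) (Y s.toNNReal w) ∂μ) s := hmd
          simp only [hm0] at hmd'
          exact hmd'.unique (hasDerivAt_const _ _)
        simp only [hm0, hz, mul_zero, add_zero]
        exact hasDerivAt_const _ _
    refine (HasDerivAt.fun_sum hterm).congr_deriv ?_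
    -- Both generator terms are the expectation of `walkGen` of the correlations along the walk and
    -- cancel; only the source remains.
    rw [Finset.sum_add_distrib, ← integral_walkGen_walk_eq_sum hY,
      integral_walk_eq_sum hY (walkGen π N (corrExt π P X ((t : ℝ) - s).toNNReal)),
      integral_walk_eq_sum hY (sourceExt π P X ((t : ℝ) - s).toNNReal), ← Finset.sum_add_distrib,
      ← Finset.sum_neg_distrib]
    refine Finset.sum_congr rfl fun q _ => ?_
    simp only [hm]
    ring
  have hFc : Continuous F := continuous_finsetSum _ fun q _ => (hcorr q).mul (hmc q)
  have hgc : Continuous fun s : ℝ =>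
      -∫ w, sourceExt π P X ((t : ℝ) - s).toNNReal (Y s.toNNReal w) ∂μ := by
    simp only [integral_walk_eq_sum hY (sourceExt π P X _)]
    exact (continuous_finsetSum _ fun q _ => (hsource q).mul (hmc q)).neg
  have hftc := intervalIntegral.integral_eq_sub_of_hasDerivAt_of_le t.coe_nonneg
    hFc.continuousOn hderiv (hgc.intervalIntegrable _ _)
  rw [intervalIntegral.integral_neg] at hftc
  have hFt : F t = ∫ w, corrExt π P X 0 (Y t w) ∂μ := by
    simp only [hF, hm, sub_self, Real.toNNReal_zero, Real.toNNReal_coe]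
    rw [← integral_walk_eq_sum hY]
  have hF0 : F 0 = corrExt π P X t p := by
    simp only [hF, hm, sub_zero, Real.toNNReal_zero, Real.toNNReal_coe]
    rw [← integral_walk_eq_sum hY, integral_congr_ae
      (g := fun _ => corrExt π P X t p) (by filter_upwards [hY0] with w hw; rw [hw])]
    simp
  rw [hFt, hF0] at hftc
  linarith

lemma measurable_indicator_upperDiagonal
    (hY : IsJumpProcess (closedTriangle N) (walkGen π N) μ Y) :
    Measurable fun q : ℝ × W =>
      (upperDiagonal N).indicator (fun _ => (1 : ℝ≥0∞)) (Y q.1.toNNReal q.2) := by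
  have h1 : (fun q : ℝ × W =>
      (upperDiagonal N).indicator (fun _ => (1 : ℝ≥0∞)) (Y q.1.toNNReal q.2)) = fun q =>
      ENNReal.ofReal ((upperDiagonal N).indicator (fun _ => (1 : ℝ)) (Y q.1.toNNReal q.2)) := by
    ext ⟨t, w⟩
    by_cases hq : Y t.toNNReal w ∈ upperDiagonal N <;> simp [hq]
  rw [h1]
  exact (hY.measurable_uncurry _).ennreal_ofReal

/-- The expected occupation time of the upper diagonal, with the order of integration exchanged. -/
lemma occupationTime_eq (hY : IsJumpProcess (closedTriangle N) (walkGen π N) μ Y) :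
    ∫⁻ w, (∫⁻ t in Set.Ici (0 : ℝ),
      (upperDiagonal N).indicator (fun _ => (1 : ℝ≥0∞)) (Y t.toNNReal w)) ∂μ
    = ∫⁻ t in Set.Ici (0 : ℝ), ∫⁻ w,
      (upperDiagonal N).indicator (fun _ => (1 : ℝ≥0∞)) (Y t.toNNReal w) ∂μ := by
  have := hY.isProbabilityMeasure
  refine lintegral_lintegral_swap ?_
  exact ((measurable_indicator_upperDiagonal hY).comp measurable_swap).aemeasurable

/-- Norms are taken in Duhamel's formula, and the time interval is enlarged to the half-line. Values
in `ℝ≥0∞` allow infinite suprema or occupation times. -/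
theorem enorm_corrExt_le (h : IsJumpProcess (stateSpace π N) (particleGen π N) P X)
    (h0 : Integrable (fun ω => (1 + (mass (X 0 ω) : ℝ)) ^ 2) P) (hN : N ≠ 0)
    (hY : IsJumpProcess (closedTriangle N) (walkGen π N) μ Y) {p : ℕ × ℕ}
    (hp : p.1 = p.2 → π.c + π.d ≠ 0) (hY0 : ∀ᵐ w ∂μ, Y 0 w = p) {M G : ℝ≥0∞}
    (hM : ∀ x y : ℕ, 0 < x → x ≤ y → y < N → (x = y → π.c + π.d ≠ 0) →
      ‖corrExt π P X 0 (x, y)‖ₑ ≤ M)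
    (hG : ∀ t : ℝ≥0, ∀ z : ℕ, 0 < z → z + 1 < N → ‖source π P X t z‖ₑ ≤ G) (t : ℝ≥0) :
    ‖corrExt π P X t p‖ₑ ≤ M + G * ∫⁻ w, (∫⁻ t in Set.Ici (0 : ℝ),
      (upperDiagonal N).indicator (fun _ => (1 : ℝ≥0∞)) (Y t.toNNReal w)) ∂μ := by
  have := hY.isProbabilityMeasure
  rw [corrExt_eq_walk h h0 hN hY hp hY0 t, occupationTime_eq hY]
  refine (enorm_add_le _ _).trans (add_le_add ?_ ?_)
  · calc _ ≤ ∫⁻ w, ‖corrExt π P X 0 (Y t w)‖ₑ ∂μ := enorm_integral_le_lintegral_enorm _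
      _ ≤ ∫⁻ _, M ∂μ := by
        refine lintegral_mono_ae ?_
        filter_upwards [walk_ae_ne_diagonal hY hp hY0 t] with w hw
        by_cases hb : (Y t w).1 = 0 ∨ (Y t w).2 = N
        · rw [corrExt_boundary h hN hb, enorm_zero]; exact zero_le
        · push Not at hb
          obtain ⟨h1, h2⟩ := hY.mem t w
          have hx := Nat.pos_of_ne_zero hb.1
          have hy := lt_of_le_of_ne h2 hb.2
          exact hM _ _ hx h1 hy fun e => hw e ⟨hx, h1.trans_lt hy⟩
      _ = M := by simp
  · rw [intervalIntegral.integral_of_le t.coe_nonneg]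
    have hmeas : Measurable fun s : ℝ => ∫⁻ w,
        (upperDiagonal N).indicator (fun _ => (1 : ℝ≥0∞)) (Y s.toNNReal w) ∂μ := by
      exact (measurable_indicator_upperDiagonal hY).lintegral_prod_right'
    calc _ ≤ ∫⁻ s in Set.Ioc (0 : ℝ) t,
          ‖∫ w, sourceExt π P X ((t : ℝ) - s).toNNReal (Y s.toNNReal w) ∂μ‖ₑ :=
          enorm_integral_le_lintegral_enorm _
      _ ≤ ∫⁻ s in Set.Ioc (0 : ℝ) t, G * ∫⁻ w,
          (upperDiagonal N).indicator (fun _ => (1 : ℝ≥0∞)) (Y s.toNNReal w) ∂μ := by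
        refine lintegral_mono fun s => ?_
        refine (enorm_integral_le_lintegral_enorm _).trans ?_
        rw [← lintegral_const_mul]
        · refine lintegral_mono fun w => ?_
          by_cases hq : Y s.toNNReal w ∈ upperDiagonal N
          · simp only [sourceExt, Set.indicator_of_mem hq, mul_one]
            exact hG _ _ hq.1 (hq.2.1 ▸ hq.2.2)
          · simp [sourceExt, Set.indicator_of_notMem hq]
        · exact (Measurable.of_discrete (f := (upperDiagonal N).indicator
            fun _ => (1 : ℝ≥0∞))).comp (hY.measurable_eval _)
      _ = G * ∫⁻ s in Set.Ioc (0 : ℝ) t, ∫⁻ w,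
          (upperDiagonal N).indicator (fun _ => (1 : ℝ≥0∞)) (Y s.toNNReal w) ∂μ :=
        lintegral_const_mul _ hmeas
      _ ≤ _ := by
        gcongr
        exact fun s hs => hs.1.le

end Walk

/-! ### Moments, symmetry and the order of the barrier bound -/

section Main

variable {π : Params} {N : ℕ} {Ω : Type*} [MeasurableSpace Ω] {P : Measure Ω}
  {X : ℝ≥0 → Ω → Config N}

lemma integrable_one_add_mass_sq [IsProbabilityMeasure P]
    (hmom : ∀ x, MemLp (fun ω => (X 0 ω x : ℝ)) 2 P) :
    Integrable (fun ω => (1 + (mass (X 0 ω) : ℝ)) ^ 2) P := by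
  have h1 : MemLp (fun ω => (1 : ℝ) + ∑ x, (X 0 ω x : ℝ)) 2 P :=
    (memLp_const (1 : ℝ)).add (memLp_finsetSum (f := fun (x : Bulk N) ω => (X 0 ω x : ℝ))
      Finset.univ fun x _ => hmom x)
  simpa [mass] using h1.integrable_sq

lemma memLp_two_of_integrable_one_add_mass_sq
    (h : IsJumpProcess (stateSpace π N) (particleGen π N) P X) {t : ℝ≥0}
    (ht : Integrable (fun ω => (1 + (mass (X t ω) : ℝ)) ^ 2) P) (x : Bulk N) :
    MemLp (fun ω => (X t ω x : ℝ)) 2 P := by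
  have hm := h.measurable_comp (fun η => (η x : ℝ)) t
  rw [memLp_two_iff_integrable_sq hm.aestronglyMeasurable]
  refine ht.mono' (hm.pow_const 2).aestronglyMeasurable (Eventually.of_forall fun ω => ?_)
  have h1 := coe_le_mass (X t ω) x
  have h2 : (0 : ℝ) ≤ X t ω x := Nat.cast_nonneg _
  rw [Real.norm_eq_abs, abs_of_nonneg (by positivity)]
  gcongr
  linarith

lemma corr_comm (t : ℝ≥0) (x y : Bulk N) : corr π P X t x y = corr π P X t y x := by
  unfold corr
  by_cases h : x = y
  · subst h; rfl
  · rw [if_neg h, if_neg (Ne.symm h)]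
    simp only [mul_comm]

/-- `effLength` is at most a constant times `N`, and `N ≤ 2 (N - 1)` for `N ≥ 2`. Divided by the
factor `N²` of the time scale this bound is of order `1 / N`. -/
lemma effLength_sq_div_le (hN : 2 ≤ N) :
    effLength π N ^ 2 / (π.c * (N - 1))
      ≤ 2 * (1 + 1 / π.lamL + 1 / π.lamR) ^ 2 / π.c * N := by
  have hc := π.c_pos
  have h1 := π.lamL_pos
  have h2 := π.lamR_pos
  have hN2 : (2 : ℝ) ≤ N := by exact_mod_cast hN
  set K := 1 + 1 / π.lamL + 1 / π.lamR with hK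
  have hK0 : 0 < 1 / π.lamL + 1 / π.lamR := by positivity
  have hL : effLength π N ≤ K * N := by
    rw [effLength, hK]
    nlinarith
  have hL0 : 0 ≤ effLength π N := by linarith [le_effLength (π := π) (N := N)]
  rw [div_le_iff₀ (by nlinarith)]
  calc effLength π N ^ 2 ≤ (K * N) ^ 2 := by gcongr
    _ = K ^ 2 * N * N := by ring
    _ ≤ K ^ 2 * N * (2 * (N - 1)) := by gcongr; linarith
    _ = _ := by field_simp

end Main

end BoundaryDriven

end

/-! ### The theorem -/

theorem corollary1p2 (π : Params)
    {Ω : ℕ → Type*} [∀ N, MeasurableSpace (Ω N)] (P : ∀ N, Measure (Ω N))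
    (η : ∀ N, ℝ≥0 → Ω N → Config N)
    (hη : ∀ N, 2 ≤ N → IsJumpProcess (stateSpace π N) (particleGen π N) (P N) (η N))
    (hmom : ∀ N, 2 ≤ N → ∀ x, MemLp (fun ω => (η N 0 ω x : ℝ)) 2 (P N)) :
    -- second moments stay finite, so that the correlations are well defined at all times
    (∀ N, 2 ≤ N → ∀ t x, MemLp (fun ω => (η N t ω x : ℝ)) 2 (P N)) ∧
    -- the bound through the occupation time of the upper diagonal
    (∀ N, 2 ≤ N → ∀ {W : Type*} [MeasurableSpace W] (Q : ℕ × ℕ → Measure W)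
      (X : ℝ≥0 → W → ℕ × ℕ), IsTriangleWalk π N Q X → ∀ t : ℝ≥0,
        (⨆ p ∈ triangle π N, ‖corr π (P N) (η N) t p.1 p.2‖ₑ) ≤
          (⨆ p ∈ triangle π N, ‖corr π (P N) (η N) 0 p.1 p.2‖ₑ) +
          (⨆ r : ℝ≥0, ⨆ z ∈ {z : ℕ | 0 < z ∧ z + 1 < N}, ‖source π (P N) (η N) r z‖ₑ) *
          (⨆ p ∈ triangle π N, occupationTime N Q X (p.1, p.2))) ∧
    -- the decay of the correlations
    ((π.d ≠ 0 → ∃ C : ℝ, ∀ N, 2 ≤ N → ∀ x < N,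
        |density π (P N) (η N) 0 (x + 1) - density π (P N) (η N) 0 x| ≤ C / N) →
      (∃ C : ℝ, ∀ N, 2 ≤ N → ∀ p ∈ pairs π N, |corr π (P N) (η N) 0 p.1 p.2| ≤ C / N) →
      ∀ T : ℝ, 0 < T → ∃ C : ℝ, ∀ N, 2 ≤ N → ∀ t : ℝ≥0, (t : ℝ) ≤ T →
        ∀ p ∈ pairs π N, |corr π (P N) (η N) t p.1 p.2| ≤ C / N) := by
  have hint : ∀ N, 2 ≤ N → Integrable (fun ω => (1 + (mass (η N 0 ω) : ℝ)) ^ 2) (P N) :=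
    fun N hN => by
      have := (hη N hN).isProbabilityMeasure
      exact integrable_one_add_mass_sq (hmom N hN)
  refine ⟨fun N hN t x => ?_, fun N hN W _ Q X hX t => ?_, fun hgrad hcorr T _ => ?_⟩
  · obtain ⟨B, hB⟩ := (hη N hN).exists_integral_mass_sq_le (hint N hN) t
    exact memLp_two_of_integrable_one_add_mass_sq (hη N hN) (hB t le_rfl).1 x
  · refine iSup₂_le fun p hp => ?_
    obtain ⟨x, y⟩ := p
    obtain ⟨hpair, hle⟩ := hp
    have hmem : ((x : ℕ), (y : ℕ)) ∈ closedTriangle N := ⟨hle, y.2.2.le⟩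
    obtain ⟨hY, hY0⟩ := hX _ hmem
    have key := enorm_corrExt_le (hη N hN) (hint N hN) (by omega) hY
      (p := ((x : ℕ), (y : ℕ))) (fun e => hpair (Subtype.ext e)) hY0
      (M := ⨆ p ∈ triangle π N, ‖corr π (P N) (η N) 0 p.1 p.2‖ₑ)
      (G := ⨆ r : ℝ≥0, ⨆ z ∈ {z : ℕ | 0 < z ∧ z + 1 < N}, ‖source π (P N) (η N) r z‖ₑ)
      (fun a b ha hab hb hcd => by
        have h1 := corrExt_coe (hη N hN) (hint N hN) 0 ⟨a, ha, hab.trans_lt hb⟩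
          ⟨b, ha.trans_le hab, hb⟩
        rw [h1]
        exact le_iSup₂_of_le (f := fun (p : Bulk N × Bulk N) (_ : p ∈ triangle π N) =>
          ‖corr π (P N) (η N) 0 p.1 p.2‖ₑ) (⟨a, ha, hab.trans_lt hb⟩, ⟨b, ha.trans_le hab, hb⟩)
          ⟨fun e => hcd (congrArg Subtype.val e), hab⟩ le_rfl)
      (fun r z hz hzN => le_iSup_of_le r (le_iSup₂_of_le (f := fun (z : ℕ)
        (_ : z ∈ {z : ℕ | 0 < z ∧ z + 1 < N}) => ‖source π (P N) (η N) r z‖ₑ) z ⟨hz, hzN⟩ le_rfl))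
      t
    rw [corrExt_coe (hη N hN) (hint N hN)] at key
    refine key.trans ?_
    gcongr
    exact le_iSup₂_of_le (f := fun (p : Bulk N × Bulk N) (_ : p ∈ triangle π N) =>
      occupationTime N Q X ((p.1 : ℕ), (p.2 : ℕ))) (x, y) ⟨hpair, hle⟩ le_rfl
  · obtain ⟨C₀, hC₀⟩ := hcorr
    obtain ⟨G, hG0, hG⟩ : ∃ G : ℝ, 0 ≤ G ∧ ∀ N, 2 ≤ N → ∀ t : ℝ≥0, ∀ z : ℕ, 0 < z → z + 1 < N →
        |source π (P N) (η N) t z| ≤ G := by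
      -- Without interaction the source vanishes, so no hypothesis on the gradient is needed;
      -- otherwise the factor `N²` cancels the square of the `1 / N` gradient.
      by_cases hd : π.d = 0
      · exact ⟨0, le_rfl, fun N _ t z _ _ => by simp [source, hd]⟩
      · obtain ⟨C₁, hC₁⟩ := hgrad hd
        refine ⟨|π.d| * (C₁ / min π.lamL π.lamR) ^ 2, by positivity, fun N hN t z hz hzN => ?_⟩
        have hN0 : (0 : ℝ) < N := by exact_mod_cast (by omega : 0 < N)
        have h1 := abs_density_gradient_le (hη N hN) (hint N hN) (hC₁ N hN) t
          (show z < N by omega)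
        have h2 := pow_le_pow_left₀ (abs_nonneg _) h1 2
        rw [sq_abs] at h2
        rw [source, abs_mul, abs_mul, abs_sq, abs_sq, mul_assoc]
        refine mul_le_mul_of_nonneg_left ?_ (abs_nonneg _)
        calc _ ≤ (N : ℝ) ^ 2 * (C₁ / N / min π.lamL π.lamR) ^ 2 := by gcongr
          _ = _ := by field_simp
    -- The constant does not depend on `T`, since the barrier bound is uniform in time.
    refine ⟨|C₀| + G * (2 * (1 + 1 / π.lamL + 1 / π.lamR) ^ 2 / π.c), fun N hN t _ => ?_⟩
    have hN0 : (0 : ℝ) < N := by exact_mod_cast (by omega : 0 < N)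
    have hN1 : (0 : ℝ) < N - 1 := by
      have : (2 : ℝ) ≤ N := by exact_mod_cast hN
      linarith
    have hc := π.c_pos
    have key : ∀ x y : Bulk N, x ≤ y → (x = y → π.c + π.d ≠ 0) →
        |corr π (P N) (η N) t x y|
          ≤ (|C₀| + G * (2 * (1 + 1 / π.lamL + 1 / π.lamR) ^ 2 / π.c)) / N := by
      intro x y hxy hcd
      have h1 := abs_corrExt_le (hη N hN) (hint N hN) hN (M := |C₀| / N) (by positivity) hG0
        (fun a b ha hab hb hcd => by
          rw [corrExt_coe (hη N hN) (hint N hN) 0 ⟨a, ha, hab.trans_lt hb⟩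
            ⟨b, ha.trans_le hab, hb⟩]
          refine (hC₀ N hN (⟨a, ha, hab.trans_lt hb⟩, ⟨b, ha.trans_le hab, hb⟩)
            fun e => hcd (congrArg Subtype.val e)).trans ?_
          gcongr
          exact le_abs_self C₀)
        (hG N hN) t x.2.1 hxy y.2.2 (fun e => hcd (Subtype.ext e))
      rw [corrExt_coe (hη N hN) (hint N hN)] at h1
      refine h1.trans ?_
      have h2 := mul_le_mul_of_nonneg_left (effLength_sq_div_le (π := π) hN)
        (by positivity : 0 ≤ G / (N : ℝ) ^ 2)
      rw [add_div]
      refine add_le_add le_rfl ?_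
      calc _ = G / (N : ℝ) ^ 2 * (effLength π N ^ 2 / (π.c * (N - 1))) := by field_simp
        _ ≤ _ := h2
        _ = _ := by field_simp
    rintro ⟨x, y⟩ hp
    rcases le_total x y with hxy | hxy
    · exact key x y hxy hp
    · rw [corr_comm]
      exact key y x hxy fun e => hp e.symm
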